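/- **Setting.** Let $Q$ be a smooth manifold (Hausdorff, second countable, finite-dimensional, without boundary) and $\pi:E_Q\to Q$ a smooth real vector bundle of finite rank with a Lie–Poisson structure $\Psi$, i.e. a smooth vertical bivector field whose restriction to every fibre is a linear Poisson structure. Then $E_Q^*$ is a bundle of Lie algebras with bracket $\ell_{[\eta_1,\eta_2]}=\Psi(\mathrm d\ell_{\eta_1},\mathrm d\ell_{\eta_2})$, where $\ell_\eta$ is the fibrewise linear function of $\eta\in\Gamma(E_Q^*)$. Put $\mathrm{ad}_\eta=[\eta,\cdot]$ and let $\mathrm{ad}^*_\eta$ be its transpose, $\langle\theta,\mathrm{ad}_\eta^*y\rangle=\langle[\eta,\theta],y\rangle$. For a linear connection $\nabla$ on $E_Q$ let $\nabla^*$ be the dual connection on $E_Q^*$, $v\langle\eta,\zeta\rangle=\langle\nabla^*_v\eta,\zeta\rangle+\langle\eta,\nabla_v\zeta\rangle$, and for an $E_Q^*$-valued form $\omega$ on $Q$ let $\nabla\omega$ be its covariant exterior derivative with respect to $\nabla^*$. A pair $(\nabla,\mathbf F)$ of a smooth linear connection on $E_Q$ and a smooth $\mathbf F\in\Omega^2(Q)\otimes\Gamma(E_Q^*)$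 is called *compatible* if (i) $[\nabla_v,\mathrm{ad}^*_\eta]=\mathrm{ad}^*_{\nabla^*_v\eta}$ for all $v\in\mathfrak X(Q)$, $\eta\in\Gamma(E_Q^*)$; (ii) $\mathrm{Curv}^\nabla=-\mathrm{ad}^*_{\mathbf F}$; (iii) $\nabla\mathbf F=0$. Let $G$ be a compact connected Lie group with Lie algebra $\mathfrak g$ and normalized Haar measure $\mathrm dg$, acting smoothly on $E_Q$ with infinitesimal generators $\Upsilon_a=\mathrm{ad}^*_{s_a}y\cdot\partial/\partial y$, where $\mathfrak g\ni a\mapsto s_a\in\Gamma(E_Q^*)$ is linear. Fix a measurable map $g\mapsto a(g)\in\mathfrak g$, taking values in a compact set for almost every $g$, with $\exp a(g)=g$ for almost every $g\in G$ (a logarithm, as used in the averaging formula). **Proposition.** The action preserves the fibres of $E_Q$, is linear on them, $(q,y)\mapsto(q,\Phi_g y)$, and lifts to smooth maps $\bar\Phi_g(q,p,y)=(q,p,\Phi_gy)$ of the total space $E=\tau^*E_Q$ of the pull-back along $\tau:T^*Q\to Q$. Let $(\nabla_0,\mathbf F_0)$ be a compatible pair. Then: 1. The formulas $$\mathbf A=-\int_G\Big(\int_0^1\mathrm{Ad}_{\exp(ts_a)}\nabla_0^*s_a\,\mathrm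 dt\Big)\mathrm dg,\quad a=a(g),\ \ \mathrm{Ad}_{\exp(ts_a)}=\exp(t\,\mathrm{ad}_{s_a}),\qquad \mathbf F=\mathbf F_0+\nabla_0\mathbf A+\tfrac12[\mathbf A\wedge\mathbf A]$$ (where $\tfrac12[\mathbf A\wedge\mathbf A](v,w)=[\mathbf A(v),\mathbf A(w)]$) have convergent integrals and define a smooth $1$-form and a smooth $2$-form on $Q$ with values in $E_Q^*$. 2. With $\nabla=\nabla_0-\mathrm{ad}^*_{\mathbf A}$, the pair $(\nabla,\mathbf F)$ is compatible, i.e. satisfies (i)–(iii). 3. $(\nabla,\mathbf F)$ is $G$-invariant: $\nabla_v(\Phi_g\zeta)=\Phi_g\nabla_v\zeta$ and $\langle\mathbf F(v,w),\Phi_gy\rangle=\langle\mathbf F(v,w),y\rangle$ for all $g\in G$. 4. There is a unique Poisson structure $\Pi=\Pi^{\nabla,\mathbf F}$ on $E$ with the brackets $$\{f,h\}=0,\quad \{P_v,f\}=v(f),\quad \{f,\ell_\eta\}=0,\quad \{P_v,\ell_\eta\}=\ell_{\nabla^*_v\eta},\quad \{P_v,P_w\}=P_{[v,w]}+\ell_{\mathbf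 F(v,w)},\quad \{\ell_\eta,\ell_\theta\}=\ell_{[\eta,\theta]}$$ for $f,h\in C^\infty(Q)$, $v,w\in\mathfrak X(Q)$, $\eta,\theta\in\Gamma(E_Q^*)$, where $P_v(q,p,y)=\langle p,v(q)\rangle$ (in coordinates: $\{p_i,q^j\}=\delta_i^j$, $\{p_i,p_j\}=\ell_{\mathbf F_{ij}}$, and so on). Every $\bar\Phi_g$ preserves this Poisson structure. 5. For every pseudo-Riemannian metric on $Q$, the Hamiltonian $\mathcal H=\tfrac12g^{ij}(q)p_ip_j$ is a smooth function on $E$, and the generalized Wong system $(E,\Pi,\mathcal H)$, $\dot f=\{\mathcal H,f\}$, is $G$-symmetric: $\mathcal H\circ\bar\Phi_g=\mathcal H$, and $\bar\Phi_g$ maps solution curves to solution curves. -/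

import Mathlib

set_option maxSynthPendingDepth 3
set_option linter.unusedSectionVars false

open Bundle MeasureTheory VectorField
open scoped Manifold ContDiff Bundle

noncomputable section

namespace Wong

/-! ### Lie-Poisson bundles -/

section LiePoisson

variable {EQ : Type*} [NormedAddCommGroup EQ] [NormedSpace ℝ EQ]
  {Q : Type*} [TopologicalSpace Q] [ChartedSpace EQ Q]
  {F : Type*} [NormedAddCommGroup F] [NormedSpace ℝ F]
  {V : Q → Type*} [TopologicalSpace (TotalSpace F V)]
  [∀ q, AddCommGroup (V q)] [∀ q, Module ℝ (V q)] [∀ q, TopologicalSpace (V q)]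
  [∀ q, IsTopologicalAddGroup (V q)] [∀ q, ContinuousSMul ℝ (V q)]
  [FiberBundle F V] [VectorBundle ℝ F V]

/-- The fibre over `q` of the dual bundle of `V`. -/
abbrev DualFib (V : Q → Type*) [∀ q, AddCommGroup (V q)] [∀ q, Module ℝ (V q)]
    [∀ q, TopologicalSpace (V q)] (q : Q) : Type _ := V q →L[ℝ] ℝ

variable (EQ F V) in
/-- A Lie-Poisson structure on the vector bundle `V → Q`: a smooth vertical bivector field on the
total space whose restriction to every fibre is linear and Poisson. `Psi q α β y` is the value, at
the point `y` of the fibre over `q`, of the bivector field on the covectors `α, β` of that fibre;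
thus `Psi q α β` is the Poisson bracket of the linear functions `α`, `β` on the fibre.
Since it is again a linear function, being Poisson means the Jacobi identity for linear functions.
-/
structure LiePoissonStructure where
  Psi : ∀ q : Q, DualFib V q →L[ℝ] DualFib V q →L[ℝ] DualFib V q
  contMDiff : ContMDiff 𝓘(ℝ, EQ)
    (𝓘(ℝ, EQ).prod 𝓘(ℝ, (F →L[ℝ] ℝ) →L[ℝ] (F →L[ℝ] ℝ) →L[ℝ] (F →L[ℝ] ℝ))) ∞
    (fun q ↦ TotalSpace.mk' ((F →L[ℝ] ℝ) →L[ℝ] (F →L[ℝ] ℝ) →L[ℝ] (F →L[ℝ] ℝ)) q (Psi q))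
  skew : ∀ q α, Psi q α α = 0
  jacobi : ∀ q α β γ,
    Psi q α (Psi q β γ) + Psi q β (Psi q γ α) + Psi q γ (Psi q α β) = 0

/-- The canonical isomorphism of a finite-dimensional space with its bidual. -/
def bidual (W : Type*) [AddCommGroup W] [Module ℝ W] [TopologicalSpace W]
    [IsTopologicalAddGroup W] [ContinuousSMul ℝ W] [T2Space W] [FiniteDimensional ℝ W] :
    W ≃L[ℝ] ((W →L[ℝ] ℝ) →L[ℝ] ℝ) :=
  have _h : FiniteDimensional ℝ (W →L[ℝ] ℝ) :=
    (LinearMap.toContinuousLinearMap (𝕜 := ℝ) (E := W) (F' := ℝ)).finiteDimensional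
  ((Module.evalEquiv ℝ W).trans
    (((LinearMap.toContinuousLinearMap (𝕜 := ℝ) (E := W) (F' := ℝ)).symm.dualMap).trans
      (LinearMap.toContinuousLinearMap (𝕜 := ℝ) (E := W →L[ℝ] ℝ) (F' := ℝ)))).toContinuousLinearEquiv

theorem bidual_apply (W : Type*) [AddCommGroup W] [Module ℝ W] [TopologicalSpace W]
    [IsTopologicalAddGroup W] [ContinuousSMul ℝ W] [T2Space W] [FiniteDimensional ℝ W]
    (y : W) (η : W →L[ℝ] ℝ) : bidual W y η = η y := rfl

/-- The co-adjoint operator `ad_ξ^*` on the fibre over `q`: the transpose of `ad_ξ = [ξ, ·]`. -/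
def coad [FiniteDimensional ℝ F] (Ψ : LiePoissonStructure EQ F V) (q : Q) (ξ : DualFib V q) :
    V q →L[ℝ] V q :=
  have _h : T2Space (V q) := FiberBundle.t2Space F V q
  have _h' : FiniteDimensional ℝ (V q) := VectorBundle.finiteDimensional ℝ F V q
  ((bidual (V q)).symm : ((V q →L[ℝ] ℝ) →L[ℝ] ℝ) →L[ℝ] V q) ∘L
    (ContinuousLinearMap.precomp ℝ (Ψ.Psi q ξ)) ∘L
      ((bidual (V q) : V q →L[ℝ] ((V q →L[ℝ] ℝ) →L[ℝ] ℝ)))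

theorem apply_coad [FiniteDimensional ℝ F] (Ψ : LiePoissonStructure EQ F V) (q : Q)
    (ξ θ : DualFib V q) (y : V q) : θ (coad Ψ q ξ y) = Ψ.Psi q ξ θ y := by
  have _h : T2Space (V q) := FiberBundle.t2Space F V q
  have _h' : FiniteDimensional ℝ (V q) := VectorBundle.finiteDimensional ℝ F V q
  rw [← bidual_apply (V q) (coad Ψ q ξ y) θ]
  simp [coad, bidual_apply]

/-- For a one-form `A` with values in the dual bundle, the endomorphism-valued one-form `-ad_A^*`,
`(y, v) ↦ - ad_{A(v)}^* y`. -/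
def negCoadForm [FiniteDimensional ℝ EQ] [FiniteDimensional ℝ F] (Ψ : LiePoissonStructure EQ F V)
    (A : ∀ q : Q, TangentSpace 𝓘(ℝ, EQ) q →L[ℝ] DualFib V q) (q : Q) :
    V q →L[ℝ] TangentSpace 𝓘(ℝ, EQ) q →L[ℝ] V q :=
  have _h : T2Space (V q) := FiberBundle.t2Space F V q
  have _h' : FiniteDimensional ℝ (V q) := VectorBundle.finiteDimensional ℝ F V q
  have ext : ∀ y z : V q, (∀ θ : DualFib V q, θ y = θ z) → y = z := fun y z h =>
    (bidual (V q)).injective (by ext θ; exact h θ)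
  have _h2 : T2Space (TangentSpace 𝓘(ℝ, EQ) q) := inferInstanceAs (T2Space EQ)
  have _h3 : FiniteDimensional ℝ (TangentSpace 𝓘(ℝ, EQ) q) :=
    inferInstanceAs (FiniteDimensional ℝ EQ)
  LinearMap.toContinuousLinearMap
    { toFun := fun y => LinearMap.toContinuousLinearMap
        { toFun := fun v => -coad Ψ q (A q v) y
          map_add' := fun v w => ext _ _ fun θ => by simp [apply_coad]; ring
          map_smul' := fun c v => ext _ _ fun θ => by simp [apply_coad] }
      map_add' := fun y z => by ext v; simp; abel
      map_smul' := fun c y => by ext v; simp }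

theorem negCoadForm_apply [FiniteDimensional ℝ EQ] [FiniteDimensional ℝ F]
    (Ψ : LiePoissonStructure EQ F V)
    (A : ∀ q : Q, TangentSpace 𝓘(ℝ, EQ) q →L[ℝ] DualFib V q) (q : Q) (y : V q)
    (v : TangentSpace 𝓘(ℝ, EQ) q) : negCoadForm Ψ A q y v = -coad Ψ q (A q v) y := rfl

end LiePoisson

/-! ### Connections, bundle-valued forms and the compatibility conditions -/

section Connection

variable {EQ : Type*} [NormedAddCommGroup EQ] [NormedSpace ℝ EQ] [FiniteDimensional ℝ EQ]
  {Q : Type*} [TopologicalSpace Q] [ChartedSpace EQ Q] [IsManifold 𝓘(ℝ, EQ) ∞ Q]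
  {F : Type*} [NormedAddCommGroup F] [NormedSpace ℝ F] [FiniteDimensional ℝ F]
  {V : Q → Type*} [TopologicalSpace (TotalSpace F V)]
  [∀ q, AddCommGroup (V q)] [∀ q, Module ℝ (V q)] [∀ q, TopologicalSpace (V q)]
  [∀ q, IsTopologicalAddGroup (V q)] [∀ q, ContinuousSMul ℝ (V q)]
  [FiberBundle F V] [VectorBundle ℝ F V] [ContMDiffVectorBundle ∞ F V 𝓘(ℝ, EQ)]

theorem mdiff_pair {η : ∀ q, DualFib V q} {σ : ∀ q, V q} {q : Q}
    (hη : MDifferentiableAt 𝓘(ℝ, EQ) (𝓘(ℝ, EQ).prod 𝓘(ℝ, F →L[ℝ] ℝ))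
      (fun x ↦ TotalSpace.mk' (F →L[ℝ] ℝ) x (η x)) q)
    (hσ : MDifferentiableAt 𝓘(ℝ, EQ) (𝓘(ℝ, EQ).prod 𝓘(ℝ, F))
      (fun x ↦ TotalSpace.mk' F x (σ x)) q) :
    MDifferentiableAt 𝓘(ℝ, EQ) 𝓘(ℝ, ℝ) (fun x ↦ η x (σ x)) q := by
  have h := MDifferentiableAt.clm_bundle_apply (F₁ := F) (F₂ := ℝ) (E₂ := Bundle.Trivial Q ℝ)
    (b := fun x : Q => x) (ϕ := η) hη hσ
  simp only [mdifferentiableAt_totalSpace] at h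
  exact h.2

theorem tensorialAt_dual (nabla : CovariantDerivative 𝓘(ℝ, EQ) F V) {η : ∀ q, DualFib V q}
    {q : Q} (v : TangentSpace 𝓘(ℝ, EQ) q)
    (hη : MDifferentiableAt 𝓘(ℝ, EQ) (𝓘(ℝ, EQ).prod 𝓘(ℝ, F →L[ℝ] ℝ))
      (fun x ↦ TotalSpace.mk' (F →L[ℝ] ℝ) x (η x)) q) :
    TensorialAt 𝓘(ℝ, EQ) F
      (fun σ : ∀ x, V x => mvfderiv 𝓘(ℝ, EQ) (fun x => η x (σ x)) q v - η q (nabla σ q v)) q where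
  smul {f σ} hf hσ := by
    have h := mvfderiv_fun_mul hf (mdiff_pair hη hσ)
    simp [nabla.isCovariantDerivativeOn.leibniz hσ hf, h]
    ring
  add {σ σ'} hσ hσ' := by
    have h := mvfderiv_fun_add (mdiff_pair hη hσ) (mdiff_pair hη hσ')
    simp [nabla.isCovariantDerivativeOn.add hσ hσ', h]
    ring

open Classical in
/-- The dual connection `∇^*`: `⟨∇_v^* η, y⟩ = v ⟨η, σ⟩ - ⟨η, ∇_v σ⟩` for every section `σ` through
`y` (and the value `0` if the section `η` of the dual bundle is not differentiable at `q`). -/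
def dualCov (nabla : CovariantDerivative 𝓘(ℝ, EQ) F V) (η : ∀ q, DualFib V q) (q : Q)
    (v : TangentSpace 𝓘(ℝ, EQ) q) : DualFib V q :=
  if hη : MDifferentiableAt 𝓘(ℝ, EQ) (𝓘(ℝ, EQ).prod 𝓘(ℝ, F →L[ℝ] ℝ))
      (fun x ↦ TotalSpace.mk' (F →L[ℝ] ℝ) x (η x)) q then
    TensorialAt.mkHom _ q (tensorialAt_dual nabla v hη)
  else 0

theorem dualCov_apply (nabla : CovariantDerivative 𝓘(ℝ, EQ) F V) {η : ∀ q, DualFib V q}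
    {q : Q} (v : TangentSpace 𝓘(ℝ, EQ) q)
    (hη : MDifferentiableAt 𝓘(ℝ, EQ) (𝓘(ℝ, EQ).prod 𝓘(ℝ, F →L[ℝ] ℝ))
      (fun x ↦ TotalSpace.mk' (F →L[ℝ] ℝ) x (η x)) q) {σ : ∀ x, V x}
    (hσ : MDifferentiableAt 𝓘(ℝ, EQ) (𝓘(ℝ, EQ).prod 𝓘(ℝ, F))
      (fun x ↦ TotalSpace.mk' F x (σ x)) q) :
    dualCov nabla η q v (σ q)
      = mvfderiv 𝓘(ℝ, EQ) (fun x => η x (σ x)) q v - η q (nabla σ q v) := by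
  rw [dualCov, dif_pos hη]
  exact TensorialAt.mkHom_apply _ hσ

/-- Smooth vector fields on `Q`. -/
abbrev VectorFields (EQ Q : Type*) [NormedAddCommGroup EQ] [NormedSpace ℝ EQ] [TopologicalSpace Q]
    [ChartedSpace EQ Q] [IsManifold 𝓘(ℝ, EQ) ∞ Q] : Type _ :=
  Cₛ^∞⟮𝓘(ℝ, EQ); EQ, (TangentSpace 𝓘(ℝ, EQ) : Q → Type _)⟯

/-- Smooth one-forms on `Q` with values in the dual bundle. -/
def IsSmoothOneForm (F : Type*) [NormedAddCommGroup F] [NormedSpace ℝ F]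
    {V : Q → Type*} [TopologicalSpace (TotalSpace F V)]
    [∀ q, AddCommGroup (V q)] [∀ q, Module ℝ (V q)] [∀ q, TopologicalSpace (V q)]
    [∀ q, IsTopologicalAddGroup (V q)] [∀ q, ContinuousSMul ℝ (V q)]
    [FiberBundle F V] [VectorBundle ℝ F V]
    (A : ∀ q : Q, TangentSpace 𝓘(ℝ, EQ) q →L[ℝ] DualFib V q) : Prop :=
  ContMDiff 𝓘(ℝ, EQ) (𝓘(ℝ, EQ).prod 𝓘(ℝ, EQ →L[ℝ] F →L[ℝ] ℝ)) ∞
    (fun q ↦ TotalSpace.mk' (EQ →L[ℝ] F →L[ℝ] ℝ) q (A q))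

/-- Smooth (alternating) two-forms on `Q` with values in the dual bundle. -/
structure IsSmoothTwoForm (F : Type*) [NormedAddCommGroup F] [NormedSpace ℝ F]
    {V : Q → Type*} [TopologicalSpace (TotalSpace F V)]
    [∀ q, AddCommGroup (V q)] [∀ q, Module ℝ (V q)] [∀ q, TopologicalSpace (V q)]
    [∀ q, IsTopologicalAddGroup (V q)] [∀ q, ContinuousSMul ℝ (V q)]
    [FiberBundle F V] [VectorBundle ℝ F V]
    (B : ∀ q : Q, TangentSpace 𝓘(ℝ, EQ) q →L[ℝ] TangentSpace 𝓘(ℝ, EQ) q →L[ℝ] DualFib V q) :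
    Prop where
  contMDiff : ContMDiff 𝓘(ℝ, EQ) (𝓘(ℝ, EQ).prod 𝓘(ℝ, EQ →L[ℝ] EQ →L[ℝ] F →L[ℝ] ℝ)) ∞
    (fun q ↦ TotalSpace.mk' (EQ →L[ℝ] EQ →L[ℝ] F →L[ℝ] ℝ) q (B q))
  alternating : ∀ q v, B q v v = 0

/-- The covariant exterior derivative of a one-form with values in the dual bundle, on two vector
fields: `(∇A)(v, w) = ∇_v^*(A(w)) - ∇_w^*(A(v)) - A([v, w])`. -/
def covExtDeriv₁ (nabla : CovariantDerivative 𝓘(ℝ, EQ) F V)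
    (A : ∀ q : Q, TangentSpace 𝓘(ℝ, EQ) q →L[ℝ] DualFib V q)
    (v w : ∀ q : Q, TangentSpace 𝓘(ℝ, EQ) q) (q : Q) : DualFib V q :=
  dualCov nabla (fun x => A x (w x)) q (v q) - dualCov nabla (fun x => A x (v x)) q (w q)
    - A q (mlieBracket 𝓘(ℝ, EQ) v w q)

/-- The covariant exterior derivative of a two-form with values in the dual bundle, on three vector
fields: the cyclic sum of `∇_u^*(B(v, w)) - B([u, v], w)`. -/
def covExtDeriv₂ (nabla : CovariantDerivative 𝓘(ℝ, EQ) F V)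
    (B : ∀ q : Q, TangentSpace 𝓘(ℝ, EQ) q →L[ℝ] TangentSpace 𝓘(ℝ, EQ) q →L[ℝ] DualFib V q)
    (u v w : ∀ q : Q, TangentSpace 𝓘(ℝ, EQ) q) (q : Q) : DualFib V q :=
  (dualCov nabla (fun x => B x (v x) (w x)) q (u q) - B q (mlieBracket 𝓘(ℝ, EQ) u v q) (w q))
    + (dualCov nabla (fun x => B x (w x) (u x)) q (v q) - B q (mlieBracket 𝓘(ℝ, EQ) v w q) (u q))
    + (dualCov nabla (fun x => B x (u x) (v x)) q (w q) - B q (mlieBracket 𝓘(ℝ, EQ) w u q) (v q))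

/-- The pair `(∇, B)` consists of a smooth linear connection on `V` and a smooth two-form with
values in the dual bundle such that
* `∇` preserves the fibrewise bracket, `[∇_v, ad_η^*] = ad_{∇_v^* η}^*`;
* the curvature of `∇` is `-ad_B^*`;
* `B` is covariantly constant: its covariant exterior derivative vanishes. -/
structure IsCompatiblePair (Ψ : LiePoissonStructure EQ F V)
    (nabla : CovariantDerivative 𝓘(ℝ, EQ) F V)
    (B : ∀ q : Q, TangentSpace 𝓘(ℝ, EQ) q →L[ℝ] TangentSpace 𝓘(ℝ, EQ) q →L[ℝ] DualFib V q) :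
    Prop where
  smooth_connection : nabla.ContMDiffCovariantDerivative ∞
  smooth_form : IsSmoothTwoForm F B
  preserves : ∀ (v : VectorFields EQ Q) (η : Cₛ^∞⟮𝓘(ℝ, EQ); F →L[ℝ] ℝ, DualFib V⟯)
    (ζ : Cₛ^∞⟮𝓘(ℝ, EQ); F, V⟯) (q : Q),
    nabla (fun x => coad Ψ x (η x) (ζ x)) q (v q) - coad Ψ q (η q) (nabla ζ q (v q))
      = coad Ψ q (dualCov nabla η q (v q)) (ζ q)
  curvature : ∀ (v w : VectorFields EQ Q) (ζ : Cₛ^∞⟮𝓘(ℝ, EQ); F, V⟯) (q : Q),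
    nabla (fun x => nabla ζ x (w x)) q (v q) - nabla (fun x => nabla ζ x (v x)) q (w q)
        - nabla ζ q (mlieBracket 𝓘(ℝ, EQ) v w q)
      = -coad Ψ q (B q (v q) (w q)) (ζ q)
  covariantly_constant : ∀ (u v w : VectorFields EQ Q) (q : Q), covExtDeriv₂ nabla B u v w q = 0

end Connection

/-! ### The averaged one-form -/

section Averaging

variable {EQ : Type*} [NormedAddCommGroup EQ] [NormedSpace ℝ EQ] [FiniteDimensional ℝ EQ]
  {Q : Type*} [TopologicalSpace Q] [ChartedSpace EQ Q] [IsManifold 𝓘(ℝ, EQ) ∞ Q]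
  {F : Type*} [NormedAddCommGroup F] [NormedSpace ℝ F] [FiniteDimensional ℝ F]
  {V : Q → Type*} [TopologicalSpace (TotalSpace F V)]
  [∀ q, AddCommGroup (V q)] [∀ q, Module ℝ (V q)] [∀ q, TopologicalSpace (V q)]
  [∀ q, IsTopologicalAddGroup (V q)] [∀ q, ContinuousSMul ℝ (V q)]
  [FiberBundle F V] [VectorBundle ℝ F V] [ContMDiffVectorBundle ∞ F V 𝓘(ℝ, EQ)]
  {EG : Type*} [NormedAddCommGroup EG] [NormedSpace ℝ EG]
  {G : Type*} [TopologicalSpace G] [ChartedSpace EG G] [Group G]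

/-- `g = exp a`: there is a smooth one-parameter subgroup with velocity `a` at `0` which is at `g`
at time `1`. -/
def IsExp (a : GroupLieAlgebra 𝓘(ℝ, EG) G) (g : G) : Prop :=
  ∃ γ : ℝ → G, ContMDiff 𝓘(ℝ, ℝ) 𝓘(ℝ, EG) ∞ γ ∧ (∀ t t', γ (t + t') = γ t * γ t') ∧
    (mfderiv 𝓘(ℝ, ℝ) 𝓘(ℝ, EG) γ 0 (1 : ℝ) : EG) = (a : EG) ∧ γ 1 = g

/-- A bounded measurable choice `g ↦ a(g)` of logarithms, `exp a(g) = g` for almost every `g`. -/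
structure IsLogChoice [MeasurableSpace G] (μ : Measure G)
    (log : G → GroupLieAlgebra 𝓘(ℝ, EG) G) : Prop where
  measurable : AEStronglyMeasurable log μ
  bounded : ∃ K : Set (GroupLieAlgebra 𝓘(ℝ, EG) G), IsCompact K ∧ ∀ᵐ g ∂μ, log g ∈ K
  exp_log : ∀ᵐ g ∂μ, IsExp (log g) g

/-- The tangent vector at `z` of the curve `t ↦ y + t w` in the fibre of the point `z = (q, y)`. -/
def verticalVector (z : TotalSpace F V) (w : V z.1) :
    TangentSpace (𝓘(ℝ, EQ).prod 𝓘(ℝ, F)) z :=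
  (mfderiv 𝓘(ℝ, ℝ) (𝓘(ℝ, EQ).prod 𝓘(ℝ, F))
    (fun t : ℝ => (⟨z.1, z.2 + t • w⟩ : TotalSpace F V)) 0 (1 : ℝ) : EQ × F)

/-- The action of `G` on the total space of `V` has the infinitesimal generators
`Υ_a = ad_{s_a}^* y · ∂/∂y`. -/
def HasCoadGenerators [MulAction G (TotalSpace F V)] (Ψ : LiePoissonStructure EQ F V)
    (s : GroupLieAlgebra 𝓘(ℝ, EG) G →ₗ[ℝ] Cₛ^∞⟮𝓘(ℝ, EQ); F →L[ℝ] ℝ, DualFib V⟯) : Prop :=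
  ∀ (a : GroupLieAlgebra 𝓘(ℝ, EG) G) (z : TotalSpace F V),
    (mfderiv 𝓘(ℝ, EG) (𝓘(ℝ, EQ).prod 𝓘(ℝ, F)) (fun g : G => g • z) 1 a : EQ × F)
      = (verticalVector z (coad Ψ z.1 (s a z.1) z.2) : EQ × F)

/-- `Ad_{exp(t ξ)} η = exp(t ad_ξ) η` in the Lie algebra `(V q)^*`. -/
def adExp (Ψ : LiePoissonStructure EQ F V) (q : Q) (t : ℝ) (ξ η : DualFib V q) : DualFib V q :=
  ∑' n : ℕ, (t ^ n / (n.factorial : ℝ)) • (fun θ => Ψ.Psi q ξ θ)^[n] η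

/-- The one-form `A` is given by the averaging formula
`A = - ∫_G (∫_0^1 Ad_{exp(t s_a)} ∇^* s_a dt) dg`, `g = exp a`, for the choice `a = log g`.
The integrals in the finite-dimensional spaces `(V q)^*` are taken after evaluation at `y ∈ V q`. -/
structure IsAveragedForm (Ψ : LiePoissonStructure EQ F V)
    (nabla : CovariantDerivative 𝓘(ℝ, EQ) F V)
    (s : GroupLieAlgebra 𝓘(ℝ, EG) G →ₗ[ℝ] Cₛ^∞⟮𝓘(ℝ, EQ); F →L[ℝ] ℝ, DualFib V⟯)
    [MeasurableSpace G] (μ : Measure G) (log : G → GroupLieAlgebra 𝓘(ℝ, EG) G)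
    (A : ∀ q : Q, TangentSpace 𝓘(ℝ, EQ) q →L[ℝ] DualFib V q) : Prop where
  summable : ∀ a q v (t : ℝ), Summable fun n : ℕ =>
    (t ^ n / (n.factorial : ℝ)) • (fun θ => Ψ.Psi q (s a q) θ)^[n] (dualCov nabla (s a) q v)
  intervalIntegrable : ∀ a q v (y : V q), IntervalIntegrable
    (fun t => adExp Ψ q t (s a q) (dualCov nabla (s a) q v) y) volume 0 1
  integrable : ∀ q v (y : V q), Integrable
    (fun g => ∫ t in (0 : ℝ)..1,
      adExp Ψ q t (s (log g) q) (dualCov nabla (s (log g)) q v) y) μ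
  formula : ∀ q v (y : V q), A q v y = -∫ g, (∫ t in (0 : ℝ)..1,
      adExp Ψ q t (s (log g) q) (dualCov nabla (s (log g)) q v) y) ∂μ

/-- The two-form `B` is `B₀ + ∇A + ½ [A ∧ A]`, where `½ [A ∧ A](v, w) = [A(v), A(w)]`. -/
def IsGaugedForm (Ψ : LiePoissonStructure EQ F V) (nabla : CovariantDerivative 𝓘(ℝ, EQ) F V)
    (B₀ : ∀ q : Q, TangentSpace 𝓘(ℝ, EQ) q →L[ℝ] TangentSpace 𝓘(ℝ, EQ) q →L[ℝ] DualFib V q)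
    (A : ∀ q : Q, TangentSpace 𝓘(ℝ, EQ) q →L[ℝ] DualFib V q)
    (B : ∀ q : Q, TangentSpace 𝓘(ℝ, EQ) q →L[ℝ] TangentSpace 𝓘(ℝ, EQ) q →L[ℝ] DualFib V q) :
    Prop :=
  ∀ (v w : VectorFields EQ Q) (q : Q), B q (v q) (w q) =
    B₀ q (v q) (w q) + covExtDeriv₁ nabla A v w q + Ψ.Psi q (A q (v q)) (A q (w q))

/-- The action of `G` on the total space of `V` preserves the fibres and acts on them by the linear
maps `Φ g q`. -/
def ActsBy [MulAction G (TotalSpace F V)] (Φ : G → ∀ q, V q →L[ℝ] V q) : Prop :=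
  ∀ (g : G) (q : Q) (y : V q), g • (⟨q, y⟩ : TotalSpace F V) = ⟨q, Φ g q y⟩

/-- The connection and the two-form are invariant under the fibrewise linear action `Φ`. -/
structure IsInvariantPair (Φ : G → ∀ q, V q →L[ℝ] V q)
    (nabla : CovariantDerivative 𝓘(ℝ, EQ) F V)
    (B : ∀ q : Q, TangentSpace 𝓘(ℝ, EQ) q →L[ℝ] TangentSpace 𝓘(ℝ, EQ) q →L[ℝ] DualFib V q) :
    Prop where
  connection : ∀ (g : G) (ζ : Cₛ^∞⟮𝓘(ℝ, EQ); F, V⟯) (q : Q) (v : TangentSpace 𝓘(ℝ, EQ) q),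
    nabla (fun x => Φ g x (ζ x)) q v = Φ g q (nabla ζ q v)
  form : ∀ (g : G) (q : Q) (v w : TangentSpace 𝓘(ℝ, EQ) q) (y : V q),
    B q v w (Φ g q y) = B q v w y

end Averaging

/-! ### Poisson structures and Wong's equations -/

/-- A Poisson structure on a manifold, given by its bracket on smooth functions. -/
structure PoissonStructure {E H : Type*} [NormedAddCommGroup E] [NormedSpace ℝ E]
    [TopologicalSpace H] (I : ModelWithCorners ℝ E H) (M : Type*) [TopologicalSpace M]
    [ChartedSpace H M] where
  br : C^∞⟮I, M; 𝓘(ℝ, ℝ), ℝ⟯ →ₗ[ℝ] C^∞⟮I, M; 𝓘(ℝ, ℝ), ℝ⟯ →ₗ[ℝ] C^∞⟮I, M; 𝓘(ℝ, ℝ), ℝ⟯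
  skew : ∀ f, br f f = 0
  leibniz : ∀ f h k, br f (h * k) = br f h * k + h * br f k
  jacobi : ∀ f h k, br f (br h k) + br h (br k f) + br k (br f h) = 0

section PhaseSpace

variable (EQ : Type*) [NormedAddCommGroup EQ] [NormedSpace ℝ EQ]
  {Q : Type*} [TopologicalSpace Q] [ChartedSpace EQ Q] [IsManifold 𝓘(ℝ, EQ) ∞ Q]
  (F : Type*) [NormedAddCommGroup F] [NormedSpace ℝ F]
  (V : Q → Type*) [TopologicalSpace (TotalSpace F V)]
  [∀ q, AddCommGroup (V q)] [∀ q, Module ℝ (V q)] [∀ q, TopologicalSpace (V q)]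
  [∀ q, IsTopologicalAddGroup (V q)] [∀ q, ContinuousSMul ℝ (V q)]
  [FiberBundle F V] [VectorBundle ℝ F V] [ContMDiffVectorBundle ∞ F V 𝓘(ℝ, EQ)]

variable (Q) in
/-- The cotangent bundle of `Q`. -/
abbrev Cotangent : Type _ :=
  TotalSpace (EQ →L[ℝ] ℝ) (fun q : Q => TangentSpace 𝓘(ℝ, EQ) q →L[ℝ] ℝ)

variable (Q) in
/-- The projection `τ : T^*Q → Q`. -/
def cotProj : C^∞⟮𝓘(ℝ, EQ).prod 𝓘(ℝ, EQ →L[ℝ] ℝ), Cotangent EQ Q; 𝓘(ℝ, EQ), Q⟯ :=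
  ⟨TotalSpace.proj, contMDiff_proj _⟩

/-- The phase space: the total space of the pull-back bundle `τ^* V → T^*Q`. Its points are
`⟨⟨q, p⟩, y⟩` with `p` a covector at `q` and `y ∈ V q`. -/
abbrev PhaseSpace : Type _ := TotalSpace F ((cotProj EQ Q) *ᵖ V)

/-- The model with corners of the phase space. -/
abbrev phaseModel := (𝓘(ℝ, EQ).prod 𝓘(ℝ, EQ →L[ℝ] ℝ)).prod 𝓘(ℝ, F)

/-- Smooth functions on the phase space. -/
abbrev PhaseFun : Type _ := C^∞⟮phaseModel EQ F, PhaseSpace EQ F V; 𝓘(ℝ, ℝ), ℝ⟯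

variable {EQ F V}

/-- The point `(q, p, y)` of the phase space. -/
def phasePt (q : Q) (p : TangentSpace 𝓘(ℝ, EQ) q →L[ℝ] ℝ) (y : V q) : PhaseSpace EQ F V :=
  ⟨⟨q, p⟩, y⟩

/-- The function `(q, p, y) ↦ f q`. -/
def baseFun (f : C^∞⟮𝓘(ℝ, EQ), Q; 𝓘(ℝ, ℝ), ℝ⟯) : PhaseFun EQ F V :=
  ⟨fun z => f z.1.1, f.contMDiff.comp ((contMDiff_proj _).comp (contMDiff_proj _))⟩

/-- The function `P_v : (q, p, y) ↦ ⟨p, v(q)⟩` of a vector field `v` on `Q`. -/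
def momFun (v : VectorFields EQ Q) : PhaseFun EQ F V :=
  ⟨fun z => z.1.2 (v z.1.1), by
    intro z
    have h1 : ContMDiff (phaseModel EQ F) (𝓘(ℝ, EQ).prod 𝓘(ℝ, EQ →L[ℝ] ℝ)) ∞
      (fun z : PhaseSpace EQ F V => (⟨z.1.1, z.1.2⟩ : Cotangent EQ Q)) := contMDiff_proj _
    have h2 : ContMDiff (phaseModel EQ F) (𝓘(ℝ, EQ).prod 𝓘(ℝ, EQ)) ∞
      (fun z : PhaseSpace EQ F V => TotalSpace.mk' EQ z.1.1 (v z.1.1)) :=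
      v.contMDiff.comp ((contMDiff_proj _).comp (contMDiff_proj _))
    have h := ContMDiffAt.clm_bundle_apply (F₁ := EQ) (F₂ := ℝ) (E₂ := Bundle.Trivial Q ℝ)
      (b := fun z : PhaseSpace EQ F V => z.1.1) (ϕ := fun z => z.1.2) (h1 z) (h2 z)
    simp only [contMDiffAt_totalSpace] at h
    exact h.2⟩

/-- The canonical map `τ^* V → V`, `(q, p, y) ↦ (q, y)`. -/
def phaseToBundle (z : PhaseSpace EQ F V) : TotalSpace F V := ⟨z.1.1, z.2⟩

theorem contMDiff_phaseToBundle :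
    ContMDiff (phaseModel EQ F) (𝓘(ℝ, EQ).prod 𝓘(ℝ, F)) ∞
      (phaseToBundle : PhaseSpace EQ F V → TotalSpace F V) := by
  intro z
  rw [contMDiffAt_totalSpace]
  refine ⟨((contMDiff_proj _).comp (contMDiff_proj _)) z, ?_⟩
  have h : ContMDiffAt (phaseModel EQ F) (phaseModel EQ F) ∞
    (fun z : PhaseSpace EQ F V => z) z := contMDiffAt_id
  rw [contMDiffAt_totalSpace] at h
  exact h.2

/-- The fibrewise linear function `ℓ_η : (q, p, y) ↦ ⟨η(q), y⟩` of a section of the dual bundle. -/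
def linFun (η : Cₛ^∞⟮𝓘(ℝ, EQ); F →L[ℝ] ℝ, DualFib V⟯) : PhaseFun EQ F V :=
  ⟨fun z => η z.1.1 z.2, by
    intro z
    have h1 : ContMDiff (phaseModel EQ F) (𝓘(ℝ, EQ).prod 𝓘(ℝ, F →L[ℝ] ℝ)) ∞
      (fun z : PhaseSpace EQ F V => TotalSpace.mk' (F →L[ℝ] ℝ) z.1.1 (η z.1.1)) :=
      η.contMDiff.comp ((contMDiff_proj _).comp (contMDiff_proj _))
    have h := ContMDiffAt.clm_bundle_apply (F₁ := F) (F₂ := ℝ) (E₂ := Bundle.Trivial Q ℝ)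
      (b := fun z : PhaseSpace EQ F V => z.1.1) (ϕ := fun z => η z.1.1) (h1 z)
      (contMDiff_phaseToBundle z)
    simp only [contMDiffAt_totalSpace] at h
    exact h.2⟩

/-- `Pi` is the gauge Poisson structure `Π^{∇,B}` on the phase space: in terms of the functions
`f` on `Q`, `P_v` and `ℓ_η`, whose differentials span every cotangent space,
`{f, h} = 0`, `{P_v, f} = v f`, `{f, ℓ_η} = 0`, `{P_v, ℓ_η} = ℓ_{∇_v^* η}`,
`{P_v, P_w} = P_{[v, w]} + ℓ_{B(v, w)}`, `{ℓ_η, ℓ_θ} = Ψ(η, θ)`. -/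
structure IsGaugePoisson [FiniteDimensional ℝ EQ] [FiniteDimensional ℝ F] (Ψ : LiePoissonStructure EQ F V)
    (nabla : CovariantDerivative 𝓘(ℝ, EQ) F V)
    (B : ∀ q : Q, TangentSpace 𝓘(ℝ, EQ) q →L[ℝ] TangentSpace 𝓘(ℝ, EQ) q →L[ℝ] DualFib V q)
    (Pi : PoissonStructure (phaseModel EQ F) (PhaseSpace EQ F V)) : Prop where
  base_base : ∀ f h : C^∞⟮𝓘(ℝ, EQ), Q; 𝓘(ℝ, ℝ), ℝ⟯, Pi.br (baseFun f) (baseFun h) = 0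
  mom_base : ∀ (v : VectorFields EQ Q) (f : C^∞⟮𝓘(ℝ, EQ), Q; 𝓘(ℝ, ℝ), ℝ⟯) (q : Q) p (y : V q),
    Pi.br (momFun v) (baseFun f) (phasePt q p y) = mvfderiv 𝓘(ℝ, EQ) f q (v q)
  base_lin : ∀ (f : C^∞⟮𝓘(ℝ, EQ), Q; 𝓘(ℝ, ℝ), ℝ⟯)
    (η : Cₛ^∞⟮𝓘(ℝ, EQ); F →L[ℝ] ℝ, DualFib V⟯), Pi.br (baseFun f) (linFun η) = 0
  mom_lin : ∀ (v : VectorFields EQ Q) (η : Cₛ^∞⟮𝓘(ℝ, EQ); F →L[ℝ] ℝ, DualFib V⟯)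
    (q : Q) p (y : V q),
    Pi.br (momFun v) (linFun η) (phasePt q p y) = dualCov nabla η q (v q) y
  mom_mom : ∀ (v w : VectorFields EQ Q) (q : Q) p (y : V q),
    Pi.br (momFun v) (momFun w) (phasePt q p y)
      = p (mlieBracket 𝓘(ℝ, EQ) v w q) + B q (v q) (w q) y
  lin_lin : ∀ (η θ : Cₛ^∞⟮𝓘(ℝ, EQ); F →L[ℝ] ℝ, DualFib V⟯) (q : Q) p (y : V q),
    Pi.br (linFun η) (linFun θ) (phasePt q p y) = Ψ.Psi q (η q) (θ q) y

variable (EQ Q) in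
/-- A pseudo-Riemannian metric on `Q`. -/
structure PseudoMetric where
  inner : ∀ q : Q, TangentSpace 𝓘(ℝ, EQ) q →L[ℝ] TangentSpace 𝓘(ℝ, EQ) q →L[ℝ] ℝ
  contMDiff : ContMDiff 𝓘(ℝ, EQ) (𝓘(ℝ, EQ).prod 𝓘(ℝ, EQ →L[ℝ] EQ →L[ℝ] ℝ)) ∞
    (fun q ↦ TotalSpace.mk' (EQ →L[ℝ] EQ →L[ℝ] ℝ) q (inner q))
  symm : ∀ q v w, inner q v w = inner q w v
  nondegenerate : ∀ q v, (∀ w, inner q v w = 0) → v = 0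

/-- The Hamiltonian `½ g^{ij}(q) p_i p_j` of a pseudo-Riemannian metric: half of the value of the
covector `p` on the vector which corresponds to it under the metric. -/
def kinetic (met : PseudoMetric EQ Q) (z : PhaseSpace EQ F V) : ℝ :=
  (1 / 2) * z.1.2 ((met.inner z.1.1).inverse z.1.2)

/-- `c` solves on the set of times `J` the Hamiltonian system of `H`, that is,
`d/dt f(c(t)) = {H, f}(c(t))` for every smooth function `f` on the phase space. -/
def IsHamiltonianCurve (Pi : PoissonStructure (phaseModel EQ F) (PhaseSpace EQ F V))
    (H : PhaseFun EQ F V) (J : Set ℝ) (c : ℝ → PhaseSpace EQ F V) : Prop :=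
  ∀ t ∈ J, ∀ f : PhaseFun EQ F V, HasDerivAt (fun t' => f (c t')) (Pi.br H f (c t)) t

/-- `Φbar` is the lift to the phase space of the fibrewise linear action `Φ` on `V`. -/
def IsLiftedAction {G : Type*} (Φ : G → ∀ q, V q →L[ℝ] V q)
    (Φbar : G → C^∞⟮phaseModel EQ F, PhaseSpace EQ F V; phaseModel EQ F, PhaseSpace EQ F V⟯) :
    Prop :=
  ∀ (g : G) (q : Q) p (y : V q), Φbar g (phasePt q p y) = phasePt q p (Φ g q y)

end PhaseSpace

end Wong

end

noncomputable section

open Filter Topology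

namespace Wong

/-! ### Smooth sections of vector bundles -/

section Bump

variable {E : Type*} [NormedAddCommGroup E] [NormedSpace ℝ E] [FiniteDimensional ℝ E]
  {H : Type*} [TopologicalSpace H] {I : ModelWithCorners ℝ E H}
  {M : Type*} [TopologicalSpace M] [ChartedSpace H M] [IsManifold I ∞ M] [T2Space M]

/-! The generators are vertical, so functions pulled back from `Q` are constant along the orbits of
one-parameter subgroups. Inside a fibre such an orbit solves the linear equation `x' = ad^*_{s_a}
x`. Hence `exp a` acts as `exp(ad^*_{s_a})` (`HasCoadGenerators.smul_of_isExp`), a linear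
automorphism of the fibrewise bracket (`coadExp_bracket`). Almost every element is an exponential,
and by invariance of Haar measure every element is a product of two such elements
(`exists_mul_of_ae`). So all of `G` acts by linear Poisson maps of the fibres.

The one-form `A` comes from averaging the connections `Φ_g⁻¹ ∇₀ Φ_g`. By condition (i), the
derivative in `t` of `exp(-t ad^*) ∇₀ exp(t ad^*)` is `ad^*` of `Ad_{exp(t s_a)} ∇₀^* s_a`.
Integrating over `[0, 1]` and over `G` identifies the averaged connection with `∇₀ - ad^*_A`
(`IsAveragedForm.nabla_eq`), and right invariance of Haar measure makes it invariant. Smoothness of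
`A` is differentiation under an integral with compact parameter set.

Compatibility is algebra on sections of the dual bundle: replacing `D` by `D + [A, ·]` and `F` by `F
+ DA + ½[A ∧ A]` preserves the derivation property, the curvature equation and the Bianchi identity
(`gauge_curvature`, `gauge_bianchi`).

The two-form is not itself an average, so its invariance needs another argument. Invariance of `∇`
makes every `∇^* s_a` central. The centre is stable under `∇^*`, so the curvature equation makes
`[F(v, w), s_a]` central as well. Then `exp(t ad_{s_a}) F` is affine in `t`. It is bounded when
evaluated at a point, since `G` is compact, and so it is constant
(`IsCompatiblePair.form_invariant_of_isExp`).

For the Poisson structure, the functions `f + P_v + ℓ_η` form a Lie algebra exactly because the pair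
satisfies (i)–(iii) (`tripleBracket_jacobi`). Coordinates of the phase space are locally of this
form, so by Hadamard's lemma every smooth function has at each point the differential of such a
generating function. The bracket of generating functions depends only on differentials
(`gen_genBracket_eq_zero`), so it extends to all functions. The Jacobi sum is a derivation in each
argument and so vanishes once it vanishes on generating functions; the same principle gives
uniqueness. The transported structure satisfies the same relations, so uniqueness gives invariance,
and an invariant Hamiltonian then has its solution curves permuted. -/

theorem exists_cutoff {x : M} {s : Set M} (hs : s ∈ 𝓝 x) :
    ∃ ψ : M → ℝ, ContMDiff I 𝓘(ℝ, ℝ) ∞ ψ ∧ ψ =ᶠ[𝓝 x] 1 ∧ tsupport ψ ⊆ s := by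
  obtain ⟨f, -, hf⟩ := (SmoothBumpFunction.nhds_basis_tsupport (I := I) x).mem_iff.1 hs
  exact ⟨f, f.contMDiff, f.eventuallyEq_one, hf⟩

/-- Multiplication by a cutoff makes a local function global without changing its germ. Coordinate
expressions can then be used where globally defined functions are required. -/
theorem exists_contMDiff_eventuallyEq {G : Type*} [NormedAddCommGroup G] [NormedSpace ℝ G]
    {f : M → G} {u : Set M} (hu : IsOpen u) {x : M} (hx : x ∈ u)
    (hf : ContMDiffOn I 𝓘(ℝ, G) ∞ f u) :
    ∃ g : M → G, ContMDiff I 𝓘(ℝ, G) ∞ g ∧ g =ᶠ[𝓝 x] f := by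
  obtain ⟨ψ, hψ, hψ1, hψs⟩ := exists_cutoff (I := I) (hu.mem_nhds hx)
  refine ⟨fun y => ψ y • f y, ?_, hψ1.mono fun y hy => by simp [hy]⟩
  refine contMDiff_of_tsupport fun y hy => ?_
  have hy' : y ∈ u := hψs (tsupport_smul_subset_left ψ f hy)
  exact hψ.contMDiffAt.smul (hf.contMDiffAt (hu.mem_nhds hy'))

end Bump

section Sections

variable {EQ : Type*} [NormedAddCommGroup EQ] [NormedSpace ℝ EQ] [FiniteDimensional ℝ EQ]
  {Q : Type*} [TopologicalSpace Q] [ChartedSpace EQ Q] [IsManifold 𝓘(ℝ, EQ) ∞ Q] [T2Space Q]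
  {F : Type*} [NormedAddCommGroup F] [NormedSpace ℝ F] [FiniteDimensional ℝ F]
  {V : Q → Type*} [TopologicalSpace (TotalSpace F V)]
  [∀ q, AddCommGroup (V q)] [∀ q, Module ℝ (V q)] [∀ q, TopologicalSpace (V q)]
  [∀ q, IsTopologicalAddGroup (V q)] [∀ q, ContinuousSMul ℝ (V q)]
  [FiberBundle F V] [VectorBundle ℝ F V] [ContMDiffVectorBundle ∞ F V 𝓘(ℝ, EQ)]
  {F₂ : Type*} [NormedAddCommGroup F₂] [NormedSpace ℝ F₂]
  {V₂ : Q → Type*} [TopologicalSpace (TotalSpace F₂ V₂)]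
  [∀ q, AddCommGroup (V₂ q)] [∀ q, Module ℝ (V₂ q)] [∀ q, TopologicalSpace (V₂ q)]
  [∀ q, IsTopologicalAddGroup (V₂ q)] [∀ q, ContinuousSMul ℝ (V₂ q)]
  [FiberBundle F₂ V₂] [VectorBundle ℝ F₂ V₂] [ContMDiffVectorBundle ∞ F₂ V₂ 𝓘(ℝ, EQ)]

/-- Smoothness of a section of a vector bundle. -/
abbrev SmoothSec {Q : Type*} [TopologicalSpace Q] (EQ : Type*) [NormedAddCommGroup EQ]
    [NormedSpace ℝ EQ] [ChartedSpace EQ Q] (F : Type*) [NormedAddCommGroup F] [NormedSpace ℝ F]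
    {V : Q → Type*} [TopologicalSpace (TotalSpace F V)] [∀ q, TopologicalSpace (V q)]
    [FiberBundle F V] (σ : ∀ q, V q) : Prop :=
  ContMDiff 𝓘(ℝ, EQ) (𝓘(ℝ, EQ).prod 𝓘(ℝ, F)) ∞ (fun q ↦ TotalSpace.mk' F q (σ q))

variable (EQ F V) in
/-- Smooth sections which are constant in the trivialization at `q₀`, on a neighbourhood of `q₀`. -/
theorem exists_local_const_sections (q₀ : Q) :
    ∃ (σ : F →ₗ[ℝ] Cₛ^∞⟮𝓘(ℝ, EQ); F, V⟯) (u : Set Q), IsOpen u ∧ q₀ ∈ u ∧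
      u ⊆ (trivializationAt F V q₀).baseSet ∧
      ∀ x ∈ u, ∀ y, σ y x = (trivializationAt F V q₀).symmL ℝ x y := by
  set e := trivializationAt F V q₀
  obtain ⟨ψ, hψ, hψ1, hψs⟩ := exists_cutoff (I := 𝓘(ℝ, EQ))
    (e.open_baseSet.mem_nhds (FiberBundle.mem_baseSet_trivializationAt F V q₀))
  have key : ∀ y : F, SmoothSec EQ F (ψ • fun x => e.symmL ℝ x y : ∀ x, V x) := by
    intro y
    refine ContMDiffOn.smul_section_of_tsupport (u := e.baseSet) hψ.contMDiffOn e.open_baseSet hψs ?_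
    rw [e.contMDiffOn_section_baseSet_iff]
    refine (contMDiffOn_const (c := y)).congr fun x hx => ?_
    simp [e.symmL_apply hx, e.apply_mk_symm hx]
  obtain ⟨u, hu, hu_open, hq⟩ := eventually_nhds_iff.1 hψ1
  refine ⟨{ toFun := fun y => ⟨_, key y⟩
            map_add' := fun y z => by ext x; simp
            map_smul' := fun c y => by ext x; simp [smul_comm c] },
    u ∩ e.baseSet, hu_open.inter e.open_baseSet,
    ⟨hq, FiberBundle.mem_baseSet_trivializationAt F V q₀⟩, Set.inter_subset_right, ?_⟩
  rintro x ⟨hx, -⟩ y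
  simp [hu x hx, e]

variable (EQ F) in
-- Reduces identities between vectors of one fibre, such as those defining the dual connection, to
-- identities between global smooth sections.
theorem exists_section_eq {q : Q} (y : V q) : ∃ σ : Cₛ^∞⟮𝓘(ℝ, EQ); F, V⟯, σ q = y := by
  obtain ⟨σ, u, -, hq, hu, h⟩ := exists_local_const_sections EQ F V q
  refine ⟨σ ((trivializationAt F V q).continuousLinearMapAt ℝ q y), ?_⟩
  rw [h q hq]
  exact (trivializationAt F V q).symmL_continuousLinearMapAt (hu hq) y

/-- A section of a bundle of linear maps is smooth if it maps smooth sections to smooth sections. -/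
theorem smoothSec_hom {L : ∀ q, V q →L[ℝ] V₂ q}
    (h : ∀ σ : Cₛ^∞⟮𝓘(ℝ, EQ); F, V⟯, SmoothSec EQ F₂ fun q => L q (σ q)) :
    SmoothSec EQ (F →L[ℝ] F₂) L := by
  intro q₀
  refine (contMDiffAt_hom_bundle _).2 ⟨contMDiffAt_id, ?_⟩
  obtain ⟨σ, u, hu, hq, hub, hσ⟩ := exists_local_const_sections EQ F V q₀
  set b := Module.finBasis ℝ F
  set e₂ := trivializationAt F₂ V₂ q₀
  let c : Fin _ → F →L[ℝ] ℝ := fun i => (b.coord i).toContinuousLinearMap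
  -- In the trivializations at `q₀`, `L` is the sum over a basis of the coordinate functionals times
  -- the images of the locally constant sections, and these images are smooth by hypothesis.
  have key : ContMDiffAt 𝓘(ℝ, EQ) 𝓘(ℝ, F →L[ℝ] F₂) ∞
      (fun x => ∑ i, ContinuousLinearMap.smulRightL ℝ F F₂ (c i) (e₂ ⟨x, L x (σ (b i) x)⟩).2) q₀ := by
    refine ContMDiffAt.sum fun i _ => ?_
    exact (ContinuousLinearMap.contMDiff _).contMDiffAt.comp q₀
      ((contMDiffAt_section q₀).1 (h (σ (b i)) q₀))
  refine key.congr_of_eventuallyEq ?_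
  filter_upwards [hu.mem_nhds hq, e₂.open_baseSet.mem_nhds
    (FiberBundle.mem_baseSet_trivializationAt F₂ V₂ q₀)] with x hx hx₂
  rw [ContinuousLinearMap.inCoordinates_eq (hub hx) hx₂]
  ext y
  conv_lhs => rw [← b.sum_repr y]
  simp only [ContinuousLinearMap.coe_comp, Function.comp_apply, map_sum, map_smul]
  simp [c, hσ x hx, e₂, Trivialization.symmL_apply _ (hub hx)]

theorem smoothSec_hom_trivial {L : ∀ q, V q →L[ℝ] ℝ}
    (h : ∀ σ : Cₛ^∞⟮𝓘(ℝ, EQ); F, V⟯, ContMDiff 𝓘(ℝ, EQ) 𝓘(ℝ, ℝ) ∞ fun q => L q (σ q)) :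
    SmoothSec EQ (F →L[ℝ] ℝ) (V := DualFib V) L := by
  refine smoothSec_hom (V₂ := Bundle.Trivial Q ℝ) (L := L) fun σ q => ?_
  simp only [contMDiffAt_totalSpace]
  exact ⟨contMDiffAt_id, h σ q⟩

end Sections
end Wong

namespace Wong

/-! ### Dual frames, and vector fields as derivations. -/

section Connections

variable {EQ : Type*} [NormedAddCommGroup EQ] [NormedSpace ℝ EQ] [FiniteDimensional ℝ EQ]
  {Q : Type*} [TopologicalSpace Q] [ChartedSpace EQ Q] [IsManifold 𝓘(ℝ, EQ) ∞ Q] [T2Space Q]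
  {F : Type*} [NormedAddCommGroup F] [NormedSpace ℝ F] [FiniteDimensional ℝ F]
  {V : Q → Type*} [TopologicalSpace (TotalSpace F V)]
  [∀ q, AddCommGroup (V q)] [∀ q, Module ℝ (V q)] [∀ q, TopologicalSpace (V q)]
  [∀ q, IsTopologicalAddGroup (V q)] [∀ q, ContinuousSMul ℝ (V q)]
  [FiberBundle F V] [VectorBundle ℝ F V] [ContMDiffVectorBundle ∞ F V 𝓘(ℝ, EQ)]

variable (EQ F V) in
/-- Smooth sections of the dual bundle. -/
abbrev DualSections : Type _ := Cₛ^∞⟮𝓘(ℝ, EQ); F →L[ℝ] ℝ, DualFib V⟯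

variable (EQ F V) in
/-- Smooth sections of the dual bundle which are constant in the trivialization at `q₀`, on a
neighbourhood of `q₀`. -/
theorem exists_local_const_dualSections (q₀ : Q) :
    ∃ (θ : (F →L[ℝ] ℝ) →ₗ[ℝ] DualSections EQ F V) (u : Set Q), IsOpen u ∧ q₀ ∈ u ∧
      u ⊆ (trivializationAt F V q₀).baseSet ∧
      ∀ x ∈ u, ∀ c y, θ c x y = c ((trivializationAt F V q₀).continuousLinearMapAt ℝ x y) := by
  set e := trivializationAt F V q₀
  obtain ⟨ψ, hψ, hψ1, hψs⟩ := exists_cutoff (I := 𝓘(ℝ, EQ))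
    (e.open_baseSet.mem_nhds (FiberBundle.mem_baseSet_trivializationAt F V q₀))
  have key : ∀ c : F →L[ℝ] ℝ, SmoothSec EQ (F →L[ℝ] ℝ)
      (fun x => ψ x • (c ∘L e.continuousLinearMapAt ℝ x) : ∀ x, DualFib V x) := by
    intro c
    refine smoothSec_hom_trivial fun σ => contMDiff_of_tsupport fun x hx => ?_
    have hx' : x ∈ e.baseSet :=
      hψs (tsupport_smul_subset_left ψ (fun x => c (e.continuousLinearMapAt ℝ x (σ x))) hx)
    refine (hψ x).smul (c.contMDiff.contMDiffAt.comp x ?_)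
    refine ((e.contMDiffAt_section_iff hx').1 (σ.contMDiff x)).congr_of_eventuallyEq ?_
    filter_upwards [e.open_baseSet.mem_nhds hx'] with y hy
    simp [Trivialization.coe_linearMapAt_of_mem _ hy]
  obtain ⟨u, hu, hu_open, hq⟩ := eventually_nhds_iff.1 hψ1
  refine ⟨{ toFun := fun c => ⟨_, key c⟩
            map_add' := fun y z => by ext x; simp
            map_smul' := fun c y => by ext x; simp; ring },
    u ∩ e.baseSet, hu_open.inter e.open_baseSet,
    ⟨hq, FiberBundle.mem_baseSet_trivializationAt F V q₀⟩, Set.inter_subset_right, ?_⟩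
  rintro x ⟨hx, -⟩ c y
  simp [hu x hx, e]

/-- The components of `y` in a local frame are its pairings with the dual frame. Since the
co-adjoint operator is defined by transposition, this is the way its smoothness is seen. -/
theorem smoothSec_of_pairing {y : ∀ q, V q}
    (h : ∀ θ : DualSections EQ F V, ContMDiff 𝓘(ℝ, EQ) 𝓘(ℝ, ℝ) ∞ fun q => θ q (y q)) :
    SmoothSec EQ F y := by
  intro q₀
  rw [contMDiffAt_section]
  obtain ⟨θ, u, hu, hq, hub, hθ⟩ := exists_local_const_dualSections EQ F V q₀
  set b := Module.finBasis ℝ F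
  have key : ContMDiffAt 𝓘(ℝ, EQ) 𝓘(ℝ, F) ∞
      (fun x => ∑ i, θ (b.coord i).toContinuousLinearMap x (y x) • b i) q₀ :=
    ContMDiffAt.sum fun i _ => (h _ q₀).smul contMDiffAt_const
  refine key.congr_of_eventuallyEq ?_
  filter_upwards [hu.mem_nhds hq] with x hx
  simp only [hθ x hx]
  simp [Trivialization.coe_linearMapAt_of_mem _ (hub hx), b.sum_repr]

theorem dual_ext (F : Type*) [NormedAddCommGroup F] [NormedSpace ℝ F] [FiniteDimensional ℝ F]
    {V : Q → Type*} [TopologicalSpace (TotalSpace F V)]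
    [∀ q, AddCommGroup (V q)] [∀ q, Module ℝ (V q)] [∀ q, TopologicalSpace (V q)]
    [∀ q, IsTopologicalAddGroup (V q)] [∀ q, ContinuousSMul ℝ (V q)]
    [FiberBundle F V] [VectorBundle ℝ F V] {q : Q} {y z : V q} (h : ∀ θ : DualFib V q, θ y = θ z) : y = z := by
  have _h : T2Space (V q) := FiberBundle.t2Space F V q
  have _h' : FiniteDimensional ℝ (V q) := VectorBundle.finiteDimensional ℝ F V q
  exact (bidual (V q)).injective (by ext θ; exact h θ)

theorem SmoothSec.pair {η : ∀ q, DualFib V q} {σ : ∀ q, V q}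
    (hη : SmoothSec EQ (F →L[ℝ] ℝ) η) (hσ : SmoothSec EQ F σ) :
    ContMDiff 𝓘(ℝ, EQ) 𝓘(ℝ, ℝ) ∞ (fun x ↦ η x (σ x)) := by
  intro q
  have h := ContMDiffAt.clm_bundle_apply (F₁ := F) (F₂ := ℝ) (E₂ := Bundle.Trivial Q ℝ)
    (b := fun x : Q => x) (ϕ := η) (hη q) (hσ q)
  simp only [contMDiffAt_totalSpace] at h
  exact h.2

theorem SmoothSec.mdiffAt {σ : ∀ q, V q} (hσ : SmoothSec EQ F σ) (q : Q) :
    MDifferentiableAt 𝓘(ℝ, EQ) (𝓘(ℝ, EQ).prod 𝓘(ℝ, F)) (fun x ↦ TotalSpace.mk' F x (σ x)) q :=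
  (hσ q).mdifferentiableAt (by simp)

theorem contMDiff_mvfderiv_apply {f : Q → ℝ} (hf : ContMDiff 𝓘(ℝ, EQ) 𝓘(ℝ, ℝ) ∞ f)
    (v : VectorFields EQ Q) :
    ContMDiff 𝓘(ℝ, EQ) 𝓘(ℝ, ℝ) ∞ (fun q => mvfderiv 𝓘(ℝ, EQ) f q (v q)) :=
  contMDiff_snd_tangentBundle_modelSpace ℝ 𝓘(ℝ, ℝ) |>.comp
    ((hf.contMDiff_tangentMap (m := ∞) (by simp)).comp v.contMDiff)

theorem SmoothSec.mlieBracket {v w : ∀ q : Q, TangentSpace 𝓘(ℝ, EQ) q}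
    (hv : SmoothSec EQ EQ v) (hw : SmoothSec EQ EQ w) :
    SmoothSec EQ EQ (mlieBracket 𝓘(ℝ, EQ) v w) := by
  have : IsManifold 𝓘(ℝ, EQ) (minSmoothness ℝ 2) Q := by simp; infer_instance
  have : IsManifold 𝓘(ℝ, EQ) (((⊤ : ℕ∞) : WithTop ℕ∞) + 1) Q := by simpa
  exact fun q => ContMDiffAt.mlieBracket_vectorField (n := ⊤) (m := ⊤) (hv q) (hw q) (by simp)

/-- The Lie bracket of smooth vector fields. -/
def lieVF (v w : VectorFields EQ Q) : VectorFields EQ Q :=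
  ⟨_, SmoothSec.mlieBracket v.contMDiff w.contMDiff⟩

theorem lieVF_apply (v w : VectorFields EQ Q) (q : Q) :
    lieVF v w q = mlieBracket 𝓘(ℝ, EQ) v w q := rfl

theorem lieVF_jacobi (u v w : VectorFields EQ Q) :
    lieVF (lieVF u v) w + lieVF (lieVF v w) u + lieVF (lieVF w u) v = 0 := by
  have : IsManifold 𝓘(ℝ, EQ) (minSmoothness ℝ 3) Q := by simp; infer_instance
  have hle : minSmoothness ℝ 2 ≤ ∞ := by
    simpa using (WithTop.coe_le_coe.2 (le_top : (2 : ℕ∞) ≤ ⊤) : (2 : WithTop ℕ∞) ≤ ∞)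
  ext q
  have h := leibniz_identity_mlieBracket_apply ((u.contMDiff q).of_le hle)
    ((v.contMDiff q).of_le hle) ((w.contMDiff q).of_le hle)
  change mlieBracket 𝓘(ℝ, EQ) (mlieBracket 𝓘(ℝ, EQ) u v) w q
    + mlieBracket 𝓘(ℝ, EQ) (mlieBracket 𝓘(ℝ, EQ) v w) u q
    + mlieBracket 𝓘(ℝ, EQ) (mlieBracket 𝓘(ℝ, EQ) w u) v q = 0
  rw [mlieBracket_swap_apply (V := mlieBracket 𝓘(ℝ, EQ) v w) (W := u), h,
    mlieBracket_swap_apply (V := mlieBracket 𝓘(ℝ, EQ) w u) (W := v),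
    mlieBracket_swap (V := w) (W := u)]
  have h2 : mlieBracket 𝓘(ℝ, EQ) v (-mlieBracket 𝓘(ℝ, EQ) u w) q
      = - mlieBracket 𝓘(ℝ, EQ) v (mlieBracket 𝓘(ℝ, EQ) u w) q := by
    have := mlieBracket_const_smul_right (I := 𝓘(ℝ, EQ)) (V := v) (c := (-1 : ℝ))
      ((SmoothSec.mlieBracket u.contMDiff w.contMDiff).mdiffAt q)
    simpa using this
  rw [h2]
  abel

/-- Obtained from the Jacobi identity alone: expand it for `v`, `w` and `f u`, subtract `f` times
the identity for `v`, `w`, `u`, and compare the coefficients of a field `u` that does not vanish at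
`q`. -/
theorem lieVF_apply_fun (v w : VectorFields EQ Q) {f : Q → ℝ}
    (hf : ContMDiff 𝓘(ℝ, EQ) 𝓘(ℝ, ℝ) ∞ f) (q : Q) :
    mvfderiv 𝓘(ℝ, EQ) f q (mlieBracket 𝓘(ℝ, EQ) v w q) =
      mvfderiv 𝓘(ℝ, EQ) (fun x => mvfderiv 𝓘(ℝ, EQ) f x (w x)) q (v q)
        - mvfderiv 𝓘(ℝ, EQ) (fun x => mvfderiv 𝓘(ℝ, EQ) f x (v x)) q (w q) := by
  have : IsManifold 𝓘(ℝ, EQ) (minSmoothness ℝ 3) Q := by simp; infer_instance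
  have hle : minSmoothness ℝ 2 ≤ ∞ := by
    simpa using (WithTop.coe_le_coe.2 (le_top : (2 : ℕ∞) ≤ ⊤) : (2 : WithTop ℕ∞) ≤ ∞)
  -- A nonzero tangent vector is needed for `u`; in dimension zero both sides vanish.
  obtain hE | hE := subsingleton_or_nontrivial EQ
  · have h0 : ∀ x : TangentSpace 𝓘(ℝ, EQ) q, x = 0 := fun x => Subsingleton.elim (α := EQ) x 0
    rw [h0 (mlieBracket 𝓘(ℝ, EQ) v w q), h0 (v q), h0 (w q)]
    simp
  obtain ⟨e, he⟩ := exists_ne (0 : EQ)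
  obtain ⟨u, hu⟩ := exists_section_eq EQ EQ (V := (TangentSpace 𝓘(ℝ, EQ) : Q → Type _)) (q := q) e
  have hfd : ∀ x, MDifferentiableAt 𝓘(ℝ, EQ) 𝓘(ℝ, ℝ) f x := fun x =>
    (hf x).mdifferentiableAt (by simp)
  have hd : ∀ (a : VectorFields EQ Q) (x : Q), MDifferentiableAt 𝓘(ℝ, EQ) 𝓘(ℝ, ℝ)
      (fun x => mvfderiv 𝓘(ℝ, EQ) f x (a x)) x := fun a x =>
    (contMDiff_mvfderiv_apply hf a x).mdifferentiableAt (by simp)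
  have hfu : SmoothSec EQ EQ (f • ⇑u) := hf.smul_section u.contMDiff
  have hbr : ∀ a b : VectorFields EQ Q, MDifferentiableAt 𝓘(ℝ, EQ) 𝓘(ℝ, EQ).tangent
      (fun x ↦ TotalSpace.mk' EQ x (mlieBracket 𝓘(ℝ, EQ) a b x)) q := fun a b =>
    (SmoothSec.mlieBracket a.contMDiff b.contMDiff).mdiffAt q
  have key : ∀ a b : VectorFields EQ Q,
      mlieBracket 𝓘(ℝ, EQ) a (mlieBracket 𝓘(ℝ, EQ) b (f • ⇑u)) q
      = (mvfderiv 𝓘(ℝ, EQ) (fun x => mvfderiv 𝓘(ℝ, EQ) f x (b x)) q (a q)) • u q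
        + mvfderiv 𝓘(ℝ, EQ) f q (b q) • mlieBracket 𝓘(ℝ, EQ) a u q
        + (mvfderiv 𝓘(ℝ, EQ) f q (a q) • mlieBracket 𝓘(ℝ, EQ) b u q
          + f q • mlieBracket 𝓘(ℝ, EQ) a (mlieBracket 𝓘(ℝ, EQ) b u) q) := by
    intro a b
    have h1 : mlieBracket 𝓘(ℝ, EQ) b (f • ⇑u)
        = (fun x => mvfderiv 𝓘(ℝ, EQ) f x (b x)) • ⇑u + f • mlieBracket 𝓘(ℝ, EQ) b u := by
      funext x
      rw [mlieBracket_smul_right (hfd x) (u.mdifferentiableAt)]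
      rfl
    rw [h1, mlieBracket_add_right
      ((hd b q).smul_section u.mdifferentiableAt)
      ((hfd q).smul_section (hbr b u)),
      mlieBracket_smul_right (hd b q) u.mdifferentiableAt,
      mlieBracket_smul_right (hfd q) (hbr b u)]
  have hJ := leibniz_identity_mlieBracket_apply ((v.contMDiff q).of_le hle)
    ((w.contMDiff q).of_le hle) ((hfu q).of_le hle)
  have hJ' := leibniz_identity_mlieBracket_apply ((v.contMDiff q).of_le hle)
    ((w.contMDiff q).of_le hle) ((u.contMDiff q).of_le hle)
  rw [key, key, mlieBracket_smul_right (hfd q) u.mdifferentiableAt, hJ'] at hJ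
  -- The terms with one derivative of `f` multiplying a bracket with `u` occur symmetrically in `v`
  -- and `w` and cancel; only a multiple of `u q` survives.
  have h0 : (mvfderiv 𝓘(ℝ, EQ) f q (mlieBracket 𝓘(ℝ, EQ) v w q) -
      (mvfderiv 𝓘(ℝ, EQ) (fun x => mvfderiv 𝓘(ℝ, EQ) f x (w x)) q (v q)
        - mvfderiv 𝓘(ℝ, EQ) (fun x => mvfderiv 𝓘(ℝ, EQ) f x (v x)) q (w q))) • u q = 0 := by
    have := sub_eq_zero.2 hJ
    rw [← neg_eq_zero, ← this]
    module
  rw [hu] at h0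
  have := (smul_eq_zero.1 h0).resolve_right he
  linarith

end Connections
end Wong

namespace Wong

/-! ### Dual connection, fibrewise bracket and compatibility on sections. -/

section Gauge

variable {EQ : Type*} [NormedAddCommGroup EQ] [NormedSpace ℝ EQ] [FiniteDimensional ℝ EQ]
  {Q : Type*} [TopologicalSpace Q] [ChartedSpace EQ Q] [IsManifold 𝓘(ℝ, EQ) ∞ Q] [T2Space Q]
  {F : Type*} [NormedAddCommGroup F] [NormedSpace ℝ F] [FiniteDimensional ℝ F]
  {V : Q → Type*} [TopologicalSpace (TotalSpace F V)]
  [∀ q, AddCommGroup (V q)] [∀ q, Module ℝ (V q)] [∀ q, TopologicalSpace (V q)]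
  [∀ q, IsTopologicalAddGroup (V q)] [∀ q, ContinuousSMul ℝ (V q)]
  [FiberBundle F V] [VectorBundle ℝ F V] [ContMDiffVectorBundle ∞ F V 𝓘(ℝ, EQ)]

/-! ### The dual connection -/

section DualConnection

variable (nabla : CovariantDerivative 𝓘(ℝ, EQ) F V)

theorem dualCov_section {η : ∀ q, DualFib V q} {q : Q} (v : TangentSpace 𝓘(ℝ, EQ) q)
    (hη : MDifferentiableAt 𝓘(ℝ, EQ) (𝓘(ℝ, EQ).prod 𝓘(ℝ, F →L[ℝ] ℝ))
      (fun x ↦ TotalSpace.mk' (F →L[ℝ] ℝ) x (η x)) q) (ζ : Cₛ^∞⟮𝓘(ℝ, EQ); F, V⟯) :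
    dualCov nabla η q v (ζ q)
      = mvfderiv 𝓘(ℝ, EQ) (fun x => η x (ζ x)) q v - η q (nabla ζ q v) :=
  dualCov_apply nabla v hη ζ.mdifferentiableAt

theorem dualCov_add {η θ : ∀ q, DualFib V q} {q : Q} (v : TangentSpace 𝓘(ℝ, EQ) q)
    (hη : MDifferentiableAt 𝓘(ℝ, EQ) (𝓘(ℝ, EQ).prod 𝓘(ℝ, F →L[ℝ] ℝ))
      (fun x ↦ TotalSpace.mk' (F →L[ℝ] ℝ) x (η x)) q)
    (hθ : MDifferentiableAt 𝓘(ℝ, EQ) (𝓘(ℝ, EQ).prod 𝓘(ℝ, F →L[ℝ] ℝ))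
      (fun x ↦ TotalSpace.mk' (F →L[ℝ] ℝ) x (θ x)) q) :
    dualCov nabla (fun x => η x + θ x) q v = dualCov nabla η q v + dualCov nabla θ q v := by
  ext y
  obtain ⟨ζ, rfl⟩ := exists_section_eq EQ F y
  have hs : MDifferentiableAt 𝓘(ℝ, EQ) (𝓘(ℝ, EQ).prod 𝓘(ℝ, F →L[ℝ] ℝ))
      (fun x ↦ TotalSpace.mk' (F →L[ℝ] ℝ) x (η x + θ x)) q :=
    mdifferentiableAt_add_section hη hθ
  simp only [dualCov_section nabla v hs ζ, add_apply, dualCov_section nabla v hη ζ,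
    dualCov_section nabla v hθ ζ]
  have := mvfderiv_fun_add (mdiff_pair hη ζ.mdifferentiableAt) (mdiff_pair hθ ζ.mdifferentiableAt)
  simp only [add_apply, this]
  ring

theorem dualCov_smul {η : ∀ q, DualFib V q} {f : Q → ℝ} {q : Q} (v : TangentSpace 𝓘(ℝ, EQ) q)
    (hf : MDifferentiableAt 𝓘(ℝ, EQ) 𝓘(ℝ, ℝ) f q)
    (hη : MDifferentiableAt 𝓘(ℝ, EQ) (𝓘(ℝ, EQ).prod 𝓘(ℝ, F →L[ℝ] ℝ))
      (fun x ↦ TotalSpace.mk' (F →L[ℝ] ℝ) x (η x)) q) :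
    dualCov nabla (fun x => f x • η x) q v
      = f q • dualCov nabla η q v + mvfderiv 𝓘(ℝ, EQ) f q v • η q := by
  ext y
  obtain ⟨ζ, rfl⟩ := exists_section_eq EQ F y
  have hs : MDifferentiableAt 𝓘(ℝ, EQ) (𝓘(ℝ, EQ).prod 𝓘(ℝ, F →L[ℝ] ℝ))
      (fun x ↦ TotalSpace.mk' (F →L[ℝ] ℝ) x (f x • η x)) q := hf.smul_section hη
  simp only [dualCov_section nabla v hs ζ, add_apply, smul_apply, smul_eq_mul,
    dualCov_section nabla v hη ζ]
  have := mvfderiv_fun_mul hf (mdiff_pair hη ζ.mdifferentiableAt)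
  simp only [smul_apply, smul_eq_mul, this, add_apply]
  ring

theorem dualCov_add_right (η : ∀ q, DualFib V q) {q : Q} (v w : TangentSpace 𝓘(ℝ, EQ) q) :
    dualCov nabla η q (v + w) = dualCov nabla η q v + dualCov nabla η q w := by
  by_cases hη : MDifferentiableAt 𝓘(ℝ, EQ) (𝓘(ℝ, EQ).prod 𝓘(ℝ, F →L[ℝ] ℝ))
      (fun x ↦ TotalSpace.mk' (F →L[ℝ] ℝ) x (η x)) q
  · ext y
    obtain ⟨ζ, rfl⟩ := exists_section_eq EQ F y
    simp only [add_apply, dualCov_section nabla _ hη ζ, map_add]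
    ring
  · simp [dualCov, hη]

theorem dualCov_smul_right (η : ∀ q, DualFib V q) {q : Q} (c : ℝ) (v : TangentSpace 𝓘(ℝ, EQ) q) :
    dualCov nabla η q (c • v) = c • dualCov nabla η q v := by
  by_cases hη : MDifferentiableAt 𝓘(ℝ, EQ) (𝓘(ℝ, EQ).prod 𝓘(ℝ, F →L[ℝ] ℝ))
      (fun x ↦ TotalSpace.mk' (F →L[ℝ] ℝ) x (η x)) q
  · ext y
    obtain ⟨ζ, rfl⟩ := exists_section_eq EQ F y
    simp only [smul_apply, dualCov_section nabla _ hη ζ, map_smul, smul_eq_mul]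
    ring
  · simp [dualCov, hη]

variable {nabla} in
theorem smoothSec_nabla (hn : nabla.ContMDiffCovariantDerivative ∞) {σ : ∀ q, V q}
    (hσ : SmoothSec EQ F σ) :
    SmoothSec EQ (EQ →L[ℝ] F) (V := fun q => TangentSpace 𝓘(ℝ, EQ) q →L[ℝ] V q) (nabla σ) := by
  rw [SmoothSec, ← contMDiffOn_univ]
  exact hn.contMDiff.contMDiff (by simpa using contMDiffOn_univ.2 hσ)

variable {nabla} in
/-- The covariant derivative of a smooth section along a vector field. -/
def covSec (hn : nabla.ContMDiffCovariantDerivative ∞) (v : VectorFields EQ Q)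
    (ζ : Cₛ^∞⟮𝓘(ℝ, EQ); F, V⟯) : Cₛ^∞⟮𝓘(ℝ, EQ); F, V⟯ :=
  ⟨fun q => nabla ζ q (v q), (smoothSec_nabla hn ζ.contMDiff).clm_bundle_apply v.contMDiff⟩

variable {nabla} in
theorem covSec_apply (hn : nabla.ContMDiffCovariantDerivative ∞) (v : VectorFields EQ Q)
    (ζ : Cₛ^∞⟮𝓘(ℝ, EQ); F, V⟯) (q : Q) : covSec hn v ζ q = nabla ζ q (v q) := rfl

variable {nabla} in
/-- The dual connection on smooth sections of the dual bundle. -/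
def dualCovSec (hn : nabla.ContMDiffCovariantDerivative ∞) (v : VectorFields EQ Q)
    (η : DualSections EQ F V) : DualSections EQ F V :=
  ⟨fun q => dualCov nabla η q (v q), by
    refine smoothSec_hom_trivial fun ζ => ?_
    have h : (fun q => dualCov nabla η q (v q) (ζ q)) = fun q =>
        mvfderiv 𝓘(ℝ, EQ) (fun x => η x (ζ x)) q (v q) - η q (covSec hn v ζ q) :=
      funext fun q => dualCov_section nabla _ η.mdifferentiableAt ζ
    rw [h]
    exact (contMDiff_mvfderiv_apply (SmoothSec.pair η.contMDiff ζ.contMDiff) v).sub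
      (SmoothSec.pair η.contMDiff (covSec hn v ζ).contMDiff)⟩

variable {nabla} in
theorem dualCovSec_apply (hn : nabla.ContMDiffCovariantDerivative ∞) (v : VectorFields EQ Q)
    (η : DualSections EQ F V) (q : Q) : dualCovSec hn v η q = dualCov nabla η q (v q) := rfl

end DualConnection

/-! ### The fibrewise bracket -/

section Bracket

variable (Ψ : LiePoissonStructure EQ F V)

theorem Psi_swap (q : Q) (α β : DualFib V q) : Ψ.Psi q α β = -Ψ.Psi q β α := by
  have h := Ψ.skew q (α + β)
  simp only [map_add, add_apply, Ψ.skew, zero_add, add_zero] at h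
  rw [eq_neg_iff_add_eq_zero, add_comm]
  exact h

/-- The bracket of smooth sections of the dual bundle. -/
def psiSec (η θ : DualSections EQ F V) : DualSections EQ F V :=
  ⟨fun q => Ψ.Psi q (η q) (θ q),
    (Ψ.contMDiff.clm_bundle_apply η.contMDiff).clm_bundle_apply θ.contMDiff⟩

theorem psiSec_apply (η θ : DualSections EQ F V) (q : Q) :
    psiSec Ψ η θ q = Ψ.Psi q (η q) (θ q) := rfl

theorem smoothSec_coad {η : ∀ q, DualFib V q} {ζ : ∀ q, V q}
    (hη : SmoothSec EQ (F →L[ℝ] ℝ) η) (hζ : SmoothSec EQ F ζ) :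
    SmoothSec EQ F (fun q => coad Ψ q (η q) (ζ q)) := by
  refine smoothSec_of_pairing fun θ => ?_
  simp only [apply_coad]
  exact SmoothSec.pair (psiSec Ψ ⟨η, hη⟩ θ).contMDiff hζ

/-- The co-adjoint operator on smooth sections. -/
def coadSec (η : DualSections EQ F V) (ζ : Cₛ^∞⟮𝓘(ℝ, EQ); F, V⟯) : Cₛ^∞⟮𝓘(ℝ, EQ); F, V⟯ :=
  ⟨_, smoothSec_coad Ψ η.contMDiff ζ.contMDiff⟩

theorem coadSec_apply (η : DualSections EQ F V) (ζ : Cₛ^∞⟮𝓘(ℝ, EQ); F, V⟯) (q : Q) :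
    coadSec Ψ η ζ q = coad Ψ q (η q) (ζ q) := rfl

end Bracket

/-! ### Compatibility in terms of the dual connection -/

section Compatible

variable {Ψ : LiePoissonStructure EQ F V} {nabla : CovariantDerivative 𝓘(ℝ, EQ) F V}
  {B : ∀ q : Q, TangentSpace 𝓘(ℝ, EQ) q →L[ℝ] TangentSpace 𝓘(ℝ, EQ) q →L[ℝ] DualFib V q}

/-- A smooth two-form on two vector fields. -/
def formSec (hB : IsSmoothTwoForm F B) (v w : VectorFields EQ Q) : DualSections EQ F V :=
  ⟨fun q => B q (v q) (w q), (hB.contMDiff.clm_bundle_apply v.contMDiff).clm_bundle_apply w.contMDiff⟩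

theorem formSec_apply (hB : IsSmoothTwoForm F B) (v w : VectorFields EQ Q) (q : Q) :
    formSec hB v w q = B q (v q) (w q) := rfl

theorem dualSections_ext {η θ : DualSections EQ F V}
    (h : ∀ (ζ : Cₛ^∞⟮𝓘(ℝ, EQ); F, V⟯) q, η q (ζ q) = θ q (ζ q)) : η = θ := by
  ext q y
  obtain ⟨ζ, rfl⟩ := exists_section_eq EQ F y
  exact h ζ q

/-- In the expansion of the second covariant derivative, the two terms with a single `∇ζ` are
interchanged by swapping `v` and `w`, so they drop out of the commutator. -/
theorem dualCov_covSec (hn : nabla.ContMDiffCovariantDerivative ∞) (v w : VectorFields EQ Q)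
    (η : DualSections EQ F V) (ζ : Cₛ^∞⟮𝓘(ℝ, EQ); F, V⟯) (q : Q) :
    dualCovSec hn v (dualCovSec hn w η) q (ζ q) =
      mvfderiv 𝓘(ℝ, EQ) (fun x => mvfderiv 𝓘(ℝ, EQ) (fun x => η x (ζ x)) x (w x)) q (v q)
      - mvfderiv 𝓘(ℝ, EQ) (fun x => η x (nabla ζ x (w x))) q (v q)
      - mvfderiv 𝓘(ℝ, EQ) (fun x => η x (nabla ζ x (v x))) q (w q)
      + η q (nabla (fun x => nabla ζ x (v x)) q (w q)) := by
  rw [dualCovSec_apply, dualCov_section nabla _ (dualCovSec hn w η).mdifferentiableAt ζ]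
  have h1 : (fun x => dualCovSec hn w η x (ζ x)) = fun x =>
      mvfderiv 𝓘(ℝ, EQ) (fun x => η x (ζ x)) x (w x) - η x (nabla ζ x (w x)) :=
    funext fun x => dualCov_section nabla _ η.mdifferentiableAt ζ
  have hf := SmoothSec.pair η.contMDiff ζ.contMDiff
  have h2 := mvfderiv_fun_sub (x := q)
    ((contMDiff_mvfderiv_apply hf w).mdifferentiable (by simp) q)
    ((SmoothSec.pair η.contMDiff (covSec hn w ζ).contMDiff).mdifferentiable (by simp) q)
  have h3 := dualCov_section nabla (w q) η.mdifferentiableAt (covSec hn v ζ)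
  simp only [covSec_apply] at h2 h3
  rw [h1, h2, sub_apply, dualCovSec_apply, h3]
  change _ - _ - (_ - η q (nabla (fun x => nabla ζ x (v x)) q (w q))) = _
  ring

/-- The curvature of `∇^*` is minus the transpose of that of `∇`. Thus `-ad^*_F` on `V` becomes
`+ad_F` on the dual bundle. -/
theorem dualCov_curvature (hn : nabla.ContMDiffCovariantDerivative ∞) (v w : VectorFields EQ Q)
    (η : DualSections EQ F V) (ζ : Cₛ^∞⟮𝓘(ℝ, EQ); F, V⟯) (q : Q) :
    (dualCovSec hn v (dualCovSec hn w η) - dualCovSec hn w (dualCovSec hn v η)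
        - dualCovSec hn (lieVF v w) η) q (ζ q) =
      -η q (nabla (fun x => nabla ζ x (w x)) q (v q) - nabla (fun x => nabla ζ x (v x)) q (w q)
        - nabla ζ q (mlieBracket 𝓘(ℝ, EQ) v w q)) := by
  have h1 := dualCov_covSec hn v w η ζ q
  have h2 := dualCov_covSec hn w v η ζ q
  have h3 := dualCov_section nabla (lieVF v w q) η.mdifferentiableAt ζ
  have h4 := lieVF_apply_fun v w (SmoothSec.pair η.contMDiff ζ.contMDiff) q
  rw [lieVF_apply, h4] at h3
  simp only [ContMDiffSection.coe_sub, Pi.sub_apply, sub_apply, h1, h2]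
  rw [dualCovSec_apply, lieVF_apply, h3]
  simp only [map_sub]
  ring

/-- Transposition turns the defect in condition (i) into the defect of `∇^*` being a derivation of
the bracket. -/
theorem dualCov_coad (hn : nabla.ContMDiffCovariantDerivative ∞) (v : VectorFields EQ Q)
    (η θ : DualSections EQ F V) (ζ : Cₛ^∞⟮𝓘(ℝ, EQ); F, V⟯) (q : Q) :
    (dualCovSec hn v (psiSec Ψ η θ) - psiSec Ψ (dualCovSec hn v η) θ
        - psiSec Ψ η (dualCovSec hn v θ)) q (ζ q) =
      θ q (nabla (fun x => coad Ψ x (η x) (ζ x)) q (v q) - coad Ψ q (η q) (nabla ζ q (v q))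
      - coad Ψ q (dualCov nabla η q (v q)) (ζ q)) := by
  have h1 := dualCov_section nabla (v q) (psiSec Ψ η θ).mdifferentiableAt ζ
  have h2 := dualCov_section nabla (v q) θ.mdifferentiableAt (coadSec Ψ η ζ)
  have h3 : (fun x => psiSec Ψ η θ x (ζ x)) = fun x => θ x (coadSec Ψ η ζ x) :=
    funext fun x => by rw [coadSec_apply, apply_coad, psiSec_apply]
  simp only [ContMDiffSection.coe_sub, Pi.sub_apply, sub_apply]
  rw [dualCovSec_apply, h1, h3]
  rw [coadSec_apply, apply_coad] at h2
  simp only [map_sub, apply_coad, psiSec_apply, dualCovSec_apply, h2]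
  change _ - _ - _ = θ q (nabla (coadSec Ψ η ζ) q (v q)) - _ - _
  ring

theorem IsCompatiblePair.dual_preserves (h : IsCompatiblePair Ψ nabla B) (v : VectorFields EQ Q)
    (η θ : DualSections EQ F V) :
    dualCovSec h.smooth_connection v (psiSec Ψ η θ)
      = psiSec Ψ (dualCovSec h.smooth_connection v η) θ
        + psiSec Ψ η (dualCovSec h.smooth_connection v θ) := by
  rw [← sub_eq_zero, ← sub_sub]
  refine dualSections_ext fun ζ q => ?_
  rw [dualCov_coad, h.preserves, sub_self, map_zero]
  rfl

theorem IsCompatiblePair.dual_curvature (h : IsCompatiblePair Ψ nabla B) (v w : VectorFields EQ Q)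
    (η : DualSections EQ F V) :
    dualCovSec h.smooth_connection v (dualCovSec h.smooth_connection w η)
      - dualCovSec h.smooth_connection w (dualCovSec h.smooth_connection v η)
      - dualCovSec h.smooth_connection (lieVF v w) η = psiSec Ψ (formSec h.smooth_form v w) η := by
  refine dualSections_ext fun ζ q => ?_
  rw [dualCov_curvature, h.curvature, map_neg, neg_neg, apply_coad]
  rfl

theorem covExtDeriv₂_eq (hn : nabla.ContMDiffCovariantDerivative ∞) (hB : IsSmoothTwoForm F B)
    (u v w : VectorFields EQ Q) (q : Q) : covExtDeriv₂ nabla B u v w q =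
      (dualCovSec hn u (formSec hB v w) - formSec hB (lieVF u v) w
        + (dualCovSec hn v (formSec hB w u) - formSec hB (lieVF v w) u)
        + (dualCovSec hn w (formSec hB u v) - formSec hB (lieVF w u) v)) q := rfl

/-- Elements of a fibre are separated by covectors, so the transposed identities give back the
original ones. The gauge computation can therefore be carried out entirely in the Lie algebra of
dual sections. -/
theorem isCompatiblePair_of_dual (hn : nabla.ContMDiffCovariantDerivative ∞)
    (hB : IsSmoothTwoForm F B)
    (h1 : ∀ (v : VectorFields EQ Q) (η θ : DualSections EQ F V),
      dualCovSec hn v (psiSec Ψ η θ)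
        = psiSec Ψ (dualCovSec hn v η) θ + psiSec Ψ η (dualCovSec hn v θ))
    (h2 : ∀ (v w : VectorFields EQ Q) (η : DualSections EQ F V),
      dualCovSec hn v (dualCovSec hn w η) - dualCovSec hn w (dualCovSec hn v η)
        - dualCovSec hn (lieVF v w) η = psiSec Ψ (formSec hB v w) η)
    (h3 : ∀ u v w : VectorFields EQ Q,
      dualCovSec hn u (formSec hB v w) - formSec hB (lieVF u v) w
        + (dualCovSec hn v (formSec hB w u) - formSec hB (lieVF v w) u)
        + (dualCovSec hn w (formSec hB u v) - formSec hB (lieVF w u) v) = 0) :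
    IsCompatiblePair Ψ nabla B where
  smooth_connection := hn
  smooth_form := hB
  preserves v η ζ q := by
    rw [← sub_eq_zero]
    refine dual_ext F fun α => ?_
    obtain ⟨θ, rfl⟩ := exists_section_eq EQ (F →L[ℝ] ℝ) (V := DualFib V) α
    rw [← dualCov_coad hn, h1, sub_sub, sub_self, map_zero]
    rfl
  curvature v w ζ q := by
    refine dual_ext F fun α => ?_
    obtain ⟨η, rfl⟩ := exists_section_eq EQ (F →L[ℝ] ℝ) (V := DualFib V) α
    have := dualCov_curvature hn v w η ζ q
    rw [h2] at this
    rw [map_neg, apply_coad, ← formSec_apply hB, ← psiSec_apply, this, neg_neg]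
  covariantly_constant u v w q := by
    rw [covExtDeriv₂_eq hn hB, h3]
    rfl

end Compatible

end Gauge
end Wong

namespace Wong

/-! ### Gauge transformations -/

section GaugeAlgebra

variable {X S : Type*} [AddCommGroup X] [AddCommGroup S] [Module ℝ S]
  (br : S →+ S →+ S) (D : X → S →+ S) (lie : X → X → X) (A : X →+ S) (B : X → X → S)

/-- The two-form `B + D A + ½ [A ∧ A]`. -/
def gaugeTwoForm (v w : X) : S := B v w + (D v (A w) - D w (A v) - A (lie v w)) + br (A v) (A w)

variable {br D lie A B}

/-- The terms linear in `A` combine by the derivation property of `D`, and the quadratic ones by the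
Jacobi identity. No geometry enters, so the computation is made for abstract additive maps. -/
theorem gauge_curvature (hskew : ∀ a b, br a b = -br b a)
    (hjac : ∀ a b c, br a (br b c) + br b (br c a) + br c (br a b) = 0)
    (hD : ∀ v a b, D v (br a b) = br (D v a) b + br a (D v b))
    (hcurv : ∀ v w a, D v (D w a) - D w (D v a) - D (lie v w) a = br (B v w) a)
    (v w : X) (a : S) :
    (D v (D w a + br (A w) a) + br (A v) (D w a + br (A w) a))
      - (D w (D v a + br (A v) a) + br (A w) (D v a + br (A v) a))
      - (D (lie v w) a + br (A (lie v w)) a) = br (gaugeTwoForm br D lie A B v w) a := by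
  have h1 := hcurv v w a
  have h2 := hjac (A v) (A w) a
  -- Brings Jacobi into the form in which `ad` of a bracket is the commutator of the operators `ad`.
  rw [hskew a (A v), map_neg, hskew a (br (A v) (A w))] at h2
  simp only [gaugeTwoForm, map_add, map_sub, AddMonoidHom.add_apply, AddMonoidHom.sub_apply, hD,
    ← h1]
  rw [← sub_eq_zero, ← h2]
  abel

/-- Second derivatives of `A` combine into `[B, A]`, which cancels the terms `[A, B]`. The cubic
terms vanish by Jacobi for `br`, the terms with a double bracket of fields by Jacobi for `lie`, and
what remains is the Bianchi identity of `B`. -/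
theorem gauge_bianchi (hskew : ∀ a b, br a b = -br b a)
    (hjac : ∀ a b c, br a (br b c) + br b (br c a) + br c (br a b) = 0)
    (hD : ∀ v a b, D v (br a b) = br (D v a) b + br a (D v b))
    (hcurv : ∀ v w a, D v (D w a) - D w (D v a) - D (lie v w) a = br (B v w) a)
    (hlie : ∀ u v w, lie (lie u v) w + lie (lie v w) u + lie (lie w u) v = 0)
    (hB : ∀ u v w, D u (B v w) - B (lie u v) w + (D v (B w u) - B (lie v w) u)
      + (D w (B u v) - B (lie w u) v) = 0) (u v w : X) :
    (D u (gaugeTwoForm br D lie A B v w) + br (A u) (gaugeTwoForm br D lie A B v w)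
        - gaugeTwoForm br D lie A B (lie u v) w)
      + (D v (gaugeTwoForm br D lie A B w u) + br (A v) (gaugeTwoForm br D lie A B w u)
        - gaugeTwoForm br D lie A B (lie v w) u)
      + (D w (gaugeTwoForm br D lie A B u v) + br (A w) (gaugeTwoForm br D lie A B u v)
        - gaugeTwoForm br D lie A B (lie w u) v) = 0 := by
  have c1 := hcurv u v (A w)
  have c2 := hcurv v w (A u)
  have c3 := hcurv w u (A v)
  have hb := hB u v w
  have hj := hjac (A u) (A v) (A w)
  have hl := congrArg A (hlie u v w)
  simp only [map_add, map_zero] at hl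
  simp only [gaugeTwoForm, map_add, map_sub, hD]
  -- Orients the brackets so that every product occurs in one order only; the rest is linear.
  rw [hskew (A u) (B v w), hskew (A v) (B w u), hskew (A w) (B u v), ← c1, ← c2, ← c3,
    hskew (A (lie u v)) (A w), hskew (A (lie v w)) (A u), hskew (A (lie w u)) (A v),
    hskew (D u (A v)) (A w), hskew (D v (A w)) (A u), hskew (D w (A u)) (A v)]
  linear_combination (norm := module) hb + hj + hl

end GaugeAlgebra

section Gauge

variable {EQ : Type*} [NormedAddCommGroup EQ] [NormedSpace ℝ EQ] [FiniteDimensional ℝ EQ]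
  {Q : Type*} [TopologicalSpace Q] [ChartedSpace EQ Q] [IsManifold 𝓘(ℝ, EQ) ∞ Q] [T2Space Q]
  {F : Type*} [NormedAddCommGroup F] [NormedSpace ℝ F] [FiniteDimensional ℝ F]
  {V : Q → Type*} [TopologicalSpace (TotalSpace F V)]
  [∀ q, AddCommGroup (V q)] [∀ q, Module ℝ (V q)] [∀ q, TopologicalSpace (V q)]
  [∀ q, IsTopologicalAddGroup (V q)] [∀ q, ContinuousSMul ℝ (V q)]
  [FiberBundle F V] [VectorBundle ℝ F V] [ContMDiffVectorBundle ∞ F V 𝓘(ℝ, EQ)]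

theorem SmoothSec.hom_apply {F₂ : Type*} [NormedAddCommGroup F₂] [NormedSpace ℝ F₂]
    {V₂ : Q → Type*} [TopologicalSpace (TotalSpace F₂ V₂)]
    [∀ q, AddCommGroup (V₂ q)] [∀ q, Module ℝ (V₂ q)] [∀ q, TopologicalSpace (V₂ q)]
    [∀ q, IsTopologicalAddGroup (V₂ q)] [∀ q, ContinuousSMul ℝ (V₂ q)]
    [FiberBundle F₂ V₂] [VectorBundle ℝ F₂ V₂]
    {L : ∀ q, V q →L[ℝ] V₂ q} {σ : ∀ q, V q}
    (hL : SmoothSec EQ (F →L[ℝ] F₂) L) (hσ : SmoothSec EQ F σ) :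
    SmoothSec EQ F₂ (fun q => L q (σ q)) :=
  ContMDiff.clm_bundle_apply hL hσ

/-- A smooth one-form on a vector field. -/
def oneFormSec {A : ∀ q : Q, TangentSpace 𝓘(ℝ, EQ) q →L[ℝ] DualFib V q}
    (hA : IsSmoothOneForm F A) : VectorFields EQ Q →+ DualSections EQ F V where
  toFun v := ⟨fun q => A q (v q), SmoothSec.hom_apply hA v.contMDiff⟩
  map_zero' := by ext q; simp
  map_add' v w := by ext q; simp

/-- The dual connection as an additive map on sections. -/
def dualCovHom {nabla : CovariantDerivative 𝓘(ℝ, EQ) F V}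
    (hn : nabla.ContMDiffCovariantDerivative ∞) (v : VectorFields EQ Q) :
    DualSections EQ F V →+ DualSections EQ F V :=
  AddMonoidHom.mk' (dualCovSec hn v) fun η θ => by
    ext q : 1
    exact dualCov_add nabla (v q) η.mdifferentiableAt θ.mdifferentiableAt

/-- The fibrewise bracket as a biadditive map on sections. -/
def psiHom (Ψ : LiePoissonStructure EQ F V) :
    DualSections EQ F V →+ DualSections EQ F V →+ DualSections EQ F V :=
  AddMonoidHom.mk' (fun η => AddMonoidHom.mk' (psiSec Ψ η) fun θ θ' => by
    ext q : 1; simp [psiSec_apply]) fun η η' => by ext θ q : 2; simp [psiSec_apply]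

/-- The minus sign in `negCoadForm` becomes a plus sign under dualization: `∇ - ad^*_A` has dual
connection `∇^* + ad_A`. -/
theorem dualCov_addOneForm (Ψ : LiePoissonStructure EQ F V)
    (nabla : CovariantDerivative 𝓘(ℝ, EQ) F V)
    (A : ∀ q : Q, TangentSpace 𝓘(ℝ, EQ) q →L[ℝ] DualFib V q) {η : ∀ q, DualFib V q} {q : Q}
    (v : TangentSpace 𝓘(ℝ, EQ) q)
    (hη : MDifferentiableAt 𝓘(ℝ, EQ) (𝓘(ℝ, EQ).prod 𝓘(ℝ, F →L[ℝ] ℝ))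
      (fun x ↦ TotalSpace.mk' (F →L[ℝ] ℝ) x (η x)) q) :
    dualCov (nabla.addOneForm (negCoadForm Ψ A)) η q v
      = dualCov nabla η q v + Ψ.Psi q (A q v) (η q) := by
  ext y
  obtain ⟨ζ, rfl⟩ := exists_section_eq EQ F y
  rw [add_apply, dualCov_section _ _ hη, dualCov_section _ _ hη]
  change _ - η q (nabla ζ q v + negCoadForm Ψ A q (ζ q) v) = _
  rw [negCoadForm_apply, map_add, map_neg, apply_coad]
  ring

theorem smooth_addOneForm (Ψ : LiePoissonStructure EQ F V)
    {nabla : CovariantDerivative 𝓘(ℝ, EQ) F V} (hn : nabla.ContMDiffCovariantDerivative ∞)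
    {A : ∀ q : Q, TangentSpace 𝓘(ℝ, EQ) q →L[ℝ] DualFib V q} (hA : IsSmoothOneForm F A) :
    (nabla.addOneForm (negCoadForm Ψ A)).ContMDiffCovariantDerivative ∞ := by
  refine ⟨⟨fun {σ} hσ => ?_⟩⟩
  have hσ' : SmoothSec EQ F σ := contMDiffOn_univ.1 (by simpa using hσ)
  rw [contMDiffOn_univ]
  refine ContMDiff.add_section (V := fun q => TangentSpace 𝓘(ℝ, EQ) q →L[ℝ] V q)
    (smoothSec_nabla hn hσ') (t := fun q => negCoadForm Ψ A q (σ q)) ?_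
  refine smoothSec_hom fun v => ?_
  simp only [negCoadForm_apply]
  exact (smoothSec_coad Ψ (oneFormSec hA v).contMDiff hσ').neg_section

section TwoForm

variable (Ψ : LiePoissonStructure EQ F V) (nabla : CovariantDerivative 𝓘(ℝ, EQ) F V)
  {A : ∀ q : Q, TangentSpace 𝓘(ℝ, EQ) q →L[ℝ] DualFib V q}

theorem mdiff_oneForm (hA : IsSmoothOneForm F A) {v : ∀ q : Q, TangentSpace 𝓘(ℝ, EQ) q} {q : Q}
    (hv : MDifferentiableAt 𝓘(ℝ, EQ) (𝓘(ℝ, EQ).prod 𝓘(ℝ, EQ))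
      (fun x ↦ TotalSpace.mk' EQ x (v x)) q) :
    MDifferentiableAt 𝓘(ℝ, EQ) (𝓘(ℝ, EQ).prod 𝓘(ℝ, F →L[ℝ] ℝ))
      (fun x ↦ TotalSpace.mk' (F →L[ℝ] ℝ) x (A x (v x) : DualFib V x)) q :=
  MDifferentiableAt.clm_bundle_apply (b := fun x => x) (ϕ := A)
    (E₂ := fun x => DualFib V x) ((hA q).mdifferentiableAt (by simp)) hv

theorem covExtDeriv₁_swap (v w : ∀ q : Q, TangentSpace 𝓘(ℝ, EQ) q) (q : Q) :
    covExtDeriv₁ nabla A v w q = -covExtDeriv₁ nabla A w v q := by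
  rw [covExtDeriv₁, covExtDeriv₁, mlieBracket_swap_apply, map_neg]
  abel

/-- The derivative of the factor `f` along `w` arises once from `∇^*_w` and once from the Lie
bracket, with opposite signs. Hence the exterior derivative, defined on fields, has values that
depend only on the vectors at `q`. -/
theorem tensorialAt_covExtDeriv₁ (hA : IsSmoothOneForm F A) (q : Q)
    (w : ∀ q : Q, TangentSpace 𝓘(ℝ, EQ) q) :
    TensorialAt 𝓘(ℝ, EQ) EQ (fun v => covExtDeriv₁ nabla A v w q) q where
  smul {f v} hf hv := by
    have h := dualCov_smul nabla (w q) hf (mdiff_oneForm hA hv)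
    simp only [covExtDeriv₁, mlieBracket_smul_left hf hv, Pi.smul_apply', map_smul, map_add, h,
      dualCov_smul_right, map_neg, neg_smul]
    module
  add {v v'} hv hv' := by
    have h := dualCov_add nabla (w q) (mdiff_oneForm hA hv) (mdiff_oneForm hA hv')
    simp only [covExtDeriv₁, mlieBracket_add_left hv hv', Pi.add_apply, map_add, h,
      dualCov_add_right]
    abel

theorem exists_gauged_twoForm (hA : IsSmoothOneForm F A)
    (B₀ : ∀ q : Q, TangentSpace 𝓘(ℝ, EQ) q →L[ℝ] TangentSpace 𝓘(ℝ, EQ) q →L[ℝ] DualFib V q) :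
    ∃ B : ∀ q : Q, TangentSpace 𝓘(ℝ, EQ) q →L[ℝ] TangentSpace 𝓘(ℝ, EQ) q →L[ℝ] DualFib V q,
      IsGaugedForm Ψ nabla B₀ A B := by
  have h₂ : ∀ (q : Q) (v : ∀ q : Q, TangentSpace 𝓘(ℝ, EQ) q),
      MDifferentiableAt 𝓘(ℝ, EQ) (𝓘(ℝ, EQ).prod 𝓘(ℝ, EQ)) (fun x ↦ TotalSpace.mk' EQ x (v x)) q →
      TensorialAt 𝓘(ℝ, EQ) EQ (fun w => covExtDeriv₁ nabla A v w q) q := by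
    intro q v hv
    have h := tensorialAt_covExtDeriv₁ nabla hA q v
    refine ⟨fun hf hσ => ?_, fun hσ hσ' => ?_⟩
    · simp only [covExtDeriv₁_swap nabla v, h.smul hf hσ, smul_neg]
    · simp only [covExtDeriv₁_swap nabla v, h.add hσ hσ', neg_add]
  -- The last summand is the bilinear map `(v, w) ↦ [A v, A w]`, written as a composition.
  refine ⟨fun q => B₀ q + TensorialAt.mkHom₂ (fun v w => covExtDeriv₁ nabla A v w q) q
    (fun v _ => tensorialAt_covExtDeriv₁ nabla hA q v) (h₂ q)
    + (ContinuousLinearMap.precomp (DualFib V q) (A q)) ∘L (Ψ.Psi q ∘L A q), fun v w q => ?_⟩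
  have := TensorialAt.mkHom₂_apply (fun v _ => tensorialAt_covExtDeriv₁ nabla hA q v) (h₂ q)
    v.mdifferentiableAt w.mdifferentiableAt
  simp only [add_apply, this]
  rfl

variable {Ψ nabla} in
theorem IsGaugedForm.isSmoothTwoForm (hn : nabla.ContMDiffCovariantDerivative ∞)
    (hA : IsSmoothOneForm F A)
    {B₀ B : ∀ q : Q, TangentSpace 𝓘(ℝ, EQ) q →L[ℝ] TangentSpace 𝓘(ℝ, EQ) q →L[ℝ] DualFib V q}
    (hB₀ : IsSmoothTwoForm F B₀) (hB : IsGaugedForm Ψ nabla B₀ A B) : IsSmoothTwoForm F B where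
  contMDiff := by
    refine smoothSec_hom (V₂ := fun q => TangentSpace 𝓘(ℝ, EQ) q →L[ℝ] DualFib V q) fun v => ?_
    refine smoothSec_hom (V₂ := DualFib V) fun w => ?_
    have h : (fun q => B q (v q) (w q)) = ⇑(gaugeTwoForm (psiHom Ψ) (dualCovHom hn) lieVF
      (oneFormSec hA) (formSec hB₀) v w) := funext fun q => hB v w q
    rw [h]
    exact ContMDiffSection.contMDiff _
  alternating q x := by
    obtain ⟨v, rfl⟩ := exists_section_eq EQ EQ (V := (TangentSpace 𝓘(ℝ, EQ) : Q → Type _)) x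
    rw [hB, hB₀.alternating, Ψ.skew, covExtDeriv₁, mlieBracket_self]
    simp

variable {Ψ nabla} in
theorem IsCompatiblePair.gauge
    {B₀ B : ∀ q : Q, TangentSpace 𝓘(ℝ, EQ) q →L[ℝ] TangentSpace 𝓘(ℝ, EQ) q →L[ℝ] DualFib V q}
    (h₀ : IsCompatiblePair Ψ nabla B₀) (hA : IsSmoothOneForm F A)
    (hB : IsGaugedForm Ψ nabla B₀ A B) :
    IsCompatiblePair Ψ (nabla.addOneForm (negCoadForm Ψ A)) B := by
  have hn := h₀.smooth_connection
  have hn' := smooth_addOneForm Ψ hn hA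
  have hB' := hB.isSmoothTwoForm hn hA h₀.smooth_form
  have hD : ∀ v η, dualCovSec hn' v η = dualCovHom hn v η + psiHom Ψ (oneFormSec hA v) η := by
    intro v η
    ext q : 1
    exact dualCov_addOneForm Ψ nabla A (v q) η.mdifferentiableAt
  have hF : ∀ v w, formSec hB' v w = gaugeTwoForm (psiHom Ψ) (dualCovHom hn) lieVF
      (oneFormSec hA) (formSec h₀.smooth_form) v w := by
    intro v w
    ext q : 1
    exact hB v w q
  have hskew : ∀ a b, psiHom Ψ a b = -psiHom Ψ b a := by
    intro a b
    ext q : 1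
    exact Psi_swap Ψ q _ _
  have hjac : ∀ a b c, psiHom Ψ a (psiHom Ψ b c) + psiHom Ψ b (psiHom Ψ c a)
      + psiHom Ψ c (psiHom Ψ a b) = 0 := by
    intro a b c
    ext q : 1
    exact Ψ.jacobi q _ _ _
  have hder : ∀ v a b, dualCovHom hn v (psiHom Ψ a b)
      = psiHom Ψ (dualCovHom hn v a) b + psiHom Ψ a (dualCovHom hn v b) := h₀.dual_preserves
  have hcurv : ∀ v w a, dualCovHom hn v (dualCovHom hn w a) - dualCovHom hn w (dualCovHom hn v a)
      - dualCovHom hn (lieVF v w) a = psiHom Ψ (formSec h₀.smooth_form v w) a :=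
    h₀.dual_curvature
  have hbi : ∀ u v w, dualCovHom hn u (formSec h₀.smooth_form v w)
      - formSec h₀.smooth_form (lieVF u v) w
      + (dualCovHom hn v (formSec h₀.smooth_form w u) - formSec h₀.smooth_form (lieVF v w) u)
      + (dualCovHom hn w (formSec h₀.smooth_form u v) - formSec h₀.smooth_form (lieVF w u) v)
      = 0 := by
    intro u v w
    ext q : 1
    exact h₀.covariantly_constant u v w q
  refine isCompatiblePair_of_dual hn' hB' (fun v η θ => ?_) (fun v w η => ?_) fun u v w => ?_
  · change dualCovSec hn' v (psiHom Ψ η θ) = psiHom Ψ _ _ + psiHom Ψ _ _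
    -- By Jacobi `ad_A` is a derivation of the bracket, so adding it to `∇^*` keeps condition (i).
    have hj := hjac (oneFormSec hA v) η θ
    rw [hskew θ (oneFormSec hA v), map_neg, hskew θ (psiHom Ψ _ _)] at hj
    simp only [hD, hder, map_add, AddMonoidHom.add_apply]
    linear_combination (norm := module) hj
  · simp only [hD, hF]
    exact gauge_curvature hskew hjac hder hcurv v w η
  · simp only [hD, hF]
    exact gauge_bianchi hskew hjac hder hcurv lieVF_jacobi hbi u v w

end TwoForm

end Gauge
end Wong

namespace Wong

/-! ### Exponentials of co-adjoint operators -/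

section CoadExp

variable {EQ : Type*} [NormedAddCommGroup EQ] [NormedSpace ℝ EQ] [FiniteDimensional ℝ EQ]
  {Q : Type*} [TopologicalSpace Q] [ChartedSpace EQ Q] [IsManifold 𝓘(ℝ, EQ) ∞ Q] [T2Space Q]
  {F : Type*} [NormedAddCommGroup F] [NormedSpace ℝ F] [FiniteDimensional ℝ F]
  {V : Q → Type*} [TopologicalSpace (TotalSpace F V)]
  [∀ q, AddCommGroup (V q)] [∀ q, Module ℝ (V q)] [∀ q, TopologicalSpace (V q)]
  [∀ q, IsTopologicalAddGroup (V q)] [∀ q, ContinuousSMul ℝ (V q)]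
  [FiberBundle F V] [VectorBundle ℝ F V] [ContMDiffVectorBundle ∞ F V 𝓘(ℝ, EQ)]

variable (F V) in
/-- The identification of the fibre over `q` with the model fibre. -/
def fibEquiv (q : Q) : V q ≃L[ℝ] F := VectorBundle.continuousLinearEquivAt ℝ F V q

theorem fibEquiv_apply (q : Q) (y : V q) :
    fibEquiv F V q y = (trivializationAt F V q ⟨q, y⟩).2 := rfl

variable (Ψ : LiePoissonStructure EQ F V)

/-- The co-adjoint operator read in the model fibre. -/
def coadMat (q : Q) : DualFib V q →ₗ[ℝ] (F →L[ℝ] F) where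
  toFun ξ := (fibEquiv F V q : V q →L[ℝ] F) ∘L coad Ψ q ξ ∘L ((fibEquiv F V q).symm : F →L[ℝ] V q)
  map_add' ξ ξ' := by
    ext x
    simp only [ContinuousLinearMap.coe_comp, Function.comp_apply, add_apply,
      ContinuousLinearEquiv.coe_coe, ← map_add]
    congr 1
    exact dual_ext F fun θ => by simp [apply_coad]
  map_smul' c ξ := by
    ext x
    simp only [ContinuousLinearMap.coe_comp, Function.comp_apply, smul_apply,
      ContinuousLinearEquiv.coe_coe, ← map_smul, RingHom.id_apply]
    congr 1
    exact dual_ext F fun θ => by simp [apply_coad]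

/-- A fibre `V q` carries a topology but no norm. Exponential series and derivatives are therefore
taken in `F →L[ℝ] F` and brought back by this intertwining relation. -/
theorem coadMat_apply (q : Q) (ξ : DualFib V q) (y : V q) :
    coadMat Ψ q ξ (fibEquiv F V q y) = fibEquiv F V q (coad Ψ q ξ y) := by
  simp [coadMat]

/-- The exponential of the co-adjoint operator. -/
def coadExp (q : Q) (ξ : DualFib V q) : V q →L[ℝ] V q :=
  ((fibEquiv F V q).symm : F →L[ℝ] V q) ∘L NormedSpace.exp (coadMat Ψ q ξ) ∘L
    (fibEquiv F V q : V q →L[ℝ] F)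

theorem fibEquiv_coadExp (q : Q) (ξ : DualFib V q) (y : V q) :
    fibEquiv F V q (coadExp Ψ q ξ y)
      = NormedSpace.exp (coadMat Ψ q ξ) (fibEquiv F V q y) := by
  simp [coadExp]

theorem coadExp_zero (q : Q) (y : V q) : coadExp Ψ q 0 y = y := by
  simp [coadExp]

theorem coadExp_add_smul (q : Q) (ξ : DualFib V q) (s t : ℝ) (y : V q) :
    coadExp Ψ q ((s + t) • ξ) y = coadExp Ψ q (s • ξ) (coadExp Ψ q (t • ξ) y) := by
  let _ : NormedAlgebra ℚ (F →L[ℝ] F) := NormedAlgebra.restrictScalars ℚ ℝ _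
  apply (fibEquiv F V q).injective
  have hc : Commute (coadMat Ψ q (s • ξ)) (coadMat Ψ q (t • ξ)) := by
    rw [map_smul, map_smul]
    exact ((Commute.refl _).smul_left s).smul_right t
  rw [fibEquiv_coadExp, fibEquiv_coadExp, fibEquiv_coadExp, add_smul, map_add,
    NormedSpace.exp_add_of_commute hc]
  rfl

theorem coadExp_neg_apply (q : Q) (ξ : DualFib V q) (t : ℝ) (y : V q) :
    coadExp Ψ q ((-t) • ξ) (coadExp Ψ q (t • ξ) y) = y := by
  rw [← coadExp_add_smul, neg_add_cancel, zero_smul, coadExp_zero]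

/-- The bracket with `ξ` is the transpose of `coadMat`. -/
theorem iterate_Psi_apply (q : Q) (ξ η : DualFib V q) (n : ℕ) (y : V q) :
    ((fun θ => Ψ.Psi q ξ θ)^[n] η) y
      = η ((fibEquiv F V q).symm ((coadMat Ψ q ξ ^ n) (fibEquiv F V q y))) := by
  induction n generalizing y with
  | zero => simp
  | succ n ih =>
    rw [Function.iterate_succ_apply', ← apply_coad, ih, ← coadMat_apply, pow_succ]
    rfl

/-- `ad_ξ` is the transpose of `ad^*_ξ`, so its exponential series converges to the transpose of the
exponential of the co-adjoint operator. This settles the convergence of `adExp` and evaluates it. -/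
theorem hasSum_adExp (q : Q) (ξ η : DualFib V q) (t : ℝ) :
    HasSum (fun n : ℕ => (t ^ n / (n.factorial : ℝ)) • (fun θ => Ψ.Psi q ξ θ)^[n] η)
      (η ∘L coadExp Ψ q (t • ξ)) := by
  have h := NormedSpace.exp_series_hasSum_exp' (𝕂 := ℝ) (coadMat Ψ q (t • ξ))
  -- The continuous linear map `X ↦ η ∘ e⁻¹ ∘ X ∘ e`, with `e` the fibre identification, carries one
  -- series into the other.
  let Λ : (F →L[ℝ] F) →L[ℝ] DualFib V q :=
    (ContinuousLinearMap.precomp ℝ (fibEquiv F V q : V q →L[ℝ] F)) ∘L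
      (ContinuousLinearMap.postcomp F (η ∘L ((fibEquiv F V q).symm : F →L[ℝ] V q)))
  convert! h.mapL Λ using 1
  funext n
  ext y
  simp only [map_smul, smul_apply, iterate_Psi_apply, smul_pow, Λ]
  simp [div_eq_inv_mul, mul_assoc]

theorem adExp_eq (q : Q) (ξ η : DualFib V q) (t : ℝ) :
    adExp Ψ q t ξ η = η ∘L coadExp Ψ q (t • ξ) :=
  (hasSum_adExp Ψ q ξ η t).tsum_eq

theorem hasDerivAt_exp_coadMat (q : Q) (ξ : DualFib V q) (t : ℝ) :
    HasDerivAt (fun t : ℝ => NormedSpace.exp (coadMat Ψ q (t • ξ)))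
      (coadMat Ψ q ξ * NormedSpace.exp (coadMat Ψ q (t • ξ))) t := by
  simp only [map_smul]
  exact hasDerivAt_exp_smul_const' _ t

theorem hasDerivAt_exp_coadMat_neg (q : Q) (ξ : DualFib V q) (t : ℝ) :
    HasDerivAt (fun t : ℝ => NormedSpace.exp (coadMat Ψ q ((-t) • ξ)))
      (-(coadMat Ψ q ξ * NormedSpace.exp (coadMat Ψ q ((-t) • ξ)))) t := by
  have := (hasDerivAt_exp_coadMat Ψ q ξ (-t)).scomp t (hasDerivAt_neg t)
  rw [neg_one_smul] at this
  exact this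

theorem coadMat_commute_exp (q : Q) (ξ : DualFib V q) (t : ℝ) :
    coadMat Ψ q ξ * NormedSpace.exp (coadMat Ψ q (t • ξ))
      = NormedSpace.exp (coadMat Ψ q (t • ξ)) * coadMat Ψ q ξ := by
  let _ : NormedAlgebra ℚ (F →L[ℝ] F) := NormedAlgebra.restrictScalars ℚ ℝ _
  rw [map_smul]
  exact (((Commute.refl (coadMat Ψ q ξ)).smul_right t).exp_right).eq

/-- The bracket of the fibre over `q` read in the model fibre. -/
def psiMat (q : Q) : (F →L[ℝ] ℝ) →L[ℝ] (F →L[ℝ] ℝ) →L[ℝ] (F →L[ℝ] ℝ) :=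
  let E : DualFib V q ≃L[ℝ] (F →L[ℝ] ℝ) :=
    (fibEquiv F V q).arrowCongr (ContinuousLinearEquiv.refl ℝ ℝ)
  E.arrowCongr (E.arrowCongr E) (Ψ.Psi q)

theorem psiMat_apply (q : Q) (α β : F →L[ℝ] ℝ) (x : F) :
    psiMat Ψ q α β x = Ψ.Psi q (α ∘L (fibEquiv F V q : V q →L[ℝ] F))
      (β ∘L (fibEquiv F V q : V q →L[ℝ] F)) ((fibEquiv F V q).symm x) := rfl

theorem comp_coadMat (q : Q) (ξ : DualFib V q) (α : F →L[ℝ] ℝ) :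
    (α ∘L coadMat Ψ q ξ) ∘L (fibEquiv F V q : V q →L[ℝ] F)
      = Ψ.Psi q ξ (α ∘L (fibEquiv F V q : V q →L[ℝ] F)) := by
  ext y
  rw [← apply_coad]
  simp [coadMat_apply]

/-- The Jacobi identity evaluated at a point: the infinitesimal version of `coadExp_bracket`. -/
theorem psiMat_derivation (q : Q) (ξ : DualFib V q) (α β : F →L[ℝ] ℝ) (x : F) :
    psiMat Ψ q (α ∘L coadMat Ψ q ξ) β x + psiMat Ψ q α (β ∘L coadMat Ψ q ξ) x
      = psiMat Ψ q α β (coadMat Ψ q ξ x) := by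
  have h := Ψ.jacobi q ξ (α ∘L (fibEquiv F V q : V q →L[ℝ] F))
    (β ∘L (fibEquiv F V q : V q →L[ℝ] F))
  have h' := congrArg (fun η => η ((fibEquiv F V q).symm x)) h
  simp only [add_apply, zero_apply] at h'
  rw [psiMat_apply, psiMat_apply, psiMat_apply, comp_coadMat, comp_coadMat]
  have e : (fibEquiv F V q).symm (coadMat Ψ q ξ x)
      = coad Ψ q ξ ((fibEquiv F V q).symm x) := by simp [coadMat]
  rw [e, apply_coad, Psi_swap Ψ q (Ψ.Psi q ξ _)]
  rw [Psi_swap Ψ q (β ∘L (fibEquiv F V q : V q →L[ℝ] F)) ξ] at h'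
  simp only [map_neg, neg_apply] at h' ⊢
  linarith

/-- With `E t` the exponential of `t ad^*_ξ`, the bracket of `η ∘ E t` and `θ ∘ E t` at the point `E
(-t) x` has derivative zero in `t`, by `psiMat_derivation`. Its values at `1` and `0` are the two
sides. -/
theorem coadExp_bracket (q : Q) (ξ η θ : DualFib V q) :
    Ψ.Psi q (η ∘L coadExp Ψ q ξ) (θ ∘L coadExp Ψ q ξ) = Ψ.Psi q η θ ∘L coadExp Ψ q ξ := by
  ext y
  set e : V q →L[ℝ] F := (fibEquiv F V q : V q →L[ℝ] F) with he
  set e' : F →L[ℝ] V q := ((fibEquiv F V q).symm : F →L[ℝ] V q) with he'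
  let E : ℝ → F →L[ℝ] F := fun t => NormedSpace.exp (coadMat Ψ q (t • ξ))
  -- Chosen so that `E (-t) x` represents `y` at `t = 1` and the image of `y` under `coadExp` at `t
  -- = 0`.
  let x : F := fibEquiv F V q (coadExp Ψ q ξ y)
  have hpre : ∀ (α : F →L[ℝ] ℝ) t, HasDerivAt (fun t => α ∘L E t)
      ((α ∘L E t) ∘L coadMat Ψ q ξ) t := by
    intro α t
    have h := ((ContinuousLinearMap.compL ℝ F F ℝ α).hasFDerivAt).comp_hasDerivAt t
      (hasDerivAt_exp_coadMat Ψ q ξ t)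
    rw [coadMat_commute_exp] at h
    exact h
  have key : ∀ t, HasDerivAt
      (fun t => psiMat Ψ q ((η ∘L e') ∘L E t) ((θ ∘L e') ∘L E t) (E (-t) x)) 0 t := by
    intro t
    have h1 := ((psiMat Ψ q).hasFDerivAt.comp_hasDerivAt t (hpre (η ∘L e') t)).clm_apply
      (hpre (θ ∘L e') t)
    have h2 : HasDerivAt (fun t => E (-t) x) (-(coadMat Ψ q ξ (E (-t) x))) t :=
      (hasDerivAt_exp_coadMat_neg Ψ q ξ t).clm_apply (hasDerivAt_const t x) |>.congr_deriv
        (by simp [E])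
    have h3 := h1.clm_apply h2
    refine h3.congr_deriv ?_
    have := psiMat_derivation Ψ q ξ ((η ∘L e') ∘L E t) ((θ ∘L e') ∘L E t) (E (-t) x)
    simp only [add_apply, Function.comp_apply, map_neg]
    linarith
  have hconst := is_const_of_deriv_eq_zero (fun t => (key t).differentiableAt)
    (fun t => (key t).deriv) 1 0
  have hx : (fibEquiv F V q).symm (E (-1) x) = y := by
    have := coadExp_neg_apply Ψ q ξ 1 y
    rw [one_smul] at this
    exact this
  have h1 : ∀ η : DualFib V q, ((η ∘L e') ∘L E 1) ∘L e = η ∘L coadExp Ψ q ξ := by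
    intro η; ext z; simp [coadExp, E, e, e']
  have h0 : ∀ η : DualFib V q, ((η ∘L e') ∘L E 0) ∘L e = η := by
    intro η; ext z; simp [E, e, e']
  have hx0 : (fibEquiv F V q).symm (E (-0) x) = coadExp Ψ q ξ y := by
    simp [E, x]
  simp only [psiMat_apply, hx, hx0, ← he, h1, h0] at hconst
  exact hconst

end CoadExp

end Wong

namespace Wong

/-! ### The action on the fibres -/

section Action

variable {EQ : Type*} [NormedAddCommGroup EQ] [NormedSpace ℝ EQ] [FiniteDimensional ℝ EQ]
  {Q : Type*} [TopologicalSpace Q] [ChartedSpace EQ Q] [IsManifold 𝓘(ℝ, EQ) ∞ Q] [T2Space Q]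
  {F : Type*} [NormedAddCommGroup F] [NormedSpace ℝ F] [FiniteDimensional ℝ F]
  {V : Q → Type*} [TopologicalSpace (TotalSpace F V)]
  [∀ q, AddCommGroup (V q)] [∀ q, Module ℝ (V q)] [∀ q, TopologicalSpace (V q)]
  [∀ q, IsTopologicalAddGroup (V q)] [∀ q, ContinuousSMul ℝ (V q)]
  [FiberBundle F V] [VectorBundle ℝ F V] [ContMDiffVectorBundle ∞ F V 𝓘(ℝ, EQ)]
  {EG : Type*} [NormedAddCommGroup EG] [NormedSpace ℝ EG]
  {G : Type*} [Group G] [TopologicalSpace G] [ChartedSpace EG G] [LieGroup 𝓘(ℝ, EG) ∞ G]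

theorem hasDerivAt_comp_oneParameter {E' : Type*} [NormedAddCommGroup E'] [NormedSpace ℝ E']
    {a : GroupLieAlgebra 𝓘(ℝ, EG) G} {γ : ℝ → G} (hγ : ContMDiff 𝓘(ℝ, ℝ) 𝓘(ℝ, EG) ∞ γ)
    (h0 : γ 0 = 1) (ha : (mfderiv 𝓘(ℝ, ℝ) 𝓘(ℝ, EG) γ 0 (1 : ℝ) : EG) = (a : EG))
    {k : G → E'} (hk : MDifferentiableAt 𝓘(ℝ, EG) 𝓘(ℝ, E') k 1) :
    HasDerivAt (fun t => k (γ t)) (mfderiv 𝓘(ℝ, EG) 𝓘(ℝ, E') k 1 a : E') 0 := by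
  have hk' : MDifferentiableAt 𝓘(ℝ, EG) 𝓘(ℝ, E') k (γ 0) := by rwa [h0]
  have h1 := (hk'.hasMFDerivAt.comp 0 ((hγ 0).mdifferentiableAt (by simp)).hasMFDerivAt)
  let L : ℝ →L[ℝ] E' := (mfderiv 𝓘(ℝ, EG) 𝓘(ℝ, E') k (γ 0)).comp
    (mfderiv 𝓘(ℝ, ℝ) 𝓘(ℝ, EG) γ 0)
  have h2 : HasFDerivAt (k ∘ γ) L 0 := h1.hasFDerivAt
  refine h2.hasDerivAt.congr_deriv ?_
  -- The type of `mfderiv` depends on its base point. The equality `γ 0 = 1` is therefore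
  -- substituted in a statement about plain vectors of the model space.
  have e : ∀ x : G, x = 1 → ∀ v : EG, (mfderiv 𝓘(ℝ, EG) 𝓘(ℝ, E') k x : EG → E') v
      = (mfderiv 𝓘(ℝ, EG) 𝓘(ℝ, E') k 1 : EG → E') v := by rintro x rfl v; rfl
  exact (e _ h0 _).trans (congrArg (mfderiv 𝓘(ℝ, EG) 𝓘(ℝ, E') k 1 : EG → E') ha)

theorem contMDiff_fibreLine (z : TotalSpace F V) (w : V z.1) :
    ContMDiff 𝓘(ℝ, ℝ) (𝓘(ℝ, EQ).prod 𝓘(ℝ, F)) ∞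
      (fun t : ℝ => (⟨z.1, z.2 + t • w⟩ : TotalSpace F V)) := by
  intro t
  rw [contMDiffAt_totalSpace]
  refine ⟨contMDiffAt_const, ?_⟩
  have : (fun t : ℝ => (trivializationAt F V z.1 ⟨z.1, z.2 + t • w⟩).2)
      = fun t : ℝ => fibEquiv F V z.1 z.2 + t • fibEquiv F V z.1 w := by
    funext t
    rw [← fibEquiv_apply, map_add, map_smul]
  change ContMDiffAt _ _ _ (fun t : ℝ => (trivializationAt F V z.1 ⟨z.1, z.2 + t • w⟩).2) t
  rw [this]
  exact (contMDiff_const.add (contMDiff_id.smul contMDiff_const)) t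

theorem hasDerivAt_fibreLine {E' : Type*} [NormedAddCommGroup E'] [NormedSpace ℝ E']
    (z : TotalSpace F V) (w : V z.1) {φ : TotalSpace F V → E'}
    (hφ : MDifferentiableAt (𝓘(ℝ, EQ).prod 𝓘(ℝ, F)) 𝓘(ℝ, E') φ z) :
    HasDerivAt (fun t : ℝ => φ ⟨z.1, z.2 + t • w⟩)
      (mfderiv (𝓘(ℝ, EQ).prod 𝓘(ℝ, F)) 𝓘(ℝ, E') φ z (verticalVector z w)) 0 := by
  have e : (⟨z.1, z.2 + (0 : ℝ) • w⟩ : TotalSpace F V) = z := by simp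
  have hφ' : MDifferentiableAt (𝓘(ℝ, EQ).prod 𝓘(ℝ, F)) 𝓘(ℝ, E') φ
    (⟨z.1, z.2 + (0 : ℝ) • w⟩ : TotalSpace F V) := by rwa [e]
  have h1 := (hφ'.hasMFDerivAt.comp (0 : ℝ)
    ((contMDiff_fibreLine z w 0).mdifferentiableAt (by simp)).hasMFDerivAt)
  let L : ℝ →L[ℝ] E' := (mfderiv (𝓘(ℝ, EQ).prod 𝓘(ℝ, F)) 𝓘(ℝ, E') φ _).comp
    (mfderiv 𝓘(ℝ, ℝ) (𝓘(ℝ, EQ).prod 𝓘(ℝ, F))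
      (fun t : ℝ => (⟨z.1, z.2 + t • w⟩ : TotalSpace F V)) 0)
  have h2 : HasFDerivAt (φ ∘ fun t : ℝ => (⟨z.1, z.2 + t • w⟩ : TotalSpace F V)) L 0 :=
    h1.hasFDerivAt
  refine h2.hasDerivAt.congr_deriv ?_
  have e' : ∀ x : TotalSpace F V, x = z → ∀ v : EQ × F,
      (mfderiv (𝓘(ℝ, EQ).prod 𝓘(ℝ, F)) 𝓘(ℝ, E') φ x : EQ × F → E') v
      = (mfderiv (𝓘(ℝ, EQ).prod 𝓘(ℝ, F)) 𝓘(ℝ, E') φ z : EQ × F → E') v := by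
    rintro x rfl v; rfl
  exact e' _ e _

variable [MulAction G (TotalSpace F V)]
  [ContMDiffSMul 𝓘(ℝ, EG) (𝓘(ℝ, EQ).prod 𝓘(ℝ, F)) ∞ G (TotalSpace F V)]
  {Ψ : LiePoissonStructure EQ F V}
  {s : GroupLieAlgebra 𝓘(ℝ, EG) G →ₗ[ℝ] DualSections EQ F V}

/-- Functions on the total space change along the orbit of a one-parameter subgroup by their
derivative along the infinitesimal generator. -/
theorem HasCoadGenerators.hasDerivAt_orbit (hs : HasCoadGenerators Ψ s)
    {E' : Type*} [NormedAddCommGroup E'] [NormedSpace ℝ E']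
    {a : GroupLieAlgebra 𝓘(ℝ, EG) G} {γ : ℝ → G} (hγ : ContMDiff 𝓘(ℝ, ℝ) 𝓘(ℝ, EG) ∞ γ)
    (hadd : ∀ t t', γ (t + t') = γ t * γ t')
    (ha : (mfderiv 𝓘(ℝ, ℝ) 𝓘(ℝ, EG) γ 0 (1 : ℝ) : EG) = (a : EG)) (z : TotalSpace F V) (t₀ : ℝ)
    {φ : TotalSpace F V → E'}
    (hφ : MDifferentiableAt (𝓘(ℝ, EQ).prod 𝓘(ℝ, F)) 𝓘(ℝ, E') φ (γ t₀ • z)) :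
    HasDerivAt (fun t => φ (γ t • z)) (deriv (fun t : ℝ => φ ⟨(γ t₀ • z).1,
      (γ t₀ • z).2 + t • coad Ψ _ (s a (γ t₀ • z).1) (γ t₀ • z).2⟩) 0) t₀ := by
  have h0 : γ 0 = 1 := by
    have := hadd 0 0
    rw [add_zero] at this
    exact (left_eq_mul.1 this)
  set w := γ t₀ • z with hw
  have hsm : ContMDiff 𝓘(ℝ, EG) (𝓘(ℝ, EQ).prod 𝓘(ℝ, F)) ∞ (fun g : G => g • w) :=
    contMDiff_id.smul contMDiff_const
  have hφ1 : MDifferentiableAt (𝓘(ℝ, EQ).prod 𝓘(ℝ, F)) 𝓘(ℝ, E') φ ((1 : G) • w) := by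
    rwa [one_smul]
  have hd := (hφ1.hasMFDerivAt.comp (1 : G)
    ((hsm 1).mdifferentiableAt (by simp)).hasMFDerivAt)
  have h1 := hasDerivAt_comp_oneParameter hγ h0 ha (k := fun g => φ (g • w)) hd.mdifferentiableAt
  -- Since `γ t • z = γ (t - t₀) • w`, the derivative at `t₀` reduces to one at the identity, the
  -- only place where the generators are given.
  have h2 : HasDerivAt (fun t => φ (γ (t - t₀) • w))
      (mfderiv 𝓘(ℝ, EG) 𝓘(ℝ, E') (fun g => φ (g • w)) 1 a : E') t₀ := by
    have h1' : HasDerivAt (fun t => φ (γ t • w))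
      (mfderiv 𝓘(ℝ, EG) 𝓘(ℝ, E') (fun g => φ (g • w)) 1 a : E') (t₀ - t₀) := by
        rwa [sub_self]
    exact h1'.comp_sub_const t₀ t₀
  have h3 : (fun t => φ (γ (t - t₀) • w)) = fun t => φ (γ t • z) := by
    funext t
    rw [hw, smul_smul, ← hadd, sub_add_cancel]
  rw [h3] at h2
  refine h2.congr_deriv ?_
  rw [(hasDerivAt_fibreLine w _ hφ).deriv]
  have h4 : (mfderiv 𝓘(ℝ, EG) 𝓘(ℝ, E') (fun g => φ (g • w)) 1 : EG → E') a =
    (mfderiv (𝓘(ℝ, EQ).prod 𝓘(ℝ, F)) 𝓘(ℝ, E') φ ((1 : G) • w) : EQ × F → E')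
      (mfderiv 𝓘(ℝ, EG) (𝓘(ℝ, EQ).prod 𝓘(ℝ, F)) (fun g : G => g • w) 1 a : EQ × F) :=
    DFunLike.congr_fun hd.mfderiv a
  have e' : ∀ x : TotalSpace F V, x = w → ∀ v : EQ × F,
      (mfderiv (𝓘(ℝ, EQ).prod 𝓘(ℝ, F)) 𝓘(ℝ, E') φ x : EQ × F → E') v
      = (mfderiv (𝓘(ℝ, EQ).prod 𝓘(ℝ, F)) 𝓘(ℝ, E') φ w : EQ × F → E') v := by
    rintro x rfl v; rfl
  refine h4.trans ((e' _ (one_smul G w) _).trans ?_)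
  rw [hs a w]

/-- A function pulled back from `Q` has zero derivative along the vertical generator, so it is
constant on the orbit. If the base point moved, a cutoff separating its two positions would
contradict this. -/
theorem HasCoadGenerators.proj_smul (hs : HasCoadGenerators Ψ s)
    {a : GroupLieAlgebra 𝓘(ℝ, EG) G} {γ : ℝ → G} (hγ : ContMDiff 𝓘(ℝ, ℝ) 𝓘(ℝ, EG) ∞ γ)
    (hadd : ∀ t t', γ (t + t') = γ t * γ t')
    (ha : (mfderiv 𝓘(ℝ, ℝ) 𝓘(ℝ, EG) γ 0 (1 : ℝ) : EG) = (a : EG)) (z : TotalSpace F V) (t : ℝ) :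
    (γ t • z).1 = z.1 := by
  have h0 : γ 0 = 1 := by
    have := hadd 0 0
    rw [add_zero] at this
    exact (left_eq_mul.1 this)
  by_contra hne
  obtain ⟨ψ, hψ, hψ1, hψs⟩ := exists_cutoff (I := 𝓘(ℝ, EQ))
    (isOpen_compl_singleton.mem_nhds (Ne.symm hne : z.1 ∈ ({(γ t • z).1}ᶜ : Set Q)))
  have hd : ∀ t₀, HasDerivAt (fun t => ψ (γ t • z).1) 0 t₀ := by
    intro t₀
    have h := hs.hasDerivAt_orbit hγ hadd ha z t₀ (φ := fun z => ψ z.1)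
      (((hψ _).comp _ (contMDiff_proj V _)).mdifferentiableAt (by simp))
    simpa using h
  have := is_const_of_deriv_eq_zero (fun t => (hd t).differentiableAt) (fun t => (hd t).deriv) t 0
  simp only [h0, one_smul] at this
  rw [hψ1.self_of_nhds, image_eq_zero_of_notMem_tsupport fun hm => hψs hm rfl] at this
  simp at this

/-- The orbit stays in the fibre over `q`, where one trivialization reads it as a curve `x` solving
`x' = ad^* x`. Then `exp(-t ad^*) x(t)` has derivative zero, which determines `x`. -/
theorem HasCoadGenerators.smul_oneParameter (hs : HasCoadGenerators Ψ s)
    {a : GroupLieAlgebra 𝓘(ℝ, EG) G} {γ : ℝ → G} (hγ : ContMDiff 𝓘(ℝ, ℝ) 𝓘(ℝ, EG) ∞ γ)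
    (hadd : ∀ t t', γ (t + t') = γ t * γ t')
    (ha : (mfderiv 𝓘(ℝ, ℝ) 𝓘(ℝ, EG) γ 0 (1 : ℝ) : EG) = (a : EG)) (q : Q) (y : V q) (t : ℝ) :
    γ t • (⟨q, y⟩ : TotalSpace F V) = ⟨q, coadExp Ψ q (t • s a q) y⟩ := by
  have h0 : γ 0 = 1 := by
    have := hadd 0 0
    rw [add_zero] at this
    exact (left_eq_mul.1 this)
  set z : TotalSpace F V := ⟨q, y⟩
  let x : ℝ → F := fun t => (trivializationAt F V q (γ t • z)).2
  have hx : ∀ t₀, HasDerivAt x (coadMat Ψ q (s a q) (x t₀)) t₀ := by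
    intro t₀
    have hproj : (γ t₀ • z).1 = q := hs.proj_smul hγ hadd ha z t₀
    have hmem : γ t₀ • z ∈ (trivializationAt F V q).source := by
      rw [Trivialization.mem_source, hproj]
      exact mem_baseSet_trivializationAt F V q
    have hφ : MDifferentiableAt (𝓘(ℝ, EQ).prod 𝓘(ℝ, F)) 𝓘(ℝ, F)
        (fun z => (trivializationAt F V q z).2) (γ t₀ • z) := by
      have h := ((trivializationAt F V q).contMDiffOn (IB := 𝓘(ℝ, EQ)) (n := ∞)).contMDiffAt
        ((trivializationAt F V q).open_source.mem_nhds hmem)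
      exact h.snd.mdifferentiableAt (by simp)
    refine (hs.hasDerivAt_orbit hγ hadd ha z t₀ hφ).congr_deriv ?_
    change _ = coadMat Ψ q (s a q) ((trivializationAt F V q (γ t₀ • z)).2)
    -- The orbit point lies over `q` only by a proved equality; once it is made a variable, its base
    -- point can be substituted.
    generalize γ t₀ • z = z' at hproj
    obtain ⟨q', y'⟩ := z'
    obtain rfl : q' = q := hproj
    have e : (fun t : ℝ => (trivializationAt F V q' ⟨q', y' + t • coad Ψ q' (s a q') y'⟩).2)
        = fun t : ℝ => fibEquiv F V q' y' + t • fibEquiv F V q' (coad Ψ q' (s a q') y') := by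
      funext t
      rw [← fibEquiv_apply, map_add, map_smul]
    change deriv (fun t : ℝ => (trivializationAt F V q' ⟨q', y' + t • coad Ψ q' (s a q') y'⟩).2) 0
      = _
    rw [e, ← fibEquiv_apply, coadMat_apply]
    have := ((hasDerivAt_id (0 : ℝ)).smul_const
      (fibEquiv F V q' (coad Ψ q' (s a q') y'))).const_add (fibEquiv F V q' y')
    simpa using this.deriv
  let E : ℝ → F →L[ℝ] F := fun t => NormedSpace.exp (coadMat Ψ q (t • s a q))
  have hE : ∀ t₀, HasDerivAt (fun t => E (-t) (x t)) 0 t₀ := by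
    intro t₀
    refine ((hasDerivAt_exp_coadMat_neg Ψ q (s a q) t₀).clm_apply (hx t₀)).congr_deriv ?_
    rw [coadMat_commute_exp]
    simp
  have hc := is_const_of_deriv_eq_zero (fun t => (hE t).differentiableAt)
    (fun t => (hE t).deriv) t 0
  have hx0 : x 0 = fibEquiv F V q y := by simp only [x, h0, one_smul]; rfl
  have hE0 : E 0 = 1 := by simp [E]
  have hproj : (γ t • z).1 = q := hs.proj_smul hγ hadd ha z t
  have hxt : x t = fibEquiv F V q (coadExp Ψ q (t • s a q) y) := by
    rw [fibEquiv_coadExp, ← hx0]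
    simp only [neg_zero, hE0, one_apply_eq_self] at hc
    rw [← hc]
    change x t = E t (E (-t) (x t))
    have h := coadExp_add_smul Ψ q (s a q) t (-t) ((fibEquiv F V q).symm (x t))
    rw [add_neg_cancel, zero_smul, coadExp_zero] at h
    have h' := congrArg (fibEquiv F V q) h
    simpa [fibEquiv_coadExp, E] using h'
  simp only [x] at hxt
  generalize γ t • z = z' at hproj hxt
  obtain ⟨q', y'⟩ := z'
  obtain rfl : q' = q := hproj
  rw [← fibEquiv_apply] at hxt
  rw [(fibEquiv F V q').injective hxt]

/-- The one-parameter subgroup of `IsExp`, acting on the fibres by exponentials. -/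
theorem HasCoadGenerators.smul_of_isExp (hs : HasCoadGenerators Ψ s)
    {a : GroupLieAlgebra 𝓘(ℝ, EG) G} {g : G} (h : IsExp a g) (q : Q) (y : V q) :
    g • (⟨q, y⟩ : TotalSpace F V) = ⟨q, coadExp Ψ q (s a q) y⟩ := by
  obtain ⟨γ, hγ, hadd, ha, rfl⟩ := h
  have := hs.smul_oneParameter hγ hadd ha q y 1
  rwa [one_smul] at this

/-- Reparametrizing `γ` by the factor `r` shows that `γ r` is the exponential of `r • a`. Statements
about single exponentials thus apply along the whole subgroup through `g`. -/
theorem IsExp.exists_oneParameter {a : GroupLieAlgebra 𝓘(ℝ, EG) G} {g : G} (h : IsExp a g) :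
    ∃ γ : ℝ → G, γ 1 = g ∧ (∀ t t', γ (t + t') = γ t * γ t') ∧ ∀ t : ℝ, IsExp (t • a) (γ t) := by
  obtain ⟨γ, hγ, hadd, ha, rfl⟩ := h
  refine ⟨γ, rfl, hadd, fun r => ⟨fun t => γ (t * r), hγ.comp ?_, fun t t' => ?_, ?_, ?_⟩⟩
  · exact (contDiff_id.mul contDiff_const).contMDiff
  · simp only [add_mul, hadd]
  · have h1 : HasMFDerivAt 𝓘(ℝ, ℝ) 𝓘(ℝ, ℝ) (fun t : ℝ => t * r) 0
        ((1 : ℝ →L[ℝ] ℝ).smulRight r) :=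
      ((hasDerivAt_id (0 : ℝ)).mul_const r |>.congr_deriv (by simp)).hasFDerivAt.hasMFDerivAt
    have hγ0 : HasMFDerivAt 𝓘(ℝ, ℝ) 𝓘(ℝ, EG) γ (0 * r)
      (mfderiv 𝓘(ℝ, ℝ) 𝓘(ℝ, EG) γ (0 * r)) := ((hγ _).mdifferentiableAt (by simp)).hasMFDerivAt
    have h2 := (hγ0.comp (0 : ℝ) h1).mfderiv
    have e' : ∀ x : ℝ, x = 0 → ∀ v : ℝ, (mfderiv 𝓘(ℝ, ℝ) 𝓘(ℝ, EG) γ x : ℝ → EG) v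
      = (mfderiv 𝓘(ℝ, ℝ) 𝓘(ℝ, EG) γ 0 : ℝ → EG) v := by rintro x rfl v; rfl
    have h3 : (mfderiv 𝓘(ℝ, ℝ) 𝓘(ℝ, EG) (fun t => γ (t * r)) 0 : ℝ → EG) 1
      = (mfderiv 𝓘(ℝ, ℝ) 𝓘(ℝ, EG) γ (0 * r) : ℝ → EG) ((1 : ℝ) • r) := DFunLike.congr_fun h2 1
    refine h3.trans ((e' _ (zero_mul r) _).trans ?_)
    have h4 : (mfderiv 𝓘(ℝ, ℝ) 𝓘(ℝ, EG) γ 0 : ℝ → EG) (r • (1 : ℝ))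
      = r • (mfderiv 𝓘(ℝ, ℝ) 𝓘(ℝ, EG) γ 0 : ℝ → EG) (1 : ℝ) := map_smul _ r _
    rw [one_smul, ← mul_one r, ← smul_eq_mul r, h4]
    simp only [smul_eq_mul, mul_one]
    exact congrArg (r • ·) ha
  · simp

/-! ### Haar measure on a compact group. -/

section Haar

variable {G : Type*} [Group G] [TopologicalSpace G] [IsTopologicalGroup G]
  [CompactSpace G] [MeasurableSpace G] [BorelSpace G]
  (μ : Measure G) [μ.IsHaarMeasure] [IsProbabilityMeasure μ]

/-- A right translate of `μ` is left invariant, hence a multiple of `μ`; both have total mass one,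
so the factor is one. -/
theorem isMulRightInvariant_of_compactSpace : μ.IsMulRightInvariant where
  map_mul_right_eq_self g := by
    have := Measure.isProbabilityMeasure_map (μ := μ) (measurable_mul_const g).aemeasurable
    have h := Measure.isMulInvariant_eq_smul_of_compactSpace (μ.map (· * g)) μ
    have h1 := congrArg (fun ν : Measure G => ν Set.univ) h
    simp only [measure_univ, Measure.smul_apply] at h1
    rw [ENNReal.smul_def, smul_eq_mul, mul_one] at h1
    rw [ENNReal.coe_eq_one.1 h1.symm, one_smul] at h
    exact h

theorem isInvInvariant_of_compactSpace : μ.IsInvInvariant where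
  inv_eq_self := by
    have := isMulRightInvariant_of_compactSpace μ
    have : IsProbabilityMeasure μ.inv := Measure.isProbabilityMeasure_map measurable_inv.aemeasurable
    have h := Measure.isMulInvariant_eq_smul_of_compactSpace μ.inv μ
    have h1 := congrArg (fun ν : Measure G => ν Set.univ) h
    simp only [measure_univ, Measure.smul_apply] at h1
    rw [ENNReal.smul_def, smul_eq_mul, mul_one] at h1
    rw [ENNReal.coe_eq_one.1 h1.symm, one_smul] at h
    exact h

/-- The map `x ↦ g / x` preserves `μ`, so for almost every `x` both `x` and `g / x` satisfy `p`.
This passes from logarithms of almost every element to statements about every element. -/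
theorem exists_mul_of_ae {p : G → Prop} (hp : ∀ᵐ g ∂μ, p g) (g : G) :
    ∃ g₁ g₂, p g₁ ∧ p g₂ ∧ g₁ * g₂ = g := by
  have := isInvInvariant_of_compactSpace μ
  have h := hp.and ((Measure.measurePreserving_div_left μ g).quasiMeasurePreserving.ae hp)
  obtain ⟨x, h1, h2⟩ := h.exists
  exact ⟨g / x, x, h2, h1, by simp⟩

end Haar

/-! ### Group elements as linear Poisson maps of the fibres. -/

section FibreAction

variable [CompactSpace G] [MeasurableSpace G] [BorelSpace G]
  (μ : Measure G) [μ.IsHaarMeasure] [IsProbabilityMeasure μ]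

/-- Every `g` is a product of two exponentials, and each of these acts by a linear map that respects
the bracket. -/
theorem HasCoadGenerators.exists_actsBy (hs : HasCoadGenerators Ψ s)
    {log : G → GroupLieAlgebra 𝓘(ℝ, EG) G} (hlog : IsLogChoice μ log) :
    ∃ Φ : G → ∀ q, V q →L[ℝ] V q, ActsBy (F := F) Φ ∧
      ∀ g q η θ, Ψ.Psi q (η ∘L Φ g q) (θ ∘L Φ g q) = Ψ.Psi q η θ ∘L Φ g q := by
  have := topologicalGroup_of_lieGroup 𝓘(ℝ, EG) ∞ (G := G)
  choose g₁ g₂ h₁ h₂ hg using exists_mul_of_ae μ hlog.exp_log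
  refine ⟨fun g q => coadExp Ψ q (s (log (g₁ g)) q) ∘L coadExp Ψ q (s (log (g₂ g)) q), ?_, ?_⟩
  · intro g q y
    conv_lhs => rw [← hg g, mul_smul, hs.smul_of_isExp (h₂ g), hs.smul_of_isExp (h₁ g)]
    rfl
  · intro g q η θ
    rw [← ContinuousLinearMap.comp_assoc, ← ContinuousLinearMap.comp_assoc, coadExp_bracket,
      coadExp_bracket, ContinuousLinearMap.comp_assoc]

end FibreAction

section ActsBy

theorem ActsBy.eq {Φ : G → ∀ q, V q →L[ℝ] V q} (hΦ : ActsBy (F := F) Φ) {g : G} {q : Q}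
    {y y' : V q} (h : g • (⟨q, y⟩ : TotalSpace F V) = ⟨q, y'⟩) : Φ g q y = y' := by
  rw [hΦ g q y] at h
  simpa using h

theorem ActsBy.mul {Φ : G → ∀ q, V q →L[ℝ] V q} (hΦ : ActsBy (F := F) Φ) (g h : G) (q : Q)
    (y : V q) : Φ (g * h) q y = Φ g q (Φ h q y) :=
  hΦ.eq (by rw [mul_smul, hΦ, hΦ])

theorem ActsBy.one {Φ : G → ∀ q, V q →L[ℝ] V q} (hΦ : ActsBy (F := F) Φ) (q : Q) (y : V q) :
    Φ 1 q y = y :=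
  hΦ.eq (one_smul _ _)

theorem ActsBy.inv_apply {Φ : G → ∀ q, V q →L[ℝ] V q} (hΦ : ActsBy (F := F) Φ) (g : G) (q : Q)
    (y : V q) : Φ g⁻¹ q (Φ g q y) = y := by
  rw [← hΦ.mul, inv_mul_cancel, hΦ.one]

theorem ActsBy.eq_coadExp {Φ : G → ∀ q, V q →L[ℝ] V q} (hΦ : ActsBy (F := F) Φ)
    (hs : HasCoadGenerators Ψ s) {a : GroupLieAlgebra 𝓘(ℝ, EG) G} {g : G} (h : IsExp a g)
    (q : Q) (y : V q) : Φ g q y = coadExp Ψ q (s a q) y :=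
  hΦ.eq (hs.smul_of_isExp h q y)

end ActsBy

end Action

/-! ### Smoothness of the action on sections, orbits and the phase space. -/

section SmoothAction

variable {EQ : Type*} [NormedAddCommGroup EQ] [NormedSpace ℝ EQ] [FiniteDimensional ℝ EQ]
  {Q : Type*} [TopologicalSpace Q] [ChartedSpace EQ Q] [IsManifold 𝓘(ℝ, EQ) ∞ Q] [T2Space Q]
  {F : Type*} [NormedAddCommGroup F] [NormedSpace ℝ F] [FiniteDimensional ℝ F]
  {V : Q → Type*} [TopologicalSpace (TotalSpace F V)]
  [∀ q, AddCommGroup (V q)] [∀ q, Module ℝ (V q)] [∀ q, TopologicalSpace (V q)]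
  [∀ q, IsTopologicalAddGroup (V q)] [∀ q, ContinuousSMul ℝ (V q)]
  [FiberBundle F V] [VectorBundle ℝ F V] [ContMDiffVectorBundle ∞ F V 𝓘(ℝ, EQ)]
  {EG : Type*} [NormedAddCommGroup EG] [NormedSpace ℝ EG]
  {G : Type*} [Group G] [TopologicalSpace G] [ChartedSpace EG G] [MulAction G (TotalSpace F V)]

theorem ActsBy.smoothSec
    (hG : ContMDiffSMul 𝓘(ℝ, EG) (𝓘(ℝ, EQ).prod 𝓘(ℝ, F)) ∞ G (TotalSpace F V))
    {Φ : G → ∀ q, V q →L[ℝ] V q} (hΦ : ActsBy (F := F) Φ) (g : G)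
    {ζ : ∀ q, V q} (hζ : SmoothSec EQ F ζ) : SmoothSec EQ F (fun q => Φ g q (ζ q)) := by
  have h := (ContMDiffSMul.contMDiff_const_smul (I := 𝓘(ℝ, EG)) (I' := 𝓘(ℝ, EQ).prod 𝓘(ℝ, F))
    (M := TotalSpace F V) (n := ∞) g).comp hζ
  refine h.congr fun q => ?_
  exact (hΦ g q (ζ q)).symm

theorem ActsBy.continuous_pair
    (hG : ContMDiffSMul 𝓘(ℝ, EG) (𝓘(ℝ, EQ).prod 𝓘(ℝ, F)) ∞ G (TotalSpace F V))
    {Φ : G → ∀ q, V q →L[ℝ] V q} (hΦ : ActsBy (F := F) Φ) (q : Q)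
    (y : V q) (η : DualFib V q) : Continuous fun g => η (Φ g q y) := by
  have h : ContMDiff 𝓘(ℝ, EG) (𝓘(ℝ, EQ).prod 𝓘(ℝ, F)) ∞
      (fun g : G => g • (⟨q, y⟩ : TotalSpace F V)) := contMDiff_id.smul contMDiff_const
  have h2 : Continuous fun g => fibEquiv F V q (Φ g q y) := by
    refine continuous_iff_continuousAt.2 fun g => ?_
    have h3 := (contMDiffAt_totalSpace.1 (h g)).2.continuousAt
    have e : (g • (⟨q, y⟩ : TotalSpace F V)).1 = q := by rw [hΦ]
    rw [e] at h3
    refine h3.congr (Eventually.of_forall fun g' => ?_)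
    simp only [hΦ g' q y, ← fibEquiv_apply]
  have h3 : Continuous fun g => (η ∘L ((fibEquiv F V q).symm : F →L[ℝ] V q))
    (fibEquiv F V q (Φ g q y)) := (ContinuousLinearMap.continuous _).comp h2
  simpa using h3

theorem ActsBy.exists_lift
    (hG : ContMDiffSMul 𝓘(ℝ, EG) (𝓘(ℝ, EQ).prod 𝓘(ℝ, F)) ∞ G (TotalSpace F V))
    {Φ : G → ∀ q, V q →L[ℝ] V q} (hΦ : ActsBy (F := F) Φ) :
    ∃ Φbar : G → C^∞⟮phaseModel EQ F, PhaseSpace EQ F V; phaseModel EQ F, PhaseSpace EQ F V⟯,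
      IsLiftedAction Φ Φbar := by
  refine ⟨fun g => ⟨fun z => phasePt z.1.1 z.1.2 (Φ g z.1.1 z.2), ?_⟩, fun g q p y => rfl⟩
  have h := (ContMDiffSMul.contMDiff_const_smul (I := 𝓘(ℝ, EG)) (I' := 𝓘(ℝ, EQ).prod 𝓘(ℝ, F))
    (M := TotalSpace F V) (n := ∞) g).comp (contMDiff_phaseToBundle (EQ := EQ) (F := F) (V := V))
  intro z
  rw [contMDiffAt_totalSpace]
  refine ⟨contMDiff_proj _ z, ?_⟩
  have h2 := (contMDiffAt_totalSpace.1 (h z)).2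
  have e : ∀ z : PhaseSpace EQ F V, g • phaseToBundle z
    = (⟨z.1.1, Φ g z.1.1 z.2⟩ : TotalSpace F V) := fun z => hΦ g z.1.1 z.2
  simp only [Function.comp_def, e] at h2
  exact h2

end SmoothAction

end Wong

namespace Wong

/-! ### Integrals and derivatives depending on parameters -/

section Parameters

/-- Push `μ` forward to `Z` and read the integral as a convolution evaluated at `0`, with a kernel
that depends smoothly on `x` and has compact support in `z`. Smoothness of convolutions with
parameters then applies. -/
theorem contDiffOn_integral_of_compact {X Z Ω : Type*} [NormedAddCommGroup X] [NormedSpace ℝ X]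
    [NormedAddCommGroup Z] [NormedSpace ℝ Z] [FiniteDimensional ℝ Z]
    [MeasurableSpace Ω] {μ : Measure Ω} [IsFiniteMeasure μ] {l : Ω → Z}
    (hl : AEStronglyMeasurable l μ) {C : Set Z} (hC : IsCompact C) (hlC : ∀ᵐ o ∂μ, l o ∈ C)
    {f : X × Z → ℝ} {U : Set X} (hU : IsOpen U) (hf : ContDiffOn ℝ ∞ f (U ×ˢ Set.univ)) :
    ContDiffOn ℝ ∞ (fun x => ∫ o, f (x, l o) ∂μ) U := by
  borelize Z
  obtain ⟨R, hR0, hR⟩ := hC.isBounded.exists_pos_norm_le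
  -- `χ` is one on a ball containing `C`, where `l` takes almost all its values, and its support
  -- makes the kernel compactly supported; the integral is unchanged.
  let χ : ContDiffBump (0 : Z) := ⟨R, R + 1, hR0, lt_add_one R⟩
  have hfin : IsFiniteMeasure (μ.map l) := inferInstance
  have hcont : ∀ x ∈ U, Continuous fun z => f (x, z) := fun x hx =>
    hf.continuousOn.comp_continuous (by fun_prop) fun z => ⟨hx, trivial⟩
  have key := contDiffOn_convolution_right_with_param (𝕜 := ℝ) (f := fun _ : Z => (1 : ℝ)) (n := ⊤)
    (μ := μ.map l) (ContinuousLinearMap.mul ℝ ℝ) (g := fun x z => χ z * f (x, -z)) hU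
    (k := Metric.closedBall 0 (R + 1)) (isCompact_closedBall 0 (R + 1))
    (fun x z _ hz => by
      rw [χ.zero_of_le_dist, zero_mul]
      exact (not_le.1 fun h => hz (Metric.mem_closedBall.2 h)).le)
    (locallyIntegrable_const _)
    (by
      refine (χ.contDiff.comp contDiff_snd).contDiffOn.mul
        (hf.comp (contDiff_fst.prodMk contDiff_snd.neg).contDiffOn fun p hp => ⟨hp.1, trivial⟩))
  -- At `0` the convolution integrates the kernel at `-z`, which cancels the reflection put into it.
  have key2 := key.comp (f := fun x : X => (x, (0 : Z))) (s := U)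
    (contDiff_id.prodMk contDiff_const).contDiffOn fun x hx => ⟨hx, trivial⟩
  refine key2.congr fun x hx => ?_
  simp only [Function.comp_apply, convolution_def, ContinuousLinearMap.mul_apply', one_mul, zero_sub,
    neg_neg]
  rw [integral_map hl.aemeasurable]
  · refine integral_congr_ae ?_
    filter_upwards [hlC] with o ho
    rw [χ.one_of_mem_closedBall, one_mul]
    simpa using hR _ ho
  · exact ((χ.continuous.comp continuous_neg).mul (hcont x hx)).aestronglyMeasurable

variable {EQ : Type*} [NormedAddCommGroup EQ] [NormedSpace ℝ EQ]
  {Q : Type*} [TopologicalSpace Q] [ChartedSpace EQ Q] [IsManifold 𝓘(ℝ, EQ) ∞ Q]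

theorem contDiffOn_comp_chart_symm {Z : Type*} [NormedAddCommGroup Z] [NormedSpace ℝ Z]
    {f : Q × Z → ℝ} (hf : ContMDiff (𝓘(ℝ, EQ).prod 𝓘(ℝ, Z)) 𝓘(ℝ, ℝ) ∞ f) (q : Q) :
    ContDiffOn ℝ ∞ (fun p : EQ × Z => f ((chartAt EQ q).symm p.1, p.2))
      ((chartAt EQ q).target ×ˢ Set.univ) := by
  have h1 : ContMDiffOn (𝓘(ℝ, EQ).prod 𝓘(ℝ, Z)) (𝓘(ℝ, EQ).prod 𝓘(ℝ, Z)) ∞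
      (fun p : EQ × Z => ((chartAt EQ q).symm p.1, p.2)) ((chartAt EQ q).target ×ˢ Set.univ) :=
    ((contMDiffOn_chart_symm (I := 𝓘(ℝ, EQ)) (x := q)).comp contMDiff_fst.contMDiffOn
      fun p hp => hp.1).prodMk contMDiff_snd.contMDiffOn
  have h2 := hf.comp_contMDiffOn h1
  rw [← modelWithCornersSelf_prod, chartedSpaceSelf_prod] at h2
  exact h2.contDiffOn

theorem contMDiff_integral_of_compact {Z Ω : Type*}
    [NormedAddCommGroup Z] [NormedSpace ℝ Z] [FiniteDimensional ℝ Z]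
    [MeasurableSpace Ω] {μ : Measure Ω} [IsFiniteMeasure μ] {l : Ω → Z}
    (hl : AEStronglyMeasurable l μ) {C : Set Z} (hC : IsCompact C) (hlC : ∀ᵐ o ∂μ, l o ∈ C)
    {f : Q × Z → ℝ} (hf : ContMDiff (𝓘(ℝ, EQ).prod 𝓘(ℝ, Z)) 𝓘(ℝ, ℝ) ∞ f) :
    ContMDiff 𝓘(ℝ, EQ) 𝓘(ℝ, ℝ) ∞ (fun q => ∫ o, f (q, l o) ∂μ) := by
  intro q
  have h := contDiffOn_integral_of_compact hl hC hlC (chartAt EQ q).open_target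
    (contDiffOn_comp_chart_symm hf q)
  have h2 := (h.contMDiffOn.comp (contMDiffOn_chart (I := 𝓘(ℝ, EQ)) (x := q))
    (chartAt EQ q).mapsTo).contMDiffAt ((chartAt EQ q).open_source.mem_nhds (mem_chart_source EQ q))
  refine h2.congr_of_eventuallyEq ?_
  filter_upwards [(chartAt EQ q).open_source.mem_nhds (mem_chart_source EQ q)] with x hx
  simp [(chartAt EQ q).left_inv hx]

theorem mvfderiv_eq_fderiv_chart {f : Q → ℝ} {q : Q} (hf : MDifferentiableAt 𝓘(ℝ, EQ) 𝓘(ℝ, ℝ) f q)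
    (v : TangentSpace 𝓘(ℝ, EQ) q) :
    mvfderiv 𝓘(ℝ, EQ) f q v
      = fderiv ℝ (fun x => f ((chartAt EQ q).symm x)) (chartAt EQ q q) (v : EQ) := by
  have h := hf.mfderiv
  simp only [mvfderiv, h]
  simp [writtenInExtChartAt, Function.comp_def]
  rfl

/-- Exchanging the derivative in `t` with that in `x` is the symmetry of the second derivative of
`k` on the vectors `(0, 1)` and `(w, 0)`. -/
theorem hasDerivAt_fderiv_parameter {X : Type*} [NormedAddCommGroup X] [NormedSpace ℝ X]
    {k : X × ℝ → ℝ} {x : X} {t : ℝ} (hk : ContDiffAt ℝ ∞ k (x, t)) (w : X) :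
    HasDerivAt (fun t => fderiv ℝ (fun x => k (x, t)) x w)
      (fderiv ℝ (fun x => deriv (fun t => k (x, t)) t) x w) t := by
  have h1 : ∀ᶠ p in 𝓝 (x, t), DifferentiableAt ℝ k p := by
    filter_upwards [(hk.of_le (by exact_mod_cast le_top : (1 : ℕ∞ω) ≤ ∞)).eventually (by simp)]
      with p hp using hp.differentiableAt (by simp)
  have h2 : DifferentiableAt ℝ (fderiv ℝ k) (x, t) :=
    (hk.fderiv_right (m := ∞) (by simp)).differentiableAt (by simp)
  have hpair : ∀ (x : X) (t : ℝ), HasFDerivAt (fun x => (x, t))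
      ((ContinuousLinearMap.id ℝ X).prod (0 : X →L[ℝ] ℝ)) x := fun x t =>
    (hasFDerivAt_id x).prodMk (hasFDerivAt_const t x)
  have e1 : (fun t => fderiv ℝ (fun x => k (x, t)) x w) =ᶠ[𝓝 t]
      fun t => fderiv ℝ k (x, t) (w, 0) := by
    have := (Continuous.prodMk_right x).continuousAt (x := t) h1
    filter_upwards [this] with t' ht'
    have h := HasFDerivAt.comp (g := k) (f := fun x => (x, t')) x ht'.hasFDerivAt (hpair x t')
    rw [show (fun x => k (x, t')) = k ∘ fun x => (x, t') from rfl, h.fderiv]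
    simp
  have e2 : (fun x => deriv (fun t => k (x, t)) t) =ᶠ[𝓝 x]
      fun x => fderiv ℝ k (x, t) (0, 1) := by
    have := (Continuous.prodMk_left t).continuousAt (x := x) h1
    filter_upwards [this] with x' hx'
    exact (hx'.hasFDerivAt.comp_hasDerivAt t
      ((hasDerivAt_const t x').prodMk (hasDerivAt_id t))).deriv
  rw [e2.fderiv_eq]
  refine HasDerivAt.congr_of_eventuallyEq ?_ e1
  have h3 := (h2.hasFDerivAt.comp_hasDerivAt t
    ((hasDerivAt_const t x).prodMk (hasDerivAt_id t))).clm_apply (hasDerivAt_const t (w, (0 : ℝ)))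
  have h4 := ((HasFDerivAt.comp (g := fderiv ℝ k) (f := fun x => (x, t)) x h2.hasFDerivAt
    (hpair x t)).clm_apply
    (hasFDerivAt_const ((0 : X), (1 : ℝ)) x)).fderiv
  have hs := (hk.isSymmSndFDerivAt (by
    rw [minSmoothness_of_isRCLikeNormedField]
    exact WithTop.coe_le_coe.2 (le_top : (2 : ℕ∞) ≤ ⊤))).eq (0, 1) (w, 0)
  refine h3.congr_deriv ?_
  have h4' := congrArg (fun L : X →L[ℝ] ℝ => L w) h4
  simp only [Function.comp_def] at h4'
  refine Eq.trans ?_ h4'.symm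
  simpa using hs

theorem hasDerivAt_mvfderiv_parameter {k : Q × ℝ → ℝ}
    (hk : ContMDiff (𝓘(ℝ, EQ).prod 𝓘(ℝ, ℝ)) 𝓘(ℝ, ℝ) ∞ k) (q : Q) (v : TangentSpace 𝓘(ℝ, EQ) q)
    (t : ℝ) (hd : MDifferentiableAt 𝓘(ℝ, EQ) 𝓘(ℝ, ℝ) (fun x => deriv (fun t => k (x, t)) t) q) :
    HasDerivAt (fun t => mvfderiv 𝓘(ℝ, EQ) (fun x => k (x, t)) q v)
      (mvfderiv 𝓘(ℝ, EQ) (fun x => deriv (fun t => k (x, t)) t) q v) t := by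
  have h1 : ∀ t, MDifferentiableAt 𝓘(ℝ, EQ) 𝓘(ℝ, ℝ) (fun x => k (x, t)) q := fun t =>
    ((hk.comp (contMDiff_id.prodMk contMDiff_const)) q).mdifferentiableAt (by simp)
  simp only [fun t => mvfderiv_eq_fderiv_chart (h1 t) v, mvfderiv_eq_fderiv_chart hd v]
  exact hasDerivAt_fderiv_parameter (k := fun p : EQ × ℝ => k ((chartAt EQ q).symm p.1, p.2))
    ((contDiffOn_comp_chart_symm hk q).contDiffAt
      (((chartAt EQ q).open_target.prod isOpen_univ).mem_nhds
        ⟨mem_chart_target EQ q, trivial⟩)) v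

end Parameters

end Wong

namespace Wong

/-! ### Smoothness of exponentials of co-adjoint operators -/

section SmoothExp

variable {EQ : Type*} [NormedAddCommGroup EQ] [NormedSpace ℝ EQ] [FiniteDimensional ℝ EQ]
  {Q : Type*} [TopologicalSpace Q] [ChartedSpace EQ Q] [IsManifold 𝓘(ℝ, EQ) ∞ Q] [T2Space Q]
  {F : Type*} [NormedAddCommGroup F] [NormedSpace ℝ F] [FiniteDimensional ℝ F]
  {V : Q → Type*} [TopologicalSpace (TotalSpace F V)]
  [∀ q, AddCommGroup (V q)] [∀ q, Module ℝ (V q)] [∀ q, TopologicalSpace (V q)]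
  [∀ q, IsTopologicalAddGroup (V q)] [∀ q, ContinuousSMul ℝ (V q)]
  [FiberBundle F V] [VectorBundle ℝ F V] [ContMDiffVectorBundle ∞ F V 𝓘(ℝ, EQ)]
  (Ψ : LiePoissonStructure EQ F V)
  {W : Type*} [NormedAddCommGroup W] [NormedSpace ℝ W] [FiniteDimensional ℝ W]

/-- The exponential commutes with conjugation, so `coadExp` may be computed in any identification of
the fibre with `F`. A trivialization fixed near `q₀` is the one in which its dependence on `q` can
be seen. -/
theorem equiv_coadExp {q : Q} (e : V q ≃L[ℝ] F) (ξ : DualFib V q) (y : V q) :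
    e (coadExp Ψ q ξ y)
      = NormedSpace.exp ((e : V q →L[ℝ] F) ∘L coad Ψ q ξ ∘L (e.symm : F →L[ℝ] V q)) (e y) := by
  let _ : NormedAlgebra ℚ (F →L[ℝ] F) := NormedAlgebra.restrictScalars ℚ ℝ _
  let P : (F →L[ℝ] F)ˣ := (ContinuousLinearEquiv.unitsEquiv ℝ F).symm ((fibEquiv F V q).symm.trans e)
  have hP : ∀ x, (P : F →L[ℝ] F) x = e ((fibEquiv F V q).symm x) := fun x => rfl
  have hP' : ∀ x, ((P⁻¹ : (F →L[ℝ] F)ˣ) : F →L[ℝ] F) x = fibEquiv F V q (e.symm x) := fun x => rfl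
  have h : (e : V q →L[ℝ] F) ∘L coad Ψ q ξ ∘L (e.symm : F →L[ℝ] V q)
      = (P : F →L[ℝ] F) * coadMat Ψ q ξ * ((P⁻¹ : (F →L[ℝ] F)ˣ) : F →L[ℝ] F) := by
    ext x
    simp [hP, hP', coadMat_apply]
  rw [h, NormedSpace.exp_units_conj]
  simp [hP, hP', coadExp]

theorem contMDiff_linear_parameter (L : W →ₗ[ℝ] (Q → ℝ))
    (hL : ∀ w, ContMDiff 𝓘(ℝ, EQ) 𝓘(ℝ, ℝ) ∞ (L w)) :
    ContMDiff (𝓘(ℝ, EQ).prod 𝓘(ℝ, W)) 𝓘(ℝ, ℝ) ∞ (fun p : Q × W => L p.2 p.1) := by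
  set b := Module.finBasis ℝ W
  have h : (fun p : Q × W => L p.2 p.1)
      = fun p => ∑ i, (b.coord i).toContinuousLinearMap p.2 • L (b i) p.1 := by
    funext p
    conv_lhs => rw [← b.sum_repr p.2, map_sum, Finset.sum_apply]
    simp
  rw [h]
  exact ContMDiff.sum fun i _ => ((b.coord i).toContinuousLinearMap.contMDiff.comp contMDiff_snd).smul
    ((hL (b i)).comp contMDiff_fst)

variable {Ψ}

/-- Near `q₀` the co-adjoint operator of `s w` has a matrix that is smooth in `q` and linear in `w`,
and the exponential is analytic. Treating `w` jointly with `q` allows integration over the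
parameters afterwards. -/
theorem contMDiff_pair_coadExp (s : W →ₗ[ℝ] DualSections EQ F V) (θ : DualSections EQ F V)
    {ζ : ∀ q, V q} (hζ : SmoothSec EQ F ζ) :
    ContMDiff (𝓘(ℝ, EQ).prod 𝓘(ℝ, W)) 𝓘(ℝ, ℝ) ∞
      (fun p : Q × W => θ p.1 (coadExp Ψ p.1 (s p.2 p.1) (ζ p.1))) := by
  rintro ⟨q₀, w₀⟩
  obtain ⟨θ', u, hu, hqu, hub, hθ'⟩ := exists_local_const_dualSections EQ F V q₀
  obtain ⟨σ, u', hu', hqu', hub', hσ⟩ := exists_local_const_sections EQ F V q₀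
  set b := Module.finBasis ℝ F
  let c : ∀ i, F →L[ℝ] ℝ := fun i => (b.coord i).toContinuousLinearMap
  have hsum : ∀ x : F, ∑ i, c i x • b i = x := fun x => b.sum_repr x
  -- Matrix entries of `ad^*`, expressed through the bracket so that their smoothness is that of a
  -- pairing of smooth sections.
  let L : ∀ i j, W →ₗ[ℝ] (Q → ℝ) := fun i j =>
    { toFun := fun w q => Ψ.Psi q (s w q) (θ' (c j) q) (σ (b i) q)
      map_add' := fun w w' => by funext q; simp
      map_smul' := fun r w => by funext q; simp }
  let N : Q × W → F →L[ℝ] F := fun p => ∑ i, ∑ j, L i j p.2 p.1 • (c i).smulRight (b j)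
  have hN : ContMDiff (𝓘(ℝ, EQ).prod 𝓘(ℝ, W)) 𝓘(ℝ, F →L[ℝ] F) ∞ N :=
    ContMDiff.sum fun i _ => ContMDiff.sum fun j _ => ContMDiff.smul
      (contMDiff_linear_parameter (L i j) fun w =>
        SmoothSec.pair (psiSec Ψ (s w) (θ' (c j))).contMDiff (σ (b i)).contMDiff) contMDiff_const
  have hexp : ContDiff ℝ ∞ (NormedSpace.exp : (F →L[ℝ] F) → (F →L[ℝ] F)) :=
    contDiff_iff_contDiffAt.2 fun x => (NormedSpace.exp_analytic (𝕂 := ℝ) x).contDiffAt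
  let z : Q → F := fun q => ∑ k, θ' (c k) q (ζ q) • b k
  have hz : ContMDiff 𝓘(ℝ, EQ) 𝓘(ℝ, F) ∞ z :=
    ContMDiff.sum fun k _ => (SmoothSec.pair (θ' (c k)).contMDiff hζ).smul contMDiff_const
  have key : ContMDiff (𝓘(ℝ, EQ).prod 𝓘(ℝ, W)) 𝓘(ℝ, ℝ) ∞
      (fun p : Q × W => ∑ i, θ p.1 (σ (b i) p.1) * c i (NormedSpace.exp (N p) (z p.1))) :=
    ContMDiff.sum fun i _ =>
      ((SmoothSec.pair θ.contMDiff (σ (b i)).contMDiff).comp contMDiff_fst).mul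
        ((c i).contMDiff.comp ((hexp.contMDiff.comp hN).clm_apply (hz.comp contMDiff_fst)))
  refine (key _).congr_of_eventuallyEq ?_
  have hnhds : (u ∩ u') ×ˢ Set.univ ∈ 𝓝 (q₀, w₀) :=
    ((hu.inter hu').prod isOpen_univ).mem_nhds ⟨⟨hqu, hqu'⟩, trivial⟩
  filter_upwards [hnhds] with p hp
  obtain ⟨q, w⟩ := p
  obtain ⟨⟨hq, hq'⟩, -⟩ := hp
  simp only at hq hq' ⊢
  let e : V q ≃L[ℝ] F := (trivializationAt F V q₀).continuousLinearEquivAt ℝ q (hub hq)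
  have hθe : ∀ k (y : V q), θ' k q y = k (e y) := by
    intro k y
    rw [hθ' q hq]
    simp [e, Trivialization.coe_linearMapAt_of_mem _ (hub hq)]
  have hσe : ∀ x, σ x q = e.symm x := by
    intro x
    rw [hσ q hq']
    simp [e, Trivialization.symmL_apply _ (hub hq)]
  have hze : z q = e (ζ q) := by simp only [z, hθe]; exact hsum _
  have hNe : N (q, w) = (e : V q →L[ℝ] F) ∘L coad Ψ q (s w q) ∘L (e.symm : F →L[ℝ] V q) := by
    ext x
    simp only [N, L, LinearMap.coe_mk, AddHom.coe_mk, ← apply_coad, hθe, hσe, sum_apply,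
      smul_apply, ContinuousLinearMap.smulRight_apply]
    conv_rhs => rw [← hsum x]
    simp only [map_sum, map_smul]
    refine Finset.sum_congr rfl fun i _ => ?_
    conv_rhs => rw [← hsum ((_ : F →L[ℝ] F) (b i))]
    rw [Finset.smul_sum]
    refine Finset.sum_congr rfl fun j _ => ?_
    rw [smul_comm]
    rfl
  rw [hNe, hze, ← equiv_coadExp]
  simp only [hσe]
  conv_lhs => rw [← e.symm_apply_apply (coadExp Ψ q (s w q) (ζ q)), ← hsum (e _)]
  simp [mul_comm]

end SmoothExp

end Wong

namespace Wong

/-! ### The averaged one-form -/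

section AveragedForm

theorem integrable_comp_of_compact {Z Ω : Type*} [TopologicalSpace Z]
    [MeasurableSpace Ω] {μ : Measure Ω} [IsFiniteMeasure μ] {l : Ω → Z}
    (hl : AEStronglyMeasurable l μ) {C : Set Z} (hC : IsCompact C) (hlC : ∀ᵐ o ∂μ, l o ∈ C)
    {k : Z → ℝ} (hk : Continuous k) : Integrable (fun o => k (l o)) μ := by
  obtain ⟨R, hR⟩ := (hC.image hk).isBounded.exists_norm_le
  refine ⟨hk.comp_aestronglyMeasurable hl, .of_bounded (C := R) ?_⟩
  filter_upwards [hlC] with o ho using hR _ ⟨_, ho, rfl⟩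

variable {EQ : Type*} [NormedAddCommGroup EQ] [NormedSpace ℝ EQ] [FiniteDimensional ℝ EQ]
  {Q : Type*} [TopologicalSpace Q] [ChartedSpace EQ Q] [IsManifold 𝓘(ℝ, EQ) ∞ Q] [T2Space Q]
  {F : Type*} [NormedAddCommGroup F] [NormedSpace ℝ F] [FiniteDimensional ℝ F]
  {V : Q → Type*} [TopologicalSpace (TotalSpace F V)]
  [∀ q, AddCommGroup (V q)] [∀ q, Module ℝ (V q)] [∀ q, TopologicalSpace (V q)]
  [∀ q, IsTopologicalAddGroup (V q)] [∀ q, ContinuousSMul ℝ (V q)]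
  [FiberBundle F V] [VectorBundle ℝ F V] [ContMDiffVectorBundle ∞ F V 𝓘(ℝ, EQ)]
  (Ψ : LiePoissonStructure EQ F V) (nabla : CovariantDerivative 𝓘(ℝ, EQ) F V)
  {W : Type*} [NormedAddCommGroup W] [NormedSpace ℝ W]
  (s : W →ₗ[ℝ] DualSections EQ F V)

/-- The covariant derivative of a section which depends linearly on a parameter. -/
def dualCovParam (q : Q) (v : TangentSpace 𝓘(ℝ, EQ) q) : W →ₗ[ℝ] DualFib V q where
  toFun a := dualCov nabla (s a) q v
  map_add' a b := by
    rw [map_add]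
    exact dualCov_add nabla v (s a).mdifferentiableAt (s b).mdifferentiableAt
  map_smul' c a := by
    rw [map_smul]
    have := dualCov_smul nabla v (f := fun _ => c) mdifferentiableAt_const (s a).mdifferentiableAt
    rw [mvfderiv_const] at this
    simp only [zero_apply, zero_smul, add_zero] at this
    exact this

/-- The integrand of the averaging formula, as a function of `a` and `t`. -/
def avgKernel (q : Q) (v : TangentSpace 𝓘(ℝ, EQ) q) (y : V q) (p : W × ℝ) : ℝ :=
  dualCov nabla (s p.1) q v (coadExp Ψ q (p.2 • s p.1 q) y)

theorem avgKernel_eq (q : Q) (v : TangentSpace 𝓘(ℝ, EQ) q) (y : V q) (a : W) (t : ℝ) :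
    adExp Ψ q t (s a q) (dualCov nabla (s a) q v) y = avgKernel Ψ nabla s q v y (a, t) := by
  rw [adExp_eq]
  rfl

variable {nabla} [FiniteDimensional ℝ W]

/-- The factor `∇^* s_a` is linear in `a`, so it is expanded in a basis of the parameter space. What
remains is an exponential with parameter `t a`. -/
theorem contMDiff_avgKernel (hn : nabla.ContMDiffCovariantDerivative ∞) (v : VectorFields EQ Q)
    {ζ : ∀ q, V q} (hζ : SmoothSec EQ F ζ) :
    ContMDiff (𝓘(ℝ, EQ).prod 𝓘(ℝ, W × ℝ)) 𝓘(ℝ, ℝ) ∞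
      (fun p : Q × (W × ℝ) => avgKernel Ψ nabla s p.1 (v p.1) (ζ p.1) p.2) := by
  set b := Module.finBasis ℝ W
  have h : (fun p : Q × (W × ℝ) => avgKernel Ψ nabla s p.1 (v p.1) (ζ p.1) p.2)
      = fun p => ∑ i, (b.coord i).toContinuousLinearMap p.2.1 •
        (dualCovSec hn v (s (b i)) p.1 (coadExp Ψ p.1 (s (p.2.2 • p.2.1) p.1) (ζ p.1))) := by
    funext p
    change dualCovParam nabla s p.1 (v p.1) p.2.1 _ = _
    conv_lhs => rw [← b.sum_repr p.2.1, map_sum]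
    rw [sum_apply]
    refine Finset.sum_congr rfl fun i _ => ?_
    rw [map_smul, smul_apply, b.sum_repr, map_smul]
    rfl
  rw [h]
  have h2 : ContMDiff (𝓘(ℝ, EQ).prod 𝓘(ℝ, W × ℝ)) 𝓘(ℝ, W × ℝ) ∞
    (Prod.snd : Q × (W × ℝ) → W × ℝ) := contMDiff_snd
  have h3 : ContMDiff (𝓘(ℝ, EQ).prod 𝓘(ℝ, W × ℝ)) (𝓘(ℝ, EQ).prod 𝓘(ℝ, W)) ∞
      (fun p : Q × (W × ℝ) => (p.1, p.2.2 • p.2.1)) :=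
    contMDiff_fst.prodMk ((contDiff_snd.smul contDiff_fst).contMDiff.comp h2)
  exact ContMDiff.sum fun i _ =>
    (((b.coord i).toContinuousLinearMap.contDiff.comp contDiff_fst).contMDiff.comp h2).smul
      ((contMDiff_pair_coadExp (Ψ := Ψ) s (dualCovSec hn v (s (b i))) hζ).comp h3)

theorem continuous_avgKernel (hn : nabla.ContMDiffCovariantDerivative ∞) (q : Q)
    (v : TangentSpace 𝓘(ℝ, EQ) q) (y : V q) : Continuous (avgKernel Ψ nabla s q v y) := by
  obtain ⟨v, rfl⟩ := exists_section_eq EQ EQ (V := (TangentSpace 𝓘(ℝ, EQ) : Q → Type _)) v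
  obtain ⟨ζ, rfl⟩ := exists_section_eq EQ F y
  exact (contMDiff_avgKernel Ψ s hn v ζ.contMDiff).continuous.comp (Continuous.prodMk_right q)

variable {Ω : Type*} [MeasurableSpace Ω] {μ : Measure Ω} [IsFiniteMeasure μ] {l : Ω → W}

/-- Both integrals are merged into one over the product measure, whose parameter stays in the
compact set `C × [0, 1]`. Integrability and smoothness follow at once, and Fubini returns the
iterated integral. -/
theorem exists_average (hn : nabla.ContMDiffCovariantDerivative ∞)
    (hl : AEStronglyMeasurable l μ) (hC : ∃ C : Set W, IsCompact C ∧ ∀ᵐ o ∂μ, l o ∈ C) :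
    ∃ A : ∀ q : Q, TangentSpace 𝓘(ℝ, EQ) q →L[ℝ] DualFib V q, IsSmoothOneForm F A ∧
      (∀ q v (y : V q), Integrable
        (fun o => ∫ t in (0 : ℝ)..1, avgKernel Ψ nabla s q v y (l o, t)) μ) ∧
      ∀ q v (y : V q), A q v y
        = -∫ o, (∫ t in (0 : ℝ)..1, avgKernel Ψ nabla s q v y (l o, t)) ∂μ := by
  obtain ⟨C, hC, hlC⟩ := hC
  let ν : Measure ℝ := volume.restrict (Set.Ioc 0 1)
  let l' : Ω × ℝ → W × ℝ := fun p => (l p.1, p.2)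
  have hl' : AEStronglyMeasurable l' (μ.prod ν) :=
    hl.comp_fst.prodMk measurable_snd.aestronglyMeasurable
  have hC' : ∀ᵐ p ∂(μ.prod ν), l' p ∈ C ×ˢ Set.Icc (0 : ℝ) 1 := by
    have h1 : ∀ᵐ p ∂(μ.prod ν), l p.1 ∈ C := Measure.quasiMeasurePreserving_fst.ae hlC
    have h2 : ∀ᵐ t ∂ν, t ∈ Set.Icc (0 : ℝ) 1 := by
      filter_upwards [ae_restrict_mem measurableSet_Ioc] with t ht using Set.Ioc_subset_Icc_self ht
    have h2' : ∀ᵐ p ∂(μ.prod ν), p.2 ∈ Set.Icc (0 : ℝ) 1 :=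
      Measure.quasiMeasurePreserving_snd.ae h2
    filter_upwards [h1, h2'] with p h h' using ⟨h, h'⟩
  have hCc := hC.prod (isCompact_Icc (a := (0 : ℝ)) (b := 1))
  have hint : ∀ q v (y : V q), Integrable (fun p => avgKernel Ψ nabla s q v y (l' p)) (μ.prod ν) :=
    fun q v y => integrable_comp_of_compact hl' hCc hC' (continuous_avgKernel Ψ s hn q v y)
  have hfub : ∀ q v (y : V q), ∫ p, avgKernel Ψ nabla s q v y (l' p) ∂(μ.prod ν)
      = ∫ o, (∫ t in (0 : ℝ)..1, avgKernel Ψ nabla s q v y (l o, t)) ∂μ := by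
    intro q v y
    rw [integral_prod _ (hint q v y)]
    simp only [intervalIntegral.integral_of_le zero_le_one]
    rfl
  -- The kernel is linear in `y` and in `v`, hence so is its integral; this makes `A` a one-form.
  have ladd : ∀ q v (y y' : V q) p, avgKernel Ψ nabla s q v (y + y') p
      = avgKernel Ψ nabla s q v y p + avgKernel Ψ nabla s q v y' p := fun q v y y' p => by
    simp [avgKernel]
  have lsmul : ∀ q v c (y : V q) p, avgKernel Ψ nabla s q v (c • y) p
      = c * avgKernel Ψ nabla s q v y p := fun q v c y p => by
    simp [avgKernel]
  have ladd' : ∀ q v v' (y : V q) p, avgKernel Ψ nabla s q (v + v') y p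
      = avgKernel Ψ nabla s q v y p + avgKernel Ψ nabla s q v' y p := fun q v v' y p => by
    simp [avgKernel, dualCov_add_right]
  have lsmul' : ∀ q c v (y : V q) p, avgKernel Ψ nabla s q (c • v) y p
      = c * avgKernel Ψ nabla s q v y p := fun q c v y p => by
    simp [avgKernel, dualCov_smul_right]
  have hT : ∀ q, T2Space (V q) := FiberBundle.t2Space F V
  have hFD : ∀ q, FiniteDimensional ℝ (V q) := fun q =>
    VectorBundle.finiteDimensional ℝ F V q
  have hT' : ∀ q, T2Space (TangentSpace 𝓘(ℝ, EQ) (q : Q)) := fun _ => inferInstanceAs (T2Space EQ)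
  have hFD' : ∀ q, FiniteDimensional ℝ (TangentSpace 𝓘(ℝ, EQ) (q : Q)) := fun _ =>
    inferInstanceAs (FiniteDimensional ℝ EQ)
  let A : ∀ q : Q, TangentSpace 𝓘(ℝ, EQ) q →L[ℝ] DualFib V q := fun q =>
    LinearMap.toContinuousLinearMap
      { toFun := fun v => LinearMap.toContinuousLinearMap
          { toFun := fun y => -∫ p, avgKernel Ψ nabla s q v y (l' p) ∂(μ.prod ν)
            map_add' := fun y y' => by
              simp only [ladd, integral_add (hint q v y) (hint q v y')]
              ring
            map_smul' := fun c y => by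
              simp only [lsmul, integral_const_mul, RingHom.id_apply, smul_eq_mul]
              ring }
        map_add' := fun v v' => by
          ext y
          simp only [LinearMap.coe_toContinuousLinearMap', LinearMap.coe_mk, AddHom.coe_mk,
            add_apply, ladd', integral_add (hint q v y) (hint q v' y)]
          ring
        map_smul' := fun c v => by
          ext y
          simp only [LinearMap.coe_toContinuousLinearMap', LinearMap.coe_mk, AddHom.coe_mk,
            smul_apply, lsmul', integral_const_mul, RingHom.id_apply, smul_eq_mul]
          ring }
  have hA : ∀ q v (y : V q), A q v y = -∫ p, avgKernel Ψ nabla s q v y (l' p) ∂(μ.prod ν) :=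
    fun q v y => rfl
  refine ⟨A, ?_, fun q v y => ?_, fun q v y => by rw [hA, hfub]⟩
  · refine smoothSec_hom (V₂ := DualFib V) fun v => smoothSec_hom_trivial fun ζ => ?_
    simp only [hA]
    exact (contMDiff_integral_of_compact hl' hCc hC' (contMDiff_avgKernel Ψ s hn v ζ.contMDiff)).neg
  · have := (hint q v y).integral_prod_left
    simp only [intervalIntegral.integral_of_le zero_le_one]
    exact this

end AveragedForm

end Wong

namespace Wong

/-! ### Conjugation of a connection by exponentials -/

section Conjugation

variable {EQ : Type*} [NormedAddCommGroup EQ] [NormedSpace ℝ EQ] [FiniteDimensional ℝ EQ]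
  {Q : Type*} [TopologicalSpace Q] [ChartedSpace EQ Q] [IsManifold 𝓘(ℝ, EQ) ∞ Q] [T2Space Q]
  {F : Type*} [NormedAddCommGroup F] [NormedSpace ℝ F] [FiniteDimensional ℝ F]
  {V : Q → Type*} [TopologicalSpace (TotalSpace F V)]
  [∀ q, AddCommGroup (V q)] [∀ q, Module ℝ (V q)] [∀ q, TopologicalSpace (V q)]
  [∀ q, IsTopologicalAddGroup (V q)] [∀ q, ContinuousSMul ℝ (V q)]
  [FiberBundle F V] [VectorBundle ℝ F V] [ContMDiffVectorBundle ∞ F V 𝓘(ℝ, EQ)]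
  {Ψ : LiePoissonStructure EQ F V} {nabla : CovariantDerivative 𝓘(ℝ, EQ) F V}
  {B : ∀ q : Q, TangentSpace 𝓘(ℝ, EQ) q →L[ℝ] TangentSpace 𝓘(ℝ, EQ) q →L[ℝ] DualFib V q}

theorem hasDerivAt_coadExp (q : Q) (ξ η : DualFib V q) (y : V q) (t : ℝ) :
    HasDerivAt (fun t : ℝ => η (coadExp Ψ q (t • ξ) y))
      (η (coad Ψ q ξ (coadExp Ψ q (t • ξ) y))) t := by
  have h := ((η ∘L ((fibEquiv F V q).symm : F →L[ℝ] V q)).hasFDerivAt).comp_hasDerivAt t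
    ((hasDerivAt_exp_coadMat Ψ q ξ t).clm_apply (hasDerivAt_const t (fibEquiv F V q y)))
  refine h.congr_deriv ?_
  simp [coadMat, coadExp]

/-- The exponential is an automorphism of the bracket, so conjugating `ad^*_η` by it gives `ad^*` of
the transported covector. -/
theorem coad_comp_coadExp (q : Q) (ξ η : DualFib V q) (y : V q) :
    coadExp Ψ q (-ξ) (coad Ψ q η (coadExp Ψ q ξ y)) = coad Ψ q (η ∘L coadExp Ψ q ξ) y := by
  refine dual_ext F fun θ => ?_
  have h : θ = (θ ∘L coadExp Ψ q (-ξ)) ∘L coadExp Ψ q ξ := by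
    ext z
    have := coadExp_neg_apply Ψ q ξ 1 z
    simp only [one_smul, neg_smul] at this
    simp [this]
  have h2 := congrArg (fun α => α y) (coadExp_bracket Ψ q ξ η (θ ∘L coadExp Ψ q (-ξ)))
  rw [← h] at h2
  rw [apply_coad, h2]
  exact apply_coad Ψ q η (θ ∘L coadExp Ψ q (-ξ)) (coadExp Ψ q ξ y)

variable (Ψ) in
/-- The section `exp(t ad_σ^*) ζ`. -/
def expSec (σ : DualSections EQ F V) (ζ : Cₛ^∞⟮𝓘(ℝ, EQ); F, V⟯) (t : ℝ) :
    Cₛ^∞⟮𝓘(ℝ, EQ); F, V⟯ :=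
  ⟨fun x => coadExp Ψ x (t • σ x) (ζ x), smoothSec_of_pairing fun θ =>
    -- The parameter space here is the line of multiples of `σ`.
    (contMDiff_pair_coadExp (Ψ := Ψ) (LinearMap.toSpanSingleton ℝ _ σ) θ ζ.contMDiff).comp
      (contMDiff_id.prodMk (contMDiff_const (c := t)))⟩

/-- `∇` commutes with the derivative in `t`. Pairing with `θ` replaces `∇` of the section by the
derivative of a function and a term of order zero, and derivatives of functions may be interchanged.
-/
theorem hasDerivAt_nabla_expSec (σ : DualSections EQ F V) (ζ : Cₛ^∞⟮𝓘(ℝ, EQ); F, V⟯) (q : Q) (v : TangentSpace 𝓘(ℝ, EQ) q)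
    (θ : DualFib V q) (t : ℝ) :
    HasDerivAt (fun t => θ (nabla (expSec Ψ σ ζ t) q v))
      (θ (nabla (coadSec Ψ σ (expSec Ψ σ ζ t)) q v)) t := by
  obtain ⟨θ, rfl⟩ := exists_section_eq EQ (F →L[ℝ] ℝ) (V := DualFib V) θ
  have h : ∀ ζ' : Cₛ^∞⟮𝓘(ℝ, EQ); F, V⟯, θ q (nabla ζ' q v)
      = mvfderiv 𝓘(ℝ, EQ) (fun x => θ x (ζ' x)) q v - dualCov nabla θ q v (ζ' q) := by
    intro ζ'
    rw [dualCov_section nabla v θ.mdifferentiableAt ζ']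
    ring
  simp only [h]
  have hk := contMDiff_pair_coadExp (Ψ := Ψ) (LinearMap.toSpanSingleton ℝ _ σ) θ ζ.contMDiff
  have hd : (fun x => deriv (fun t : ℝ => θ x (coadExp Ψ x (t • σ x) (ζ x))) t)
      = fun x => θ x (coadSec Ψ σ (expSec Ψ σ ζ t) x) :=
    funext fun x => (hasDerivAt_coadExp x (σ x) (θ x) (ζ x) t).deriv
  have hmd : MDifferentiableAt 𝓘(ℝ, EQ) 𝓘(ℝ, ℝ)
      (fun x => deriv (fun t : ℝ => θ x (coadExp Ψ x (t • σ x) (ζ x))) t) q := by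
    rw [hd]
    exact mdiff_pair θ.mdifferentiableAt (coadSec Ψ σ (expSec Ψ σ ζ t)).mdifferentiableAt
  have h1 := hasDerivAt_mvfderiv_parameter hk q v t hmd
  have h2 := hasDerivAt_coadExp (Ψ := Ψ) q (σ q) (dualCov nabla θ q v) (ζ q) t
  have h3 := h1.sub h2
  refine h3.congr_deriv ?_
  congr 1
  exact congrArg (fun f => mvfderiv 𝓘(ℝ, EQ) f q v) hd

/-- The product rule produces the commutator of `∇` with `ad^*_σ`, which is `ad^*` of `∇^* σ` by
condition (i). Conjugation by the exponentials transports this covector, and skewness then moves `θ`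
inside `ad^*`, giving the integrand of the averaging formula at `ad^*_θ ζ`. -/
theorem IsCompatiblePair.hasDerivAt_conj (h : IsCompatiblePair Ψ nabla B)
    (σ : DualSections EQ F V) (ζ : Cₛ^∞⟮𝓘(ℝ, EQ); F, V⟯) (q : Q) (v : TangentSpace 𝓘(ℝ, EQ) q)
    (θ : DualFib V q) (t : ℝ) :
    HasDerivAt (fun t => θ (coadExp Ψ q ((-t) • σ q) (nabla (expSec Ψ σ ζ t) q v)))
      (-(dualCov nabla σ q v (coadExp Ψ q (t • σ q) (coad Ψ q θ (ζ q))))) t := by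
  set b := Module.finBasis ℝ F
  set e := fibEquiv F V q
  let z : ℝ → F := fun t => e (nabla (expSec Ψ σ ζ t) q v)
  let z' : F := e (nabla (coadSec Ψ σ (expSec Ψ σ ζ t)) q v)
  -- Derivatives are known only after pairing with covectors, so the vector-valued one is assembled
  -- from coordinates.
  have hz : HasDerivAt z z' t := by
    have h1 : ∀ i, HasDerivAt (fun t => b.coord i (z t)) (b.coord i z') t := fun i =>
      hasDerivAt_nabla_expSec σ ζ q v
        ((b.coord i).toContinuousLinearMap ∘L (e : V q →L[ℝ] F)) t
    have h2 := HasDerivAt.fun_sum (u := Finset.univ) fun i _ => (h1 i).smul_const (b i)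
    simp only [Module.Basis.coord_apply, b.sum_repr] at h2
    exact h2
  have h1 := (((θ ∘L (e.symm : F →L[ℝ] V q))).hasFDerivAt).comp_hasDerivAt t
    ((hasDerivAt_exp_coadMat_neg Ψ q (σ q) t).clm_apply hz)
  refine h1.congr_deriv ?_
  have hp : z' - coadMat Ψ q (σ q) (z t)
      = e (coad Ψ q (dualCov nabla σ q v) (coadExp Ψ q (t • σ q) (ζ q))) := by
    obtain ⟨v, rfl⟩ := exists_section_eq EQ EQ (V := (TangentSpace 𝓘(ℝ, EQ) : Q → Type _)) v
    have := h.preserves v σ (expSec Ψ σ ζ t) q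
    have h' : coad Ψ q (dualCov nabla σ q (v q)) (coadExp Ψ q (t • σ q) (ζ q)) = _ := this.symm
    rw [h', map_sub]
    congr 1
    exact coadMat_apply Ψ q _ _
  have h2 : -(coadMat Ψ q (σ q) * NormedSpace.exp (coadMat Ψ q ((-t) • σ q))) (z t)
      + NormedSpace.exp (coadMat Ψ q ((-t) • σ q)) z'
      = e (coadExp Ψ q (-(t • σ q)) (coad Ψ q (dualCov nabla σ q v)
        (coadExp Ψ q (t • σ q) (ζ q)))) := by
    rw [fibEquiv_coadExp, ← hp, coadMat_commute_exp, map_sub, neg_smul]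
    exact (neg_add_eq_sub _ _)
  rw [neg_apply, h2, coad_comp_coadExp]
  have h3 : (θ ∘L (e.symm : F →L[ℝ] V q)) (e (coad Ψ q (dualCov nabla σ q v ∘L
      coadExp Ψ q (t • σ q)) (ζ q))) = Ψ.Psi q (dualCov nabla σ q v ∘L
      coadExp Ψ q (t • σ q)) θ (ζ q) := by
    rw [← apply_coad]
    simp
  rw [h3, Psi_swap, neg_apply, ← apply_coad]
  rfl

/-- The fundamental theorem of calculus over `[0, 1]` compares the transformed connection with the
original one. -/
theorem IsCompatiblePair.conj_eq (h : IsCompatiblePair Ψ nabla B)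
    (σ : DualSections EQ F V) (ζ : Cₛ^∞⟮𝓘(ℝ, EQ); F, V⟯) (q : Q) (v : TangentSpace 𝓘(ℝ, EQ) q)
    (θ : DualFib V q) :
    θ (coadExp Ψ q (-σ q) (nabla (expSec Ψ σ ζ 1) q v)) = θ (nabla ζ q v)
      - ∫ t in (0 : ℝ)..1, dualCov nabla σ q v (coadExp Ψ q (t • σ q) (coad Ψ q θ (ζ q))) := by
  have hc : Continuous fun t : ℝ =>
      dualCov nabla σ q v (coadExp Ψ q (t • σ q) (coad Ψ q θ (ζ q))) :=
    continuous_iff_continuousAt.2 fun t => (hasDerivAt_coadExp q (σ q) _ _ t).continuousAt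
  have hI := intervalIntegral.integral_eq_sub_of_hasDerivAt
    (fun t _ => h.hasDerivAt_conj σ ζ q v θ t) (hc.neg.intervalIntegrable 0 1)
  have h0 : expSec Ψ σ ζ 0 = ζ := by
    ext x : 1
    change coadExp Ψ x ((0 : ℝ) • σ x) (ζ x) = ζ x
    rw [zero_smul, coadExp_zero]
  rw [intervalIntegral.integral_neg] at hI
  simp only [neg_smul, one_smul, neg_zero, zero_smul, coadExp_zero, h0] at hI
  linarith

end Conjugation

end Wong

namespace Wong

/-! ### Invariance of the averaged pair -/

section Invariance

variable {EQ : Type*} [NormedAddCommGroup EQ] [NormedSpace ℝ EQ] [FiniteDimensional ℝ EQ]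
  {Q : Type*} [TopologicalSpace Q] [ChartedSpace EQ Q] [IsManifold 𝓘(ℝ, EQ) ∞ Q] [T2Space Q]
  {F : Type*} [NormedAddCommGroup F] [NormedSpace ℝ F] [FiniteDimensional ℝ F]
  {V : Q → Type*} [TopologicalSpace (TotalSpace F V)]
  [∀ q, AddCommGroup (V q)] [∀ q, Module ℝ (V q)] [∀ q, TopologicalSpace (V q)]
  [∀ q, IsTopologicalAddGroup (V q)] [∀ q, ContinuousSMul ℝ (V q)]
  [FiberBundle F V] [VectorBundle ℝ F V] [ContMDiffVectorBundle ∞ F V 𝓘(ℝ, EQ)]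
  {EG : Type*} [NormedAddCommGroup EG] [NormedSpace ℝ EG]
  {G : Type*} [Group G] [TopologicalSpace G] [ChartedSpace EG G] [LieGroup 𝓘(ℝ, EG) ∞ G]
  [CompactSpace G] [MulAction G (TotalSpace F V)]
  [ContMDiffSMul 𝓘(ℝ, EG) (𝓘(ℝ, EQ).prod 𝓘(ℝ, F)) ∞ G (TotalSpace F V)]
  {Ψ : LiePoissonStructure EQ F V}
  {s : GroupLieAlgebra 𝓘(ℝ, EG) G →ₗ[ℝ] DualSections EQ F V}
  {nabla : CovariantDerivative 𝓘(ℝ, EQ) F V}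
  {B : ∀ q : Q, TangentSpace 𝓘(ℝ, EQ) q →L[ℝ] TangentSpace 𝓘(ℝ, EQ) q →L[ℝ] DualFib V q}
  {Φ : G → ∀ q, V q →L[ℝ] V q}

theorem ActsBy.eq_expSec (hΦ : ActsBy (F := F) Φ) (hs : HasCoadGenerators Ψ s)
    {a : GroupLieAlgebra 𝓘(ℝ, EG) G} {g : G} (h : IsExp a g) (ζ : Cₛ^∞⟮𝓘(ℝ, EQ); F, V⟯) :
    (fun x => Φ g x (ζ x)) = expSec Ψ (s a) ζ 1 := by
  funext x
  rw [hΦ.eq_coadExp hs h]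
  change _ = coadExp Ψ x ((1 : ℝ) • s a x) (ζ x)
  rw [one_smul]

theorem ActsBy.inv_eq_coadExp (hΦ : ActsBy (F := F) Φ) (hs : HasCoadGenerators Ψ s)
    {a : GroupLieAlgebra 𝓘(ℝ, EG) G} {g : G} (h : IsExp a g) (q : Q) (y : V q) :
    Φ g⁻¹ q y = coadExp Ψ q (-s a q) y := by
  have h1 : Φ g q (coadExp Ψ q (-s a q) y) = y := by
    rw [hΦ.eq_coadExp hs h]
    have := coadExp_neg_apply Ψ q (s a q) (-1) y
    rwa [neg_neg, one_smul, neg_one_smul] at this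
  conv_lhs => rw [← h1, hΦ.inv_apply]

/-- Invariance of the connection under a one-parameter subgroup makes the derivative of its
generator central. -/
theorem IsCompatiblePair.central_of_invariant (h : IsCompatiblePair Ψ nabla B)
    (hs : HasCoadGenerators Ψ s) (hΦ : ActsBy (F := F) Φ)
    (hinv : ∀ (g : G) (ζ : Cₛ^∞⟮𝓘(ℝ, EQ); F, V⟯) (q : Q) (v : TangentSpace 𝓘(ℝ, EQ) q),
      nabla (fun x => Φ g x (ζ x)) q v = Φ g q (nabla ζ q v))
    {a : GroupLieAlgebra 𝓘(ℝ, EG) G} {g : G} (hg : IsExp a g) (θ : DualSections EQ F V)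
    (v : VectorFields EQ Q) :
    psiSec Ψ θ (dualCovSec h.smooth_connection v (s a)) = 0 := by
  ext q y
  obtain ⟨ζ, rfl⟩ := exists_section_eq EQ F y
  obtain ⟨γ, -, -, hγ⟩ := hg.exists_oneParameter
  have hd := h.hasDerivAt_conj (s a) ζ q (v q) (θ q) 0
  -- Invariance cancels the two exponentials, so the conjugated derivative does not depend on `t`;
  -- its derivative at `t = 0` is the bracket in question up to sign.
  have hc : (fun t : ℝ => θ q (coadExp Ψ q ((-t) • s a q) (nabla (expSec Ψ (s a) ζ t) q (v q))))
      = fun _ => θ q (nabla ζ q (v q)) := by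
    funext t
    have e : expSec Ψ (s a) ζ t = expSec Ψ (s (t • a)) ζ 1 := by
      ext x : 1
      change coadExp Ψ x (t • s a x) (ζ x) = coadExp Ψ x ((1 : ℝ) • s (t • a) x) (ζ x)
      rw [one_smul, map_smul]
      rfl
    have := hinv (γ t) ζ q (v q)
    rw [hΦ.eq_expSec hs (hγ t), ← e, hΦ.eq_coadExp hs (hγ t), map_smul] at this
    rw [this]
    exact congrArg (θ q) (coadExp_neg_apply Ψ q (s a q) t _)
  rw [hc] at hd
  have := hd.unique (hasDerivAt_const _ _)
  rw [zero_smul, coadExp_zero, neg_eq_zero, apply_coad] at this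
  exact this

/-- Since `∇^*` is a derivation, it preserves the centre. All derivatives of `σ` are central, hence
so are its second derivatives, and the curvature equation writes `[F(v, w), σ]` through these. -/
theorem IsCompatiblePair.form_bracket_central (h : IsCompatiblePair Ψ nabla B)
    (σ : DualSections EQ F V)
    (hσ : ∀ (θ : DualSections EQ F V) (v : VectorFields EQ Q),
      psiSec Ψ θ (dualCovSec h.smooth_connection v σ) = 0)
    (θ : DualSections EQ F V) (v w : VectorFields EQ Q) :
    psiSec Ψ θ (psiSec Ψ (formSec h.smooth_form v w) σ) = 0 := by
  have key : ∀ v w : VectorFields EQ Q, psiSec Ψ θ (dualCovSec h.smooth_connection v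
      (dualCovSec h.smooth_connection w σ)) = 0 := by
    intro v w
    have h1 := h.dual_preserves v θ (dualCovSec h.smooth_connection w σ)
    rw [hσ, hσ, zero_add] at h1
    rw [← h1]
    exact (dualCovHom h.smooth_connection v).map_zero
  rw [← h.dual_curvature]
  have h1 := key v w
  have h2 := key w v
  have h3 := hσ θ (lieVF v w)
  change psiHom Ψ θ _ = 0 at h1 h2 h3
  change psiHom Ψ θ _ = 0
  rw [map_sub, map_sub, h1, h2, h3, sub_zero, sub_zero]

/-- All terms of the exponential series from the second order on vanish, which leaves an affine
function of `t`. -/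
theorem apply_coadExp_of_central (q : Q) (ξ η : DualFib V q) (h : Ψ.Psi q ξ (Ψ.Psi q ξ η) = 0)
    (t : ℝ) (y : V q) : η (coadExp Ψ q (t • ξ) y) = η y + t * Ψ.Psi q ξ η y := by
  have h0 : ∀ n, (fun θ => Ψ.Psi q ξ θ)^[n + 2] η = 0 := by
    intro n
    rw [Function.iterate_add_apply]
    simp only [Function.iterate_succ_apply, Function.iterate_zero_apply, h]
    induction n with
    | zero => rfl
    | succ n ih => rw [Function.iterate_succ_apply', ih, map_zero]
  have h1 := (hasSum_adExp Ψ q ξ η t).tsum_eq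
  rw [tsum_eq_sum (s := Finset.range 2)] at h1
  · have h2 := congrArg (fun α => α y) h1
    simp [Finset.sum_range_succ] at h2
    exact h2.symm
  · intro n hn
    obtain ⟨m, rfl⟩ : ∃ m, n = m + 2 := ⟨n - 2, by simp at hn; omega⟩
    rw [h0, smul_zero]

/-- Along the one-parameter subgroup the form, evaluated at the moving point, is affine in `t`. It
takes values in a continuous image of the compact group, so its slope is zero. -/
theorem IsCompatiblePair.form_invariant_of_isExp (h : IsCompatiblePair Ψ nabla B)
    (hs : HasCoadGenerators Ψ s) (hΦ : ActsBy (F := F) Φ)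
    (hinv : ∀ (g : G) (ζ : Cₛ^∞⟮𝓘(ℝ, EQ); F, V⟯) (q : Q) (v : TangentSpace 𝓘(ℝ, EQ) q),
      nabla (fun x => Φ g x (ζ x)) q v = Φ g q (nabla ζ q v))
    {a : GroupLieAlgebra 𝓘(ℝ, EG) G} {g : G} (hg : IsExp a g) (q : Q)
    (v w : TangentSpace 𝓘(ℝ, EQ) q) (y : V q) : B q v w (Φ g q y) = B q v w y := by
  obtain ⟨v, rfl⟩ := exists_section_eq EQ EQ (V := (TangentSpace 𝓘(ℝ, EQ) : Q → Type _)) v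
  obtain ⟨w, rfl⟩ := exists_section_eq EQ EQ (V := (TangentSpace 𝓘(ℝ, EQ) : Q → Type _)) w
  have hc := h.form_bracket_central (s a)
    (fun θ v => h.central_of_invariant hs hΦ hinv hg θ v) (s a) v w
  have hc' : Ψ.Psi q (s a q) (Ψ.Psi q (s a q) (B q (v q) (w q))) = 0 := by
    rw [Psi_swap Ψ q (s a q) (B q (v q) (w q)), map_neg, neg_eq_zero]
    exact congrArg (fun η : DualSections EQ F V => η q) hc
  obtain ⟨γ, -, -, hγ⟩ := hg.exists_oneParameter
  have hlin : ∀ t : ℝ, B q (v q) (w q) (Φ (γ t) q y)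
      = B q (v q) (w q) y + t * Ψ.Psi q (s a q) (B q (v q) (w q)) y := by
    intro t
    rw [hΦ.eq_coadExp hs (hγ t), map_smul]
    exact apply_coadExp_of_central q _ _ hc' t y
  obtain ⟨R, hR⟩ := (isCompact_range (ActsBy.continuous_pair (EG := EG) (EQ := EQ) inferInstance hΦ q y
    (B q (v q) (w q)))).isBounded.exists_norm_le
  have h0 : Ψ.Psi q (s a q) (B q (v q) (w q)) y = 0 := by
    by_contra hne
    set c := Ψ.Psi q (s a q) (B q (v q) (w q)) y
    set d := B q (v q) (w q) y
    -- At this time the affine function equals `d + (R + |d| + 1)`, which exceeds the bound `R`.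
    have h1 := hR _ ⟨γ ((R + |d| + 1) / c), rfl⟩
    simp only [hlin, div_mul_cancel₀ _ hne, Real.norm_eq_abs] at h1
    have h2 := le_abs_self (d + (R + |d| + 1))
    have h3 := neg_abs_le d
    linarith
  rw [hΦ.eq_coadExp hs hg]
  have := apply_coadExp_of_central q _ _ hc' 1 y
  rw [one_smul, h0, mul_zero, add_zero] at this
  exact this

variable [MeasurableSpace G] [BorelSpace G] {μ : Measure G} [μ.IsHaarMeasure]
  [IsProbabilityMeasure μ] {log : G → GroupLieAlgebra 𝓘(ℝ, EG) G}
  {A : ∀ q : Q, TangentSpace 𝓘(ℝ, EQ) q →L[ℝ] DualFib V q}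

/-- The averaged connection is the average of the transformed connections. -/
theorem IsAveragedForm.nabla_eq (h : IsCompatiblePair Ψ nabla B)
    (hs : HasCoadGenerators Ψ s) (hΦ : ActsBy (F := F) Φ) (hlog : IsLogChoice μ log)
    (hA : IsAveragedForm Ψ nabla s μ log A) (ζ : Cₛ^∞⟮𝓘(ℝ, EQ); F, V⟯) (q : Q)
    (v : TangentSpace 𝓘(ℝ, EQ) q) (θ : DualFib V q) :
    θ (nabla.addOneForm (negCoadForm Ψ A) ζ q v)
      = ∫ g, θ (Φ g⁻¹ q (nabla (fun x => Φ g x (ζ x)) q v)) ∂μ := by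
  have h1 : (fun g => θ (Φ g⁻¹ q (nabla (fun x => Φ g x (ζ x)) q v))) =ᵐ[μ]
      fun g => θ (nabla ζ q v) - ∫ t in (0 : ℝ)..1,
        adExp Ψ q t (s (log g) q) (dualCov nabla (s (log g)) q v) (coad Ψ q θ (ζ q)) := by
    filter_upwards [hlog.exp_log] with g hg
    rw [hΦ.eq_expSec hs hg, hΦ.inv_eq_coadExp hs hg, h.conj_eq]
    simp only [adExp_eq]
    rfl
  rw [integral_congr_ae h1, integral_sub (integrable_const _) (hA.integrable q v _),
    integral_const, probReal_univ, one_smul]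
  change θ (nabla ζ q v + negCoadForm Ψ A q (ζ q) v) = _
  -- Skewness turns `-θ(ad^*_A ζ)` into `A` evaluated at `ad^*_θ ζ`, where the averaging formula
  -- applies.
  rw [negCoadForm_apply, map_add, map_neg, apply_coad, Psi_swap, neg_apply, ← apply_coad,
    hA.formula]
  ring

/-- Applying `Φ g` to the section shifts the integration variable in the average by `g` on the
right, which Haar measure does not notice. -/
theorem IsAveragedForm.connection_invariant (h : IsCompatiblePair Ψ nabla B)
    (hs : HasCoadGenerators Ψ s) (hΦ : ActsBy (F := F) Φ) (hlog : IsLogChoice μ log)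
    (hA : IsAveragedForm Ψ nabla s μ log A) (g : G) (ζ : Cₛ^∞⟮𝓘(ℝ, EQ); F, V⟯) (q : Q)
    (v : TangentSpace 𝓘(ℝ, EQ) q) :
    nabla.addOneForm (negCoadForm Ψ A) (fun x => Φ g x (ζ x)) q v
      = Φ g q (nabla.addOneForm (negCoadForm Ψ A) ζ q v) := by
  have := topologicalGroup_of_lieGroup 𝓘(ℝ, EG) ∞ (G := G)
  have := isMulRightInvariant_of_compactSpace μ
  refine dual_ext F fun θ => ?_
  have h1 := hA.nabla_eq h hs hΦ hlog
    (⟨fun x => Φ g x (ζ x), ActsBy.smoothSec (EG := EG) inferInstance hΦ g ζ.contMDiff⟩ :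
      Cₛ^∞⟮𝓘(ℝ, EQ); F, V⟯) q v θ
  have h2 := hA.nabla_eq h hs hΦ hlog ζ q v (θ ∘L Φ g q)
  rw [← integral_mul_right_eq_self _ g] at h2
  refine h1.trans (Eq.trans ?_ h2.symm)
  congr 1
  funext g'
  simp only [ContinuousLinearMap.coe_comp, Function.comp_apply, ← hΦ.mul]
  congr 2
  · simp
  · congr 2
    funext x
    exact (hΦ.mul g' g x (ζ x)).symm

theorem IsAveragedForm.isInvariantPair (h : IsCompatiblePair Ψ nabla B)
    (hs : HasCoadGenerators Ψ s) (hΦ : ActsBy (F := F) Φ) (hlog : IsLogChoice μ log)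
    (hA : IsAveragedForm Ψ nabla s μ log A)
    {B' : ∀ q : Q, TangentSpace 𝓘(ℝ, EQ) q →L[ℝ] TangentSpace 𝓘(ℝ, EQ) q →L[ℝ] DualFib V q}
    (h' : IsCompatiblePair Ψ (nabla.addOneForm (negCoadForm Ψ A)) B') :
    IsInvariantPair Φ (nabla.addOneForm (negCoadForm Ψ A)) B' where
  connection := hA.connection_invariant h hs hΦ hlog
  form g q v w y := by
    have := topologicalGroup_of_lieGroup 𝓘(ℝ, EG) ∞ (G := G)
    have hinv := hA.connection_invariant h hs hΦ hlog
    -- Invariance of the form is known for exponentials only; a general element is a product of two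
    -- of them.
    obtain ⟨g₁, g₂, h₁, h₂, rfl⟩ := exists_mul_of_ae μ hlog.exp_log g
    rw [hΦ.mul, h'.form_invariant_of_isExp hs hΦ hinv h₁, h'.form_invariant_of_isExp hs hΦ hinv h₂]

end Invariance

end Wong

namespace Wong

/-! ### The Lie algebra of generating functions -/

section GeneratorAlgebra

variable {R X S K : Type*} [CommRing R] [AddCommGroup X] [Module R X] [AddCommGroup S] [Module R S]
  [AddCommGroup K] [Module R K]

/-- The bracket on triples (function, vector field, section). -/
def tripleBracket (d : X →ₗ[R] K →ₗ[R] K) (lie : X →ₗ[R] X →ₗ[R] X) (D : X →ₗ[R] S →ₗ[R] S)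
    (B : X →ₗ[R] X →ₗ[R] S) (br : S →ₗ[R] S →ₗ[R] S) :
    (K × X × S) →ₗ[R] (K × X × S) →ₗ[R] (K × X × S) :=
  LinearMap.mk₂ R (fun ξ ξ' => (d ξ.2.1 ξ'.1 - d ξ'.2.1 ξ.1, lie ξ.2.1 ξ'.2.1,
      D ξ.2.1 ξ'.2.2 - D ξ'.2.1 ξ.2.2 + B ξ.2.1 ξ'.2.1 + br ξ.2.2 ξ'.2.2))
    (fun ξ ζ ξ' => by
      refine Prod.ext ?_ (Prod.ext ?_ ?_) <;> simp <;> abel)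
    (fun c ξ ξ' => by
      refine Prod.ext ?_ (Prod.ext ?_ ?_) <;> simp [smul_sub])
    (fun ξ ζ ξ' => by
      refine Prod.ext ?_ (Prod.ext ?_ ?_) <;> simp <;> abel)
    (fun c ξ ξ' => by
      refine Prod.ext ?_ (Prod.ext ?_ ?_) <;> simp [smul_sub])

variable {d : X →ₗ[R] K →ₗ[R] K} {lie : X →ₗ[R] X →ₗ[R] X} {D : X →ₗ[R] S →ₗ[R] S}
  {B : X →ₗ[R] X →ₗ[R] S} {br : S →ₗ[R] S →ₗ[R] S}

theorem tripleBracket_apply (ξ ξ' : K × X × S) : tripleBracket d lie D B br ξ ξ'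
    = (d ξ.2.1 ξ'.1 - d ξ'.2.1 ξ.1, lie ξ.2.1 ξ'.2.1,
      D ξ.2.1 ξ'.2.2 - D ξ'.2.1 ξ.2.2 + B ξ.2.1 ξ'.2.1 + br ξ.2.2 ξ'.2.2) := rfl

theorem tripleBracket_self (hlie : ∀ v, lie v v = 0) (hB : ∀ v, B v v = 0) (hbr : ∀ a, br a a = 0)
    (ξ : K × X × S) : tripleBracket d lie D B br ξ ξ = 0 := by
  rw [tripleBracket_apply, hlie, hB, hbr]
  simp

/-- The function component says that vector fields act as derivations, and the field component is
their Jacobi identity. In the section component the derivation property, the curvature equation, the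
Bianchi identity and the fibrewise Jacobi identity each cancel one type of term. -/
theorem tripleBracket_jacobi (hlie : ∀ v w, lie v w = -lie w v) (hB : ∀ v w, B v w = -B w v)
    (hbr : ∀ a b, br a b = -br b a)
    (hd : ∀ v w f, d (lie v w) f = d v (d w f) - d w (d v f))
    (hljac : ∀ u v w, lie (lie u v) w + lie (lie v w) u + lie (lie w u) v = 0)
    (hjac : ∀ a b c, br a (br b c) + br b (br c a) + br c (br a b) = 0)
    (hD : ∀ v a b, D v (br a b) = br (D v a) b + br a (D v b))
    (hcurv : ∀ v w a, D v (D w a) - D w (D v a) - D (lie v w) a = br (B v w) a)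
    (hbi : ∀ u v w, D u (B v w) - B (lie u v) w + (D v (B w u) - B (lie v w) u)
      + (D w (B u v) - B (lie w u) v) = 0) (ξ ξ' ξ'' : K × X × S) :
    tripleBracket d lie D B br ξ (tripleBracket d lie D B br ξ' ξ'')
      + tripleBracket d lie D B br ξ' (tripleBracket d lie D B br ξ'' ξ)
      + tripleBracket d lie D B br ξ'' (tripleBracket d lie D B br ξ ξ') = 0 := by
  obtain ⟨f, u, a⟩ := ξ
  obtain ⟨g, v, b⟩ := ξ'
  obtain ⟨h, w, c⟩ := ξ''
  simp only [tripleBracket_apply, Prod.mk_add_mk]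
  refine Prod.ext ?_ (Prod.ext ?_ ?_)
  · simp only [map_sub, hd, Prod.fst_zero]
    abel
  · simp only [Prod.fst_zero, Prod.snd_zero]
    rw [hlie u, hlie v (lie w u), hlie w (lie u v), ← neg_eq_zero, ← hljac u v w]
    abel
  · simp only [Prod.snd_zero, map_sub, map_add, hD]
    have c1 := hcurv u v c
    have c2 := hcurv v w a
    have c3 := hcurv w u b
    have hb := hbi u v w
    have hj := hjac a b c
    rw [hB u (lie v w), hB v (lie w u), hB w (lie u v), hbr a (B v w), hbr b (B w u),
      hbr c (B u v), hbr c (D u b), hbr a (D v c), hbr b (D w a)]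
    linear_combination (norm := module) c1 + c2 + c3 + hb + hj

end GeneratorAlgebra

/-! ### Generating triples on a manifold. -/

section Generators

variable {EQ : Type*} [NormedAddCommGroup EQ] [NormedSpace ℝ EQ] [FiniteDimensional ℝ EQ]
  {Q : Type*} [TopologicalSpace Q] [ChartedSpace EQ Q] [IsManifold 𝓘(ℝ, EQ) ∞ Q] [T2Space Q]
  {F : Type*} [NormedAddCommGroup F] [NormedSpace ℝ F] [FiniteDimensional ℝ F]
  {V : Q → Type*} [TopologicalSpace (TotalSpace F V)]
  [∀ q, AddCommGroup (V q)] [∀ q, Module ℝ (V q)] [∀ q, TopologicalSpace (V q)]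
  [∀ q, IsTopologicalAddGroup (V q)] [∀ q, ContinuousSMul ℝ (V q)]
  [FiberBundle F V] [VectorBundle ℝ F V] [ContMDiffVectorBundle ∞ F V 𝓘(ℝ, EQ)]

variable (EQ Q F V) in
/-- Triples of a function on `Q`, a vector field and a section of the dual bundle. -/
abbrev Gen : Type _ :=
  C^∞⟮𝓘(ℝ, EQ), Q; 𝓘(ℝ, ℝ), ℝ⟯ × VectorFields EQ Q × DualSections EQ F V

/-- The function on the phase space generated by a triple. -/
def gen : Gen EQ Q F V →ₗ[ℝ] PhaseFun EQ F V where
  toFun ξ := baseFun ξ.1 + momFun ξ.2.1 + linFun ξ.2.2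
  map_add' ξ ξ' := by
    ext z
    change (ξ.1 z.1.1 + ξ'.1 z.1.1) + z.1.2 (ξ.2.1 z.1.1 + ξ'.2.1 z.1.1)
      + (ξ.2.2 z.1.1 z.2 + ξ'.2.2 z.1.1 z.2)
      = (ξ.1 z.1.1 + z.1.2 (ξ.2.1 z.1.1) + ξ.2.2 z.1.1 z.2)
        + (ξ'.1 z.1.1 + z.1.2 (ξ'.2.1 z.1.1) + ξ'.2.2 z.1.1 z.2)
    rw [map_add]
    ring
  map_smul' c ξ := by
    ext z
    change c * ξ.1 z.1.1 + z.1.2 (c • ξ.2.1 z.1.1) + c * (ξ.2.2 z.1.1 z.2)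
      = c * (ξ.1 z.1.1 + z.1.2 (ξ.2.1 z.1.1) + ξ.2.2 z.1.1 z.2)
    rw [map_smul, smul_eq_mul]
    ring

theorem gen_apply (ξ : Gen EQ Q F V) (z : PhaseSpace EQ F V) :
    gen ξ z = ξ.1 z.1.1 + z.1.2 (ξ.2.1 z.1.1) + ξ.2.2 z.1.1 z.2 := rfl

theorem gen_eq (ξ : Gen EQ Q F V) : gen ξ = baseFun ξ.1 + momFun ξ.2.1 + linFun ξ.2.2 := rfl

variable (EQ Q) in
/-- Vector fields as derivations. -/
def derivLin : VectorFields EQ Q →ₗ[ℝ] C^∞⟮𝓘(ℝ, EQ), Q; 𝓘(ℝ, ℝ), ℝ⟯ →ₗ[ℝ]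
    C^∞⟮𝓘(ℝ, EQ), Q; 𝓘(ℝ, ℝ), ℝ⟯ :=
  LinearMap.mk₂ ℝ (fun v f => ⟨fun q => mvfderiv 𝓘(ℝ, EQ) f q (v q),
      contMDiff_mvfderiv_apply f.contMDiff v⟩)
    (fun v w f => by ext q; exact (mvfderiv 𝓘(ℝ, EQ) f q).map_add _ _)
    (fun c v f => by ext q; exact (mvfderiv 𝓘(ℝ, EQ) f q).map_smul _ _)
    (fun v f g => by
      ext q
      exact congrArg (fun L => L (v q)) (mvfderiv_fun_add ((f.contMDiff q).mdifferentiableAt (by simp))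
        ((g.contMDiff q).mdifferentiableAt (by simp))))
    (fun c v f => by
      ext q
      have := congrArg (fun L => L (v q)) (mvfderiv_fun_mul
        (mdifferentiableAt_const (c := c)) ((f.contMDiff q).mdifferentiableAt (by simp)))
      simp [mvfderiv_const] at this
      exact this)

theorem lieVF_swap (v w : VectorFields EQ Q) : lieVF v w = -lieVF w v := by
  ext q
  exact mlieBracket_swap_apply

variable (EQ Q) in
/-- The Lie bracket of vector fields, as a bilinear map. -/
def lieLin : VectorFields EQ Q →ₗ[ℝ] VectorFields EQ Q →ₗ[ℝ] VectorFields EQ Q :=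
  LinearMap.mk₂ ℝ lieVF
    (fun v v' w => by ext q; exact mlieBracket_add_left v.mdifferentiableAt v'.mdifferentiableAt)
    (fun c v w => by ext q; exact mlieBracket_const_smul_left v.mdifferentiableAt)
    (fun v w w' => by ext q; exact mlieBracket_add_right w.mdifferentiableAt w'.mdifferentiableAt)
    (fun c v w => by ext q; exact mlieBracket_const_smul_right w.mdifferentiableAt)

variable {Ψ : LiePoissonStructure EQ F V} {nabla : CovariantDerivative 𝓘(ℝ, EQ) F V}
  {B : ∀ q : Q, TangentSpace 𝓘(ℝ, EQ) q →L[ℝ] TangentSpace 𝓘(ℝ, EQ) q →L[ℝ] DualFib V q}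

/-- The dual connection, as a bilinear map. -/
def dualCovLin (hn : nabla.ContMDiffCovariantDerivative ∞) :
    VectorFields EQ Q →ₗ[ℝ] DualSections EQ F V →ₗ[ℝ] DualSections EQ F V :=
  LinearMap.mk₂ ℝ (dualCovSec hn)
    (fun v w η => by ext q : 1; exact dualCov_add_right nabla η _ _)
    (fun c v η => by ext q : 1; exact dualCov_smul_right nabla η c _)
    (fun v => (dualCovHom hn v).map_add)
    (fun c v η => by
      ext q : 1
      have := (dualCovParam nabla (LinearMap.toSpanSingleton ℝ _ η) q (v q)).map_smul c 1
      change dualCov nabla ((c * 1) • η : DualSections EQ F V) q (v q)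
        = c • dualCov nabla ((1 : ℝ) • η : DualSections EQ F V) q (v q) at this
      rwa [mul_one, one_smul] at this)

/-- A two-form with values in the dual bundle, as a bilinear map. -/
def formLin (hB : IsSmoothTwoForm F B) :
    VectorFields EQ Q →ₗ[ℝ] VectorFields EQ Q →ₗ[ℝ] DualSections EQ F V :=
  LinearMap.mk₂ ℝ (formSec hB)
    (fun v v' w => by
      ext q : 1
      exact congrArg (fun L => L (w q)) ((B q).map_add (v q) (v' q)))
    (fun c v w => by
      ext q : 1
      exact congrArg (fun L => L (w q)) ((B q).map_smul c (v q)))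
    (fun v w w' => by
      ext q : 1
      exact (B q (v q)).map_add (w q) (w' q))
    (fun c v w => by
      ext q : 1
      exact (B q (v q)).map_smul c (w q))

variable (Ψ) in
/-- The fibrewise bracket on sections, as a bilinear map. -/
def psiLin : DualSections EQ F V →ₗ[ℝ] DualSections EQ F V →ₗ[ℝ] DualSections EQ F V :=
  LinearMap.mk₂ ℝ (psiSec Ψ)
    (fun v v' w => by
      ext q : 1
      exact congrArg (fun L => L (w q)) ((Ψ.Psi q).map_add (v q) (v' q)))
    (fun c v w => by
      ext q : 1
      exact congrArg (fun L => L (w q)) ((Ψ.Psi q).map_smul c (v q)))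
    (fun v w w' => by
      ext q : 1
      exact (Ψ.Psi q (v q)).map_add (w q) (w' q))
    (fun c v w => by
      ext q : 1
      exact (Ψ.Psi q (v q)).map_smul c (w q))

/-- The bracket of generating triples for a compatible pair. -/
def genBracket (h : IsCompatiblePair Ψ nabla B) :
    Gen EQ Q F V →ₗ[ℝ] Gen EQ Q F V →ₗ[ℝ] Gen EQ Q F V :=
  tripleBracket (derivLin EQ Q) (lieLin EQ Q) (dualCovLin h.smooth_connection)
    (formLin h.smooth_form) (psiLin Ψ)

theorem gen_genBracket_apply (h : IsCompatiblePair Ψ nabla B) (ξ ξ' : Gen EQ Q F V) (q : Q)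
    (p : TangentSpace 𝓘(ℝ, EQ) q →L[ℝ] ℝ) (y : V q) :
    gen (genBracket h ξ ξ') (phasePt q p y) =
      (mvfderiv 𝓘(ℝ, EQ) ξ'.1 q (ξ.2.1 q) - mvfderiv 𝓘(ℝ, EQ) ξ.1 q (ξ'.2.1 q))
        + p (mlieBracket 𝓘(ℝ, EQ) ξ.2.1 ξ'.2.1 q)
        + (dualCov nabla ξ'.2.2 q (ξ.2.1 q) y - dualCov nabla ξ.2.2 q (ξ'.2.1 q) y
          + B q (ξ.2.1 q) (ξ'.2.1 q) y + Ψ.Psi q (ξ.2.2 q) (ξ'.2.2 q) y) := rfl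

theorem genBracket_self (h : IsCompatiblePair Ψ nabla B) (ξ : Gen EQ Q F V) :
    genBracket h ξ ξ = 0 := by
  refine tripleBracket_self (fun v => ?_) (fun v => ?_) (fun a => ?_) ξ
  · ext q
    exact congrFun mlieBracket_self q
  · ext q : 1
    exact h.smooth_form.alternating q (v q)
  · ext q : 1
    exact Ψ.skew q (a q)

theorem genBracket_swap (h : IsCompatiblePair Ψ nabla B) (ξ ξ' : Gen EQ Q F V) :
    genBracket h ξ ξ' = -genBracket h ξ' ξ := by
  have h1 := genBracket_self h (ξ + ξ')
  simp only [map_add, LinearMap.add_apply, genBracket_self, zero_add, add_zero] at h1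
  exact eq_neg_of_add_eq_zero_right h1

theorem genBracket_jacobi (h : IsCompatiblePair Ψ nabla B) (ξ ξ' ξ'' : Gen EQ Q F V) :
    genBracket h ξ (genBracket h ξ' ξ'') + genBracket h ξ' (genBracket h ξ'' ξ)
      + genBracket h ξ'' (genBracket h ξ ξ') = 0 := by
  refine tripleBracket_jacobi lieVF_swap (fun v w => ?_) (fun a b => ?_) (fun v w f => ?_)
    lieVF_jacobi (fun a b c => ?_) (fun v a b => h.dual_preserves v a b) (fun v w a => ?_)
    (fun u v w => ?_) ξ ξ' ξ''
  · have hs : ∀ v, formLin h.smooth_form v v = 0 := fun v => by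
      ext q : 1
      exact h.smooth_form.alternating q (v q)
    have h1 := hs (v + w)
    simp only [map_add, LinearMap.add_apply, hs, zero_add, add_zero] at h1
    exact eq_neg_of_add_eq_zero_right h1
  · ext q : 1
    exact Psi_swap Ψ q _ _
  · ext q
    exact lieVF_apply_fun v w f.contMDiff q
  · ext q : 1
    exact Ψ.jacobi q _ _ _
  · ext q : 1
    exact congrArg (fun η : DualSections EQ F V => η q) (h.dual_curvature v w a)
  · ext q : 1
    exact h.covariantly_constant u v w q

end Generators

end Wong

namespace Wong

/-! ### Coordinates of the phase space -/

section Coordinates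

/-- Points over different base points are separated in the base, points of one fibre in a
trivialization. Cutoffs on the phase space need this. -/
theorem t2Space_totalSpace {B : Type*} [TopologicalSpace B] [T2Space B] (F : Type*)
    [TopologicalSpace F] [T2Space F] (E : B → Type*) [TopologicalSpace (TotalSpace F E)]
    [∀ b, TopologicalSpace (E b)] [FiberBundle F E] : T2Space (TotalSpace F E) where
  t2 x y hxy := by
    by_cases hp : x.1 = y.1
    · set e := trivializationAt F E x.1
      have hx : x ∈ e.source := FiberBundle.mem_trivializationAt_proj_source
      have hy : y ∈ e.source := by
        rw [Trivialization.mem_source, ← hp]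
        exact FiberBundle.mem_baseSet_trivializationAt F E x.1
      obtain ⟨u, v, hu, hv, hxu, hyv, huv⟩ := t2_separation (e.injOn.ne hx hy hxy)
      refine ⟨e.source ∩ e ⁻¹' u, e.source ∩ e ⁻¹' v, e.continuousOn.isOpen_inter_preimage
        e.open_source hu, e.continuousOn.isOpen_inter_preimage e.open_source hv, ⟨hx, hxu⟩,
        ⟨hy, hyv⟩, ?_⟩
      exact (huv.preimage e).mono Set.inter_subset_right Set.inter_subset_right
    · obtain ⟨u, v, hu, hv, hxu, hyv, huv⟩ := t2_separation hp
      have hc : Continuous (TotalSpace.proj : TotalSpace F E → B) := FiberBundle.continuous_proj F E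
      exact ⟨_, _, hu.preimage hc, hv.preimage hc, hxu, hyv, huv.preimage _⟩

variable {EQ : Type*} [NormedAddCommGroup EQ] [NormedSpace ℝ EQ] [FiniteDimensional ℝ EQ]
  {Q : Type*} [TopologicalSpace Q] [ChartedSpace EQ Q] [IsManifold 𝓘(ℝ, EQ) ∞ Q] [T2Space Q]
  {F : Type*} [NormedAddCommGroup F] [NormedSpace ℝ F] [FiniteDimensional ℝ F]
  {V : Q → Type*} [TopologicalSpace (TotalSpace F V)]
  [∀ q, AddCommGroup (V q)] [∀ q, Module ℝ (V q)] [∀ q, TopologicalSpace (V q)]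
  [∀ q, IsTopologicalAddGroup (V q)] [∀ q, ContinuousSMul ℝ (V q)]
  [FiberBundle F V] [VectorBundle ℝ F V] [ContMDiffVectorBundle ∞ F V 𝓘(ℝ, EQ)]

instance : T2Space (Cotangent EQ Q) := t2Space_totalSpace _ _

instance : T2Space (PhaseSpace EQ F V) := t2Space_totalSpace _ _

theorem extChartAt_phaseSpace (z₀ z : PhaseSpace EQ F V) :
    extChartAt (phaseModel EQ F) z₀ z = ((chartAt EQ z₀.1.1 z.1.1,
      (trivializationAt (EQ →L[ℝ] ℝ) (fun q : Q => TangentSpace 𝓘(ℝ, EQ) q →L[ℝ] ℝ)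
        z₀.1.1 z.1).2), (trivializationAt F V z₀.1.1 (phaseToBundle z)).2) := by
  rfl

/-- A linear functional of the coordinates has three parts: a function on `Q`, the pairing of `p`
with a locally constant vector field, and a locally constant section paired with `y`. So chart
coordinates of the phase space are locally generating functions. -/
theorem exists_gen_eventuallyEq (z₀ : PhaseSpace EQ F V)
    (c : ((EQ × (EQ →L[ℝ] ℝ)) × F) →L[ℝ] ℝ) :
    ∃ ξ : Gen EQ Q F V, ∀ᶠ z in 𝓝 z₀, gen ξ z = c (extChartAt (phaseModel EQ F) z₀ z) := by
  let c₁ : EQ →L[ℝ] ℝ := c ∘L ContinuousLinearMap.inl ℝ _ F ∘L ContinuousLinearMap.inl ℝ EQ _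
  let c₂ : (EQ →L[ℝ] ℝ) →L[ℝ] ℝ :=
    c ∘L ContinuousLinearMap.inl ℝ _ F ∘L ContinuousLinearMap.inr ℝ EQ _
  let c₃ : F →L[ℝ] ℝ := c ∘L ContinuousLinearMap.inr ℝ _ F
  have hc : ∀ x, c x = c₁ x.1.1 + c₂ x.1.2 + c₃ x.2 := by
    intro x
    simp only [c₁, c₂, c₃, ContinuousLinearMap.coe_comp, Function.comp_apply,
      ContinuousLinearMap.inl_apply, ContinuousLinearMap.inr_apply, ← map_add]
    simp
  obtain ⟨φ, hφ, hφe⟩ := exists_contMDiff_eventuallyEq (I := 𝓘(ℝ, EQ))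
    (f := fun q => c₁ (chartAt EQ z₀.1.1 q)) (chartAt EQ z₀.1.1).open_source
    (mem_chart_source EQ z₀.1.1)
    (c₁.contMDiff.comp_contMDiffOn (contMDiffOn_chart (I := 𝓘(ℝ, EQ))))
  obtain ⟨σ, u, hu, hqu, hub, hσ⟩ := exists_local_const_sections EQ EQ
    (TangentSpace 𝓘(ℝ, EQ) : Q → Type _) z₀.1.1
  obtain ⟨θ, u', hu', hqu', hub', hθ⟩ := exists_local_const_dualSections EQ F V z₀.1.1
  have hproj : Continuous fun z : PhaseSpace EQ F V => z.1.1 :=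
    (FiberBundle.continuous_proj _ _).comp (FiberBundle.continuous_proj _ _)
  refine ⟨(⟨φ, hφ⟩, σ ((bidual EQ).symm c₂), θ c₃), ?_⟩
  filter_upwards [hproj.continuousAt.eventually hφe,
    hproj.continuousAt.eventually (hu.mem_nhds hqu),
    hproj.continuousAt.eventually (hu'.mem_nhds hqu')] with z h1 h2 h3
  rw [gen_apply, extChartAt_phaseSpace, hc]
  change φ z.1.1 + z.1.2 (σ ((bidual EQ).symm c₂) z.1.1) + θ c₃ z.1.1 z.2 = _
  rw [h1, hσ _ h2]
  congr 1
  · congr 1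
    have hb : ∀ α : EQ →L[ℝ] ℝ, c₂ α = α ((bidual EQ).symm c₂) := by
      intro α
      exact (congrArg (fun L => L α) ((bidual EQ).apply_symm_apply c₂)).symm.trans
        (bidual_apply EQ _ _)
    rw [hb, hom_trivializationAt_apply]
    simp [ContinuousLinearMap.inCoordinates]
  · refine (hθ _ h3 _ _).trans ?_
    rw [Trivialization.continuousLinearMapAt_apply, Trivialization.coe_linearMapAt_of_mem _ (hub' h3)]
    rfl

end Coordinates

/-! ### Derivations at a point -/

section Hadamard

/-- The fundamental theorem of calculus on the segment from `x₀` to `x`; the coefficients are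
partial derivatives averaged over the segment, hence smooth. -/
theorem exists_hadamard {X : Type*} [NormedAddCommGroup X] [NormedSpace ℝ X]
    {ι : Type*} [Fintype ι] (b : Module.Basis ι ℝ X) [FiniteDimensional ℝ X]
    {f : X → ℝ} (hf : ContDiff ℝ ∞ f) (x₀ : X) :
    ∃ g : ι → X → ℝ, (∀ i, ContDiff ℝ ∞ (g i)) ∧ (∀ i, g i x₀ = fderiv ℝ f x₀ (b i)) ∧
      ∀ x, f x = f x₀ + ∑ i, b.coord i (x - x₀) * g i x := by
  let μ : Measure ℝ := volume.restrict (Set.Ioc 0 1)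
  have hμ : ∀ᵐ t ∂μ, id t ∈ Set.Icc (0 : ℝ) 1 := by
    filter_upwards [ae_restrict_mem measurableSet_Ioc] with t ht using Set.Ioc_subset_Icc_self ht
  have hsm : ∀ i, ContDiff ℝ ∞ fun p : X × ℝ => fderiv ℝ f (x₀ + p.2 • (p.1 - x₀)) (b i) := by
    intro i
    have h1 : ContDiff ℝ ∞ (fderiv ℝ f) := hf.fderiv_right (by simp)
    have h2 : ContDiff ℝ ∞ fun p : X × ℝ => x₀ + p.2 • (p.1 - x₀) := by fun_prop
    exact (h1.comp h2).clm_apply contDiff_const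
  refine ⟨fun i x => ∫ t, fderiv ℝ f (x₀ + t • (x - x₀)) (b i) ∂μ, fun i => ?_, fun i => ?_,
    fun x => ?_⟩
  · exact contDiffOn_univ.1 (contDiffOn_integral_of_compact (μ := μ) (l := id)
      aestronglyMeasurable_id (isCompact_Icc (a := (0 : ℝ)) (b := 1)) hμ isOpen_univ
      (f := fun p : X × ℝ => fderiv ℝ f (x₀ + p.2 • (p.1 - x₀)) (b i)) (hsm i).contDiffOn)
  · simp [μ]
  · have hint : ∀ i, Integrable (fun t => fderiv ℝ f (x₀ + t • (x - x₀)) (b i)) μ := fun i =>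
      integrable_comp_of_compact (l := id) aestronglyMeasurable_id
        (isCompact_Icc (a := (0 : ℝ)) (b := 1)) hμ
        ((hsm i).continuous.comp (Continuous.prodMk_right x))
    have hd : ∀ t ∈ Set.uIcc (0 : ℝ) 1, HasDerivAt (fun t : ℝ => f (x₀ + t • (x - x₀)))
        (fderiv ℝ f (x₀ + t • (x - x₀)) (x - x₀)) t := by
      intro t _
      have h1 : HasDerivAt (fun t : ℝ => x₀ + t • (x - x₀)) (x - x₀) t := by
        simpa using ((hasDerivAt_id t).smul_const (x - x₀)).const_add x₀
      exact ((hf.differentiable (by simp) _).hasFDerivAt).comp_hasDerivAt t h1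
    have hexp : ∀ t : ℝ, fderiv ℝ f (x₀ + t • (x - x₀)) (x - x₀)
        = ∑ i, b.coord i (x - x₀) * fderiv ℝ f (x₀ + t • (x - x₀)) (b i) := by
      intro t
      conv_lhs => rw [← b.sum_repr (x - x₀), map_sum]
      simp only [map_smul, smul_eq_mul, Module.Basis.coord_apply]
      rw [b.sum_repr]
    have hii : IntervalIntegrable (fun t : ℝ => fderiv ℝ f (x₀ + t • (x - x₀)) (x - x₀))
        volume 0 1 := by
      rw [intervalIntegrable_iff_integrableOn_Ioc_of_le zero_le_one]
      simp only [hexp]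
      exact integrable_finsetSum _ fun i _ => (hint i).const_mul _
    have h := intervalIntegral.integral_eq_sub_of_hasDerivAt hd hii
    rw [intervalIntegral.integral_of_le zero_le_one] at h
    simp only [one_smul, zero_smul, add_zero, add_sub_cancel, hexp] at h
    rw [integral_finsetSum _ fun i _ => (hint i).const_mul _] at h
    simp only [integral_const_mul] at h
    linarith

end Hadamard

section Derivations

variable {EQ : Type*} [NormedAddCommGroup EQ] [NormedSpace ℝ EQ] [FiniteDimensional ℝ EQ]
  {Q : Type*} [TopologicalSpace Q] [ChartedSpace EQ Q] [IsManifold 𝓘(ℝ, EQ) ∞ Q] [T2Space Q]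
  {F : Type*} [NormedAddCommGroup F] [NormedSpace ℝ F] [FiniteDimensional ℝ F]
  {V : Q → Type*} [TopologicalSpace (TotalSpace F V)]
  [∀ q, AddCommGroup (V q)] [∀ q, Module ℝ (V q)] [∀ q, TopologicalSpace (V q)]
  [∀ q, IsTopologicalAddGroup (V q)] [∀ q, ContinuousSMul ℝ (V q)]
  [FiberBundle F V] [VectorBundle ℝ F V] [ContMDiffVectorBundle ∞ F V 𝓘(ℝ, EQ)]

/-- Derivations at a point of the algebra of smooth functions on the phase space. -/
def IsDerivationAt (z : PhaseSpace EQ F V) (D : PhaseFun EQ F V →ₗ[ℝ] ℝ) : Prop :=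
  ∀ f h : PhaseFun EQ F V, D (f * h) = D f * h z + f z * D h

variable {z : PhaseSpace EQ F V} {D : PhaseFun EQ F V →ₗ[ℝ] ℝ}

theorem IsDerivationAt.apply_one (hD : IsDerivationAt z D) : D 1 = 0 := by
  have h := hD 1 1
  rw [mul_one] at h
  change D 1 = D 1 * 1 + 1 * D 1 at h
  linarith

/-- Derivations are local: a cutoff `ψ` with `ψ (f - h) = 0` and value one at the point gives the
equality through the product rule. -/
theorem IsDerivationAt.congr (hD : IsDerivationAt z D) {f h : PhaseFun EQ F V}
    (hfh : ∀ᶠ x in 𝓝 z, f x = h x) : D f = D h := by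
  obtain ⟨ψ, hψ, hψ1, hψs⟩ := exists_cutoff (I := phaseModel EQ F) hfh
  let ψ' : PhaseFun EQ F V := ⟨ψ, hψ⟩
  have h0 : ψ' * (f - h) = 0 := by
    ext x
    change ψ x * (f x - h x) = 0
    by_cases hx : x ∈ tsupport ψ
    · rw [show f x = h x from hψs hx, sub_self, mul_zero]
    · rw [image_eq_zero_of_notMem_tsupport hx, zero_mul]
  have h1 := hD ψ' (f - h)
  have h2 : ψ' z = 1 := hψ1.self_of_nhds
  have h3 : (f - h) z = 0 := sub_eq_zero.2 hfh.self_of_nhds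
  rw [h0, map_zero, h2, h3, mul_zero, zero_add, one_mul, map_sub] at h1
  exact (sub_eq_zero.1 h1.symm)

theorem phaseFun_sum_apply {ι : Type*} (t : Finset ι) (a : ι → PhaseFun EQ F V)
    (x : PhaseSpace EQ F V) : (∑ i ∈ t, a i) x = ∑ i ∈ t, a i x := by
  classical
  induction t using Finset.induction_on with
  | empty => rfl
  | insert i t hi ih => rw [Finset.sum_insert hi, Finset.sum_insert hi, ← ih]; rfl

set_option maxHeartbeats 1000000 in
/-- Near every point, all derivations are determined by finitely many generating functions. -/
theorem exists_local_expansion (z₀ : PhaseSpace EQ F V) :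
    ∃ (n : ℕ) (ξ : Fin n → Gen EQ Q F V), ∀ f : PhaseFun EQ F V, ∃ g : Fin n → PhaseFun EQ F V,
      ∀ᶠ z in 𝓝 z₀, ∀ D : PhaseFun EQ F V →ₗ[ℝ] ℝ, IsDerivationAt z D →
        D f = ∑ i, g i z * D (gen (ξ i)) := by
  let X := (EQ × (EQ →L[ℝ] ℝ)) × F
  set b := Module.finBasis ℝ X
  set ext := extChartAt (phaseModel EQ F) z₀
  have hext : ContMDiffOn (phaseModel EQ F) 𝓘(ℝ, X) ∞ ext ext.source :=
    by simpa only [ext, extChartAt_source] using contMDiffOn_extChartAt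
  have hso : IsOpen ext.source := isOpen_extChartAt_source z₀
  have hz₀ : z₀ ∈ ext.source := mem_extChartAt_source z₀
  choose ξ hξ using fun i => exists_gen_eventuallyEq z₀ (b.coord i).toContinuousLinearMap
  refine ⟨_, ξ, fun f => ?_⟩
  -- The germ of `f` in the chart is extended to the whole model space, where Hadamard's lemma
  -- applies.
  obtain ⟨f', hf', hff'⟩ := exists_contMDiff_eventuallyEq (I := 𝓘(ℝ, X)) (f := f ∘ ext.symm)
    (isOpen_extChartAt_target z₀) (mem_extChartAt_target z₀)
    (f.contMDiff.comp_contMDiffOn (contMDiffOn_extChartAt_symm z₀))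
  have hf'' : ContDiff ℝ ∞ f' := hf'.contDiff
  have hfe : ∀ᶠ z in 𝓝 z₀, f z = f' (ext z) := by
    filter_upwards [(continuousAt_extChartAt z₀).eventually hff', hso.mem_nhds hz₀] with z h1 h2
    rw [h1, Function.comp_apply, ext.left_inv h2]
  have hgi : ∀ i, ∃ g : PhaseFun EQ F V, ∀ᶠ z in 𝓝 z₀, g z = fderiv ℝ f' (ext z) (b i) := by
    intro i
    have h1 : ContDiff ℝ ∞ fun x => fderiv ℝ f' x (b i) :=
      (hf''.fderiv_right (by simp)).clm_apply contDiff_const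
    obtain ⟨g, hg, hge⟩ := exists_contMDiff_eventuallyEq hso hz₀ (h1.contMDiff.comp_contMDiffOn hext)
    exact ⟨⟨g, hg⟩, hge⟩
  choose g hg using hgi
  refine ⟨g, ?_⟩
  filter_upwards [(eventually_all.2 hξ).eventually_nhds, hfe.eventually_nhds,
    hso.mem_nhds hz₀, eventually_all.2 hg] with z hκ hf1 hz hgz D hD
  -- The expansion is made at the moving point `z`. Its coefficients at `z` are partial derivatives
  -- of `f'`, so one family of smooth functions `g` serves all nearby points.
  obtain ⟨G, hG, hGz, hGe⟩ := exists_hadamard b hf'' (ext z)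
  have hGi : ∀ i, ∃ k : PhaseFun EQ F V, ∀ᶠ x in 𝓝 z, k x = G i (ext x) := by
    intro i
    obtain ⟨k, hk, hke⟩ := exists_contMDiff_eventuallyEq hso hz
      ((hG i).contMDiff.comp_contMDiffOn hext)
    exact ⟨⟨k, hk⟩, hke⟩
  choose k hk using hGi
  have hloc : ∀ᶠ x in 𝓝 z, f x = ((f' (ext z)) • (1 : PhaseFun EQ F V)
      + ∑ i, (gen (ξ i) - (gen (ξ i) z) • (1 : PhaseFun EQ F V)) * k i) x := by
    filter_upwards [hκ, hf1, eventually_all.2 hk] with x h1 h2 h3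
    rw [h2, hGe]
    change _ = f' (ext z) * 1 + (∑ i, (gen (ξ i) - (gen (ξ i) z) • (1 : PhaseFun EQ F V)) * k i) x
    rw [phaseFun_sum_apply, mul_one]
    congr 1
    refine Finset.sum_congr rfl fun i _ => ?_
    change _ = (gen (ξ i) x - gen (ξ i) z * 1) * k i x
    rw [h1 i, hκ.self_of_nhds i, h3 i, map_sub, mul_one]
    rfl
  rw [hD.congr hloc, map_add, map_smul, hD.apply_one, smul_zero, zero_add, map_sum]
  refine Finset.sum_congr rfl fun i _ => ?_
  rw [hD, map_sub, map_smul, hD.apply_one, (hk i).self_of_nhds, hGz, hgz i]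
  change _ + (gen (ξ i) z - gen (ξ i) z * 1) * _ = _
  rw [mul_one, sub_self, zero_mul, add_zero, smul_zero, sub_zero, mul_comm]

theorem IsDerivationAt.eq_zero (hD : IsDerivationAt z D) (h : ∀ ξ, D (gen ξ) = 0)
    (f : PhaseFun EQ F V) : D f = 0 := by
  obtain ⟨n, ξ, hξ⟩ := exists_local_expansion z
  obtain ⟨g, hg⟩ := hξ f
  rw [hg.self_of_nhds D hD]
  simp [h]

end Derivations

end Wong

namespace Wong

/-! ### The Poisson bracket defined by a compatible pair -/

section TestDerivations

variable {EQ : Type*} [NormedAddCommGroup EQ] [NormedSpace ℝ EQ] [FiniteDimensional ℝ EQ]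
  {Q : Type*} [TopologicalSpace Q] [ChartedSpace EQ Q] [IsManifold 𝓘(ℝ, EQ) ∞ Q] [T2Space Q]
  {F : Type*} [NormedAddCommGroup F] [NormedSpace ℝ F] [FiniteDimensional ℝ F]
  {V : Q → Type*} [TopologicalSpace (TotalSpace F V)]
  [∀ q, AddCommGroup (V q)] [∀ q, Module ℝ (V q)] [∀ q, TopologicalSpace (V q)]
  [∀ q, IsTopologicalAddGroup (V q)] [∀ q, ContinuousSMul ℝ (V q)]
  [FiberBundle F V] [VectorBundle ℝ F V] [ContMDiffVectorBundle ∞ F V 𝓘(ℝ, EQ)]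

theorem contMDiff_phaseSpace_mk {E : Type*} [NormedAddCommGroup E] [NormedSpace ℝ E]
    {M : Type*} [TopologicalSpace M] [ChartedSpace E M] {c : M → PhaseSpace EQ F V}
    (h1 : ContMDiff 𝓘(ℝ, E) (𝓘(ℝ, EQ).prod 𝓘(ℝ, EQ →L[ℝ] ℝ)) ∞
      (fun x => ((c x).1 : Cotangent EQ Q)))
    (h2 : ContMDiff 𝓘(ℝ, E) (𝓘(ℝ, EQ).prod 𝓘(ℝ, F)) ∞ (fun x => phaseToBundle (c x))) :
    ContMDiff 𝓘(ℝ, E) (phaseModel EQ F) ∞ c := by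
  intro x
  rw [contMDiffAt_totalSpace]
  exact ⟨h1 x, (contMDiffAt_totalSpace.1 (h2 x)).2⟩

/-- The derivation given by a tangent vector of a manifold mapped to the phase space. -/
def pushDerivation {E : Type*} [NormedAddCommGroup E] [NormedSpace ℝ E]
    {M : Type*} [TopologicalSpace M] [ChartedSpace E M] {c : M → PhaseSpace EQ F V}
    (hc : ContMDiff 𝓘(ℝ, E) (phaseModel EQ F) ∞ c) (x : M) (w : TangentSpace 𝓘(ℝ, E) x) :
    PhaseFun EQ F V →ₗ[ℝ] ℝ where
  toFun f := mvfderiv 𝓘(ℝ, E) (fun x => f (c x)) x w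
  map_add' f h := by
    exact congrArg (fun L => L w) (mvfderiv_fun_add
      (((f.contMDiff.comp hc) x).mdifferentiableAt (by simp))
      (((h.contMDiff.comp hc) x).mdifferentiableAt (by simp)))
  map_smul' r f := by
    have := congrArg (fun L => L w) (mvfderiv_fun_mul (mdifferentiableAt_const (c := r))
      (((f.contMDiff.comp hc) x).mdifferentiableAt (by simp)))
    simp [mvfderiv_const] at this
    exact this

theorem isDerivationAt_pushDerivation {E : Type*} [NormedAddCommGroup E] [NormedSpace ℝ E]
    {M : Type*} [TopologicalSpace M] [ChartedSpace E M] {c : M → PhaseSpace EQ F V}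
    (hc : ContMDiff 𝓘(ℝ, E) (phaseModel EQ F) ∞ c) (x : M) (w : TangentSpace 𝓘(ℝ, E) x) :
    IsDerivationAt (c x) (pushDerivation hc x w) := by
  intro f h
  have := congrArg (fun L => L w) (mvfderiv_fun_mul
      (((f.contMDiff.comp hc) x).mdifferentiableAt (by simp))
      (((h.contMDiff.comp hc) x).mdifferentiableAt (by simp)))
  simp at this
  refine Eq.trans this ?_
  change f (c x) * pushDerivation hc x w h + h (c x) * pushDerivation hc x w f = _
  ring

/-- Every covector is the differential of a smooth function. -/
theorem exists_mvfderiv_eq (q : Q) (p : TangentSpace 𝓘(ℝ, EQ) q →L[ℝ] ℝ) :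
    ∃ ψ : C^∞⟮𝓘(ℝ, EQ), Q; 𝓘(ℝ, ℝ), ℝ⟯, mvfderiv 𝓘(ℝ, EQ) ψ q = p := by
  let p' : EQ →L[ℝ] ℝ := p
  obtain ⟨ψ, hψ, hψe⟩ := exists_contMDiff_eventuallyEq (I := 𝓘(ℝ, EQ))
    (f := fun x => p' (chartAt EQ q x)) (chartAt EQ q).open_source (mem_chart_source EQ q)
    (p'.contMDiff.comp_contMDiffOn (contMDiffOn_chart (I := 𝓘(ℝ, EQ))))
  refine ⟨⟨ψ, hψ⟩, ContinuousLinearMap.ext fun v => ?_⟩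
  refine (mvfderiv_eq_fderiv_chart ((hψ q).mdifferentiableAt (by simp)) v).trans ?_
  have h1 : (fun x => ψ ((chartAt EQ q).symm x)) =ᶠ[𝓝 (chartAt EQ q q)] p' := by
    have hc : ContinuousAt (chartAt EQ q).symm (chartAt EQ q q) :=
      (chartAt EQ q).continuousAt_symm (mem_chart_target EQ q)
    have hc' := hc.eventually (p := fun x => ψ x = p' (chartAt EQ q x))
      (by rw [(chartAt EQ q).left_inv (mem_chart_source EQ q)]; exact hψe)
    filter_upwards [hc', (chartAt EQ q).open_target.mem_nhds (mem_chart_target EQ q)] with x h1 h2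
    rw [h1, (chartAt EQ q).right_inv h2]
  rw [h1.fderiv_eq, ContinuousLinearMap.fderiv]
  rfl

variable {Ψ : LiePoissonStructure EQ F V} {nabla : CovariantDerivative 𝓘(ℝ, EQ) F V}
  {B : ∀ q : Q, TangentSpace 𝓘(ℝ, EQ) q →L[ℝ] TangentSpace 𝓘(ℝ, EQ) q →L[ℝ] DualFib V q}

/-- Differentiating along the lines `p + t α` and `y + t w` in the fibre directions isolates the
values of the field and of the section. -/
theorem values_eq_zero_of_derivations {ξ : Gen EQ Q F V} {z : PhaseSpace EQ F V}
    (hξ : ∀ D : PhaseFun EQ F V →ₗ[ℝ] ℝ, IsDerivationAt z D → D (gen ξ) = 0) :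
    ξ.2.1 z.1.1 = 0 ∧ ξ.2.2 z.1.1 = 0 := by
  obtain ⟨⟨q, p⟩, y⟩ := z
  change V q at y
  have hmv : ∀ (g : ℝ → ℝ) (a b : ℝ), (∀ t, g t = a + t * b) →
      mvfderiv 𝓘(ℝ, ℝ) g 0 (1 : ℝ) = b := by
    intro g a b hg
    obtain rfl : g = fun t => a + t * b := funext hg
    have : HasDerivAt (fun t : ℝ => a + t * b) b 0 := by
      simpa using ((hasDerivAt_id (0 : ℝ)).mul_const b).const_add a
    exact (congrArg (fun L : ℝ →L[ℝ] ℝ => L 1) (mfderiv_eq_fderiv)).trans this.deriv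
  constructor
  · refine SeparatingDual.eq_zero_of_forall_dual_eq_zero (R := ℝ) (V := EQ) fun α => ?_
    let α' : TangentSpace 𝓘(ℝ, EQ) q →L[ℝ] ℝ := α
    have hc : ContMDiff 𝓘(ℝ, ℝ) (phaseModel EQ F) ∞
        (fun t : ℝ => (⟨⟨q, p + t • α'⟩, y⟩ : PhaseSpace EQ F V)) :=
      contMDiff_phaseSpace_mk (contMDiff_fibreLine (⟨q, p⟩ : Cotangent EQ Q) α')
        (contMDiff_const (c := (⟨q, y⟩ : TotalSpace F V)))
    have h := isDerivationAt_pushDerivation hc 0 (1 : ℝ)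
    have e : (⟨⟨q, p + (0 : ℝ) • α'⟩, y⟩ : PhaseSpace EQ F V) = ⟨⟨q, p⟩, y⟩ := by
      rw [zero_smul, add_zero]
    rw [e] at h
    rw [← hξ _ h]
    refine (hmv _ (ξ.1 q + p (ξ.2.1 q) + ξ.2.2 q y) _ fun t => ?_).symm
    change ξ.1 q + (p (ξ.2.1 q) + t * α (ξ.2.1 q)) + ξ.2.2 q y = _
    ring
  · refine ContinuousLinearMap.ext fun w => ?_
    have hc : ContMDiff 𝓘(ℝ, ℝ) (phaseModel EQ F) ∞
        (fun t : ℝ => (phasePt q p (y + t • w) : PhaseSpace EQ F V)) :=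
      contMDiff_phaseSpace_mk (contMDiff_const (c := (⟨q, p⟩ : Cotangent EQ Q)))
        (contMDiff_fibreLine (⟨q, y⟩ : TotalSpace F V) w)
    have h := isDerivationAt_pushDerivation hc 0 (1 : ℝ)
    have e : (phasePt q p (y + (0 : ℝ) • w) : PhaseSpace EQ F V) = phasePt q p y := by
      rw [zero_smul, add_zero]
    rw [e] at h
    refine Eq.trans ?_ (hξ _ h)
    refine (hmv _ (ξ.1 q + p (ξ.2.1 q) + ξ.2.2 q y) _ fun t => ?_).symm
    change ξ.1 q + p (ξ.2.1 q) + ξ.2.2 q (y + t • w) = _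
    rw [map_add, map_smul, smul_eq_mul]
    ring

/-- This makes the bracket well defined. When the field and the section of `ξ` vanish at the base
point, the bracket is minus the derivative of `gen ξ` along the field of `ξ'`, taken on a section of
the phase space through `z`. -/
theorem gen_genBracket_eq_zero (h : IsCompatiblePair Ψ nabla B) {ξ : Gen EQ Q F V}
    {z : PhaseSpace EQ F V} (hξ : ∀ D : PhaseFun EQ F V →ₗ[ℝ] ℝ, IsDerivationAt z D → D (gen ξ) = 0)
    (ξ' : Gen EQ Q F V) : gen (genBracket h ξ ξ') z = 0 := by
  obtain ⟨hv, hη⟩ := values_eq_zero_of_derivations hξ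
  rcases z with ⟨⟨q, p⟩, y⟩
  change V q at y
  change ξ.2.1 q = 0 at hv
  change ξ.2.2 q = 0 at hη
  -- The covector part of the section is an exact form, so that the pairing of `p` with the Lie
  -- bracket becomes a derivative of the pairing with the field.
  obtain ⟨ψ, hψ⟩ := exists_mvfderiv_eq q p
  obtain ⟨σ, hσ⟩ := exists_section_eq EQ F (V := V) (q := q) y
  have hc : ContMDiff 𝓘(ℝ, EQ) (phaseModel EQ F) ∞
      (fun x => (phasePt x (mvfderiv 𝓘(ℝ, EQ) ψ x) (σ x) : PhaseSpace EQ F V)) :=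
    contMDiff_phaseSpace_mk
      (smoothSec_hom_trivial fun v => contMDiff_mvfderiv_apply ψ.contMDiff v) σ.contMDiff
  have hD := isDerivationAt_pushDerivation hc q (ξ'.2.1 q)
  rw [hψ, hσ] at hD
  have h0 := hξ _ hD
  have h1 := lieVF_apply_fun ξ.2.1 ξ'.2.1 ψ.contMDiff q
  rw [hv, map_zero, zero_sub, hψ] at h1
  have h2 := dualCov_section (nabla := nabla) (ξ'.2.1 q) ξ.2.2.mdifferentiableAt σ
  rw [hη, zero_apply, sub_zero, hσ] at h2
  have s1 := (ξ.1.contMDiff q).mdifferentiableAt (n := ∞) (by simp)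
  have s2 := (contMDiff_mvfderiv_apply ψ.contMDiff ξ.2.1 q).mdifferentiableAt (n := ∞) (by simp)
  have s3 := (SmoothSec.pair ξ.2.2.contMDiff σ.contMDiff q).mdifferentiableAt (n := ∞) (by simp)
  have s12 : MDifferentiableAt 𝓘(ℝ, EQ) 𝓘(ℝ, ℝ)
    (fun x => ξ.1 x + mvfderiv 𝓘(ℝ, EQ) ψ x (ξ.2.1 x)) q := s1.add s2
  have h3 : mvfderiv 𝓘(ℝ, EQ) (fun x => (ξ.1 x + mvfderiv 𝓘(ℝ, EQ) ψ x (ξ.2.1 x))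
      + ξ.2.2 x (σ x)) q (ξ'.2.1 q) = 0 := h0
  rw [mvfderiv_fun_add s12 s3, mvfderiv_fun_add s1 s2, add_apply,
    add_apply, ← h2] at h3
  refine (gen_genBracket_apply h ξ ξ' q p y).trans ?_
  rw [hv, hη, h1]
  simp only [map_zero, zero_apply, zero_sub, add_zero]
  have h4 : dualCov nabla ξ'.2.2 q 0 y = 0 := by
    have := dualCov_smul_right nabla ξ'.2.2 (0 : ℝ) (0 : TangentSpace 𝓘(ℝ, EQ) q)
    rw [zero_smul, zero_smul] at this
    rw [this, zero_apply]
  rw [h4]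
  linarith

end TestDerivations

end Wong

namespace Wong

/-! ### Extending identities of biderivations from generators. -/

section JacobiExtension

variable {R A : Type*} [CommRing R] [CommRing A] [Algebra R A] (br : A →ₗ[R] A →ₗ[R] A)

theorem skew_of_self {br : A →ₗ[R] A →ₗ[R] A} (hs : ∀ f, br f f = 0) (f k : A) :
    br f k = -br k f := by
  have h1 := hs (f + k)
  simp only [map_add, LinearMap.add_apply, hs, zero_add, add_zero] at h1
  exact eq_neg_of_add_eq_zero_right h1

/-- The Jacobi sum of a bilinear operation, as a function of its first argument. -/
def jacobiSum (h k : A) : A →ₗ[R] A :=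
  br.flip (br h k) + br h ∘ₗ br k + br k ∘ₗ br.flip h

theorem jacobiSum_apply (f h k : A) :
    jacobiSum br h k f = br f (br h k) + br h (br k f) + br k (br f h) := rfl

variable {br} in
/-- The Jacobi sum of a skew biderivation is a derivation in each argument. -/
theorem jacobiSum_mul (hs : ∀ f, br f f = 0)
    (hl : ∀ f h k, br f (h * k) = br f h * k + h * br f k) (f f' h k : A) :
    jacobiSum br h k (f * f') = jacobiSum br h k f * f' + f * jacobiSum br h k f' := by
  replace hs := skew_of_self hs
  simp only [jacobiSum_apply]
  have hl' : ∀ k, br (f * f') k = br f k * f' + f * br f' k := by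
    intro k
    rw [hs, hl, hs k f, hs k f']
    ring
  rw [hl', hl' h]
  simp only [hl, map_add]
  rw [hs f h, hs f' h, map_neg, map_neg]
  ring_nf

theorem sub_leibniz {T T' : A →ₗ[R] A} (hT : ∀ f h, T (f * h) = T f * h + f * T h)
    (hT' : ∀ f h, T' (f * h) = T' f * h + f * T' h) (f h : A) :
    (T - T') (f * h) = (T - T') f * h + f * (T - T') h := by
  simp only [LinearMap.sub_apply, hT, hT']
  ring

/-- Derivations that agree on generators are equal; this is used in the second argument, first with
a generator in the first argument and then, after skewness, with any element. -/
theorem ext_biderivation {X : Type*} {g : X → A}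
    (hg : ∀ T : A →ₗ[R] A, (∀ f h, T (f * h) = T f * h + f * T h) → (∀ x, T (g x) = 0) → T = 0)
    {br br' : A →ₗ[R] A →ₗ[R] A} (hs : ∀ f, br f f = 0) (hs' : ∀ f, br' f f = 0)
    (hl : ∀ f h k, br f (h * k) = br f h * k + h * br f k)
    (hl' : ∀ f h k, br' f (h * k) = br' f h * k + h * br' f k)
    (h : ∀ x y, br (g x) (g y) = br' (g x) (g y)) : br = br' := by
  have key : ∀ k, (∀ x, br k (g x) = br' k (g x)) → br k = br' k := fun k hk =>
    sub_eq_zero.1 (hg _ (sub_leibniz (hl k) (hl' k)) fun x => by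
      rw [LinearMap.sub_apply, hk, sub_self])
  refine LinearMap.ext fun f => key f fun x => ?_
  rw [skew_of_self hs, skew_of_self hs', key (g x) (h x)]

end JacobiExtension

/-! ### Bilinear expansions and brackets of homogeneous triples. -/

section BilinearSums

theorem bilinear_sum_smul {R X Y ι : Type*} [CommRing R] [AddCommGroup X] [Module R X]
    [AddCommGroup Y] [Module R Y] (b : X →ₗ[R] X →ₗ[R] Y) (t : Finset ι) (a c : ι → R)
    (x : ι → X) : b (∑ i ∈ t, a i • x i) (∑ j ∈ t, c j • x j)
      = ∑ i ∈ t, ∑ j ∈ t, (a i * c j) • b (x i) (x j) := by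
  simp only [map_sum, map_smul, LinearMap.sum_apply, LinearMap.smul_apply, Finset.smul_sum,
    smul_smul]
  rw [Finset.sum_comm]
  simp only [mul_comm]

variable {R X S K : Type*} [CommRing R] [AddCommGroup X] [Module R X] [AddCommGroup S] [Module R S]
  [AddCommGroup K] [Module R K] (d : X →ₗ[R] K →ₗ[R] K) (lie : X →ₗ[R] X →ₗ[R] X)
  (D : X →ₗ[R] S →ₗ[R] S) (B : X →ₗ[R] X →ₗ[R] S) (br : S →ₗ[R] S →ₗ[R] S)

theorem tripleBracket_fst_fst (f g : K) :
    tripleBracket d lie D B br (f, 0, 0) (g, 0, 0) = 0 := by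
  simp [tripleBracket_apply]

theorem tripleBracket_mid_fst (v : X) (f : K) :
    tripleBracket d lie D B br (0, v, 0) (f, 0, 0) = (d v f, 0, 0) := by
  simp [tripleBracket_apply]

theorem tripleBracket_fst_last (f : K) (a : S) :
    tripleBracket d lie D B br (f, 0, 0) (0, 0, a) = 0 := by
  simp [tripleBracket_apply]

theorem tripleBracket_mid_last (v : X) (a : S) :
    tripleBracket d lie D B br (0, v, 0) (0, 0, a) = (0, 0, D v a) := by
  simp [tripleBracket_apply]

theorem tripleBracket_mid_mid (v w : X) :
    tripleBracket d lie D B br (0, v, 0) (0, w, 0) = (0, lie v w, B v w) := by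
  simp [tripleBracket_apply]

theorem tripleBracket_last_last (a b : S) :
    tripleBracket d lie D B br (0, 0, a) (0, 0, b) = (0, 0, br a b) := by
  simp [tripleBracket_apply]

end BilinearSums

/-! ### The gauge Poisson structure: existence and uniqueness. -/

section PoissonConstruction

variable {EQ : Type*} [NormedAddCommGroup EQ] [NormedSpace ℝ EQ] [FiniteDimensional ℝ EQ]
  {Q : Type*} [TopologicalSpace Q] [ChartedSpace EQ Q] [IsManifold 𝓘(ℝ, EQ) ∞ Q] [T2Space Q]
  {F : Type*} [NormedAddCommGroup F] [NormedSpace ℝ F] [FiniteDimensional ℝ F]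
  {V : Q → Type*} [TopologicalSpace (TotalSpace F V)]
  [∀ q, AddCommGroup (V q)] [∀ q, Module ℝ (V q)] [∀ q, TopologicalSpace (V q)]
  [∀ q, IsTopologicalAddGroup (V q)] [∀ q, ContinuousSMul ℝ (V q)]
  [FiberBundle F V] [VectorBundle ℝ F V] [ContMDiffVectorBundle ∞ F V 𝓘(ℝ, EQ)]

/-- The generating triple `ξ` and the function `f` have the same differential at `z`. -/
def Osculates (ξ : Gen EQ Q F V) (f : PhaseFun EQ F V) (z : PhaseSpace EQ F V) : Prop :=
  ∀ D : PhaseFun EQ F V →ₗ[ℝ] ℝ, IsDerivationAt z D → D f = D (gen ξ)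

theorem osculates_gen (ξ : Gen EQ Q F V) (z : PhaseSpace EQ F V) : Osculates ξ (gen ξ) z :=
  fun _ _ => rfl

theorem Osculates.add {ξ ξ' : Gen EQ Q F V} {f f' : PhaseFun EQ F V} {z : PhaseSpace EQ F V}
    (h : Osculates ξ f z) (h' : Osculates ξ' f' z) : Osculates (ξ + ξ') (f + f') z :=
  fun D hD => by rw [map_add, map_add, map_add, h D hD, h' D hD]

theorem Osculates.smul {ξ : Gen EQ Q F V} {f : PhaseFun EQ F V} {z : PhaseSpace EQ F V}
    (h : Osculates ξ f z) (c : ℝ) : Osculates (c • ξ) (c • f) z :=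
  fun D hD => by rw [map_smul, map_smul, map_smul, h D hD]

/-- Only differentials at `z` matter, so the coefficients may be the numbers `f z` and `f' z`; the
Leibniz rule of the bracket comes from this. -/
theorem Osculates.mul {ξ ξ' : Gen EQ Q F V} {f f' : PhaseFun EQ F V} {z : PhaseSpace EQ F V}
    (h : Osculates ξ f z) (h' : Osculates ξ' f' z) :
    Osculates (f' z • ξ + f z • ξ') (f * f') z :=
  fun D hD => by
    rw [hD, map_add, map_smul, map_smul, map_add, map_smul, map_smul, h D hD, h' D hD, smul_eq_mul,
      smul_eq_mul, mul_comm]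

/-- The triples stay fixed and only the smooth coefficients vary with `z`, which is what makes the
bracket smooth. -/
theorem exists_local_osculates (z₀ : PhaseSpace EQ F V) :
    ∃ (n : ℕ) (ξ : Fin n → Gen EQ Q F V), ∀ f : PhaseFun EQ F V, ∃ g : Fin n → PhaseFun EQ F V,
      ∀ᶠ z in 𝓝 z₀, Osculates (∑ i, g i z • ξ i) f z := by
  obtain ⟨n, ξ, h⟩ := exists_local_expansion z₀
  refine ⟨n, ξ, fun f => ?_⟩
  obtain ⟨g, hg⟩ := h f
  refine ⟨g, hg.mono fun z hz D hD => ?_⟩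
  rw [hz D hD, map_sum, map_sum]
  simp only [map_smul, smul_eq_mul]

theorem exists_osculates (f : PhaseFun EQ F V) (z : PhaseSpace EQ F V) :
    ∃ ξ : Gen EQ Q F V, Osculates ξ f z := by
  obtain ⟨n, ξ, h⟩ := exists_local_osculates z
  obtain ⟨g, hg⟩ := h f
  exact ⟨_, hg.self_of_nhds⟩

variable {Ψ : LiePoissonStructure EQ F V} {nabla : CovariantDerivative 𝓘(ℝ, EQ) F V}
  {B : ∀ q : Q, TangentSpace 𝓘(ℝ, EQ) q →L[ℝ] TangentSpace 𝓘(ℝ, EQ) q →L[ℝ] DualFib V q}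

theorem Osculates.genBracket_eq_left (h : IsCompatiblePair Ψ nabla B) {ξ ξ' : Gen EQ Q F V}
    {f : PhaseFun EQ F V} {z : PhaseSpace EQ F V} (h₁ : Osculates ξ f z) (h₂ : Osculates ξ' f z)
    (ζ : Gen EQ Q F V) : gen (genBracket h ξ ζ) z = gen (genBracket h ξ' ζ) z := by
  have := gen_genBracket_eq_zero h (ξ := ξ - ξ') (z := z)
    (fun D hD => by rw [map_sub, map_sub, ← h₁ D hD, ← h₂ D hD, sub_self]) ζ
  rw [map_sub, LinearMap.sub_apply, map_sub] at this
  exact sub_eq_zero.1 this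

theorem Osculates.genBracket_eq (h : IsCompatiblePair Ψ nabla B) {ξ ξ' ζ ζ' : Gen EQ Q F V}
    {f k : PhaseFun EQ F V} {z : PhaseSpace EQ F V} (h₁ : Osculates ξ f z) (h₂ : Osculates ξ' f z)
    (h₃ : Osculates ζ k z) (h₄ : Osculates ζ' k z) :
    gen (genBracket h ξ ζ) z = gen (genBracket h ξ' ζ') z := by
  rw [h₁.genBracket_eq_left h h₂, genBracket_swap h ξ' ζ, genBracket_swap h ξ' ζ', map_neg, map_neg]
  exact congrArg Neg.neg (h₃.genBracket_eq_left h h₄ ξ')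

/-- The value of the bracket of two functions at a point of the phase space. -/
def bracketVal (h : IsCompatiblePair Ψ nabla B) (f k : PhaseFun EQ F V) (z : PhaseSpace EQ F V) :
    ℝ :=
  gen (genBracket h (exists_osculates f z).choose (exists_osculates k z).choose) z

theorem bracketVal_eq (h : IsCompatiblePair Ψ nabla B) {ξ ζ : Gen EQ Q F V}
    {f k : PhaseFun EQ F V} {z : PhaseSpace EQ F V} (h₁ : Osculates ξ f z) (h₂ : Osculates ζ k z) :
    bracketVal h f k z = gen (genBracket h ξ ζ) z := by
  rw [bracketVal]
  exact Osculates.genBracket_eq h (exists_osculates f z).choose_spec h₁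
    (exists_osculates k z).choose_spec h₂

/-- Near a point the value is a sum of smooth coefficients of `f` and `k` times brackets of fixed
generating triples. At each `z` the coefficients are numbers, so bilinearity over the reals
suffices. -/
theorem contMDiff_bracketVal (h : IsCompatiblePair Ψ nabla B) (f k : PhaseFun EQ F V) :
    ContMDiff (phaseModel EQ F) 𝓘(ℝ, ℝ) ∞ (bracketVal h f k) := by
  intro z₀
  obtain ⟨n, ξ, hξ⟩ := exists_local_osculates z₀
  obtain ⟨a, ha⟩ := hξ f
  obtain ⟨b, hb⟩ := hξ k
  refine ((∑ i, ∑ j, a i * b j * gen (genBracket h (ξ i) (ξ j)) :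
    PhaseFun EQ F V).contMDiff z₀).congr_of_eventuallyEq ?_
  filter_upwards [ha, hb] with z haz hbz
  have e := bilinear_sum_smul (genBracket h) Finset.univ (fun i => a i z) (fun i => b i z) ξ
  rw [bracketVal_eq h haz hbz, e, map_sum, phaseFun_sum_apply, phaseFun_sum_apply]
  refine Finset.sum_congr rfl fun i _ => ?_
  rw [map_sum, phaseFun_sum_apply, phaseFun_sum_apply]
  refine Finset.sum_congr rfl fun j _ => ?_
  rw [map_smul]
  rfl

attribute [irreducible] bracketVal

/-- The bracket of two functions on the phase space. -/
def bracketFun (h : IsCompatiblePair Ψ nabla B) (f k : PhaseFun EQ F V) : PhaseFun EQ F V :=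
  ⟨bracketVal h f k, contMDiff_bracketVal h f k⟩

theorem bracketFun_apply (h : IsCompatiblePair Ψ nabla B) {ξ ζ : Gen EQ Q F V}
    {f k : PhaseFun EQ F V} {z : PhaseSpace EQ F V} (h₁ : Osculates ξ f z) (h₂ : Osculates ζ k z) :
    bracketFun h f k z = gen (genBracket h ξ ζ) z :=
  (rfl : bracketFun h f k z = bracketVal h f k z).trans (bracketVal_eq h h₁ h₂)

theorem bracketFun_gen (h : IsCompatiblePair Ψ nabla B) (ξ ζ : Gen EQ Q F V) :
    bracketFun h (gen ξ) (gen ζ) = gen (genBracket h ξ ζ) := by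
  ext z
  exact bracketFun_apply h (osculates_gen ξ z) (osculates_gen ζ z)

/-- The bracket on the phase space as a bilinear map. -/
def bracketLin (h : IsCompatiblePair Ψ nabla B) :
    PhaseFun EQ F V →ₗ[ℝ] PhaseFun EQ F V →ₗ[ℝ] PhaseFun EQ F V :=
  LinearMap.mk₂ ℝ (bracketFun h)
    (fun f f' k => by
      ext z
      obtain ⟨ξ, hξ⟩ := exists_osculates f z
      obtain ⟨ξ', hξ'⟩ := exists_osculates f' z
      obtain ⟨ζ, hζ⟩ := exists_osculates k z
      change _ = bracketFun h f k z + bracketFun h f' k z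
      rw [bracketFun_apply h (hξ.add hξ') hζ, bracketFun_apply h hξ hζ, bracketFun_apply h hξ' hζ,
        map_add, LinearMap.add_apply, map_add]
      rfl)
    (fun c f k => by
      ext z
      obtain ⟨ξ, hξ⟩ := exists_osculates f z
      obtain ⟨ζ, hζ⟩ := exists_osculates k z
      change _ = c * bracketFun h f k z
      rw [bracketFun_apply h (hξ.smul c) hζ, bracketFun_apply h hξ hζ, map_smul,
        LinearMap.smul_apply, map_smul]
      rfl)
    (fun f k k' => by
      ext z
      obtain ⟨ξ, hξ⟩ := exists_osculates f z
      obtain ⟨ζ, hζ⟩ := exists_osculates k z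
      obtain ⟨ζ', hζ'⟩ := exists_osculates k' z
      change _ = bracketFun h f k z + bracketFun h f k' z
      rw [bracketFun_apply h hξ (hζ.add hζ'), bracketFun_apply h hξ hζ, bracketFun_apply h hξ hζ',
        map_add, map_add]
      rfl)
    (fun c f k => by
      ext z
      obtain ⟨ξ, hξ⟩ := exists_osculates f z
      obtain ⟨ζ, hζ⟩ := exists_osculates k z
      change _ = c * bracketFun h f k z
      rw [bracketFun_apply h hξ (hζ.smul c), bracketFun_apply h hξ hζ, map_smul, map_smul]
      rfl)

theorem bracketLin_self (h : IsCompatiblePair Ψ nabla B) (f : PhaseFun EQ F V) :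
    bracketLin h f f = 0 := by
  ext z
  obtain ⟨ξ, hξ⟩ := exists_osculates f z
  refine (bracketFun_apply h hξ hξ).trans ?_
  rw [genBracket_self, map_zero]

theorem bracketLin_mul (h : IsCompatiblePair Ψ nabla B) (f k k' : PhaseFun EQ F V) :
    bracketLin h f (k * k') = bracketLin h f k * k' + k * bracketLin h f k' := by
  ext z
  obtain ⟨ξ, hξ⟩ := exists_osculates f z
  obtain ⟨ζ, hζ⟩ := exists_osculates k z
  obtain ⟨ζ', hζ'⟩ := exists_osculates k' z
  change bracketFun h f (k * k') z = bracketFun h f k z * k' z + k z * bracketFun h f k' z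
  rw [bracketFun_apply h hξ (hζ.mul hζ'), bracketFun_apply h hξ hζ, bracketFun_apply h hξ hζ']
  simp only [map_add, map_smul]
  change k' z * _ + k z * _ = _
  ring

/-- Followed by evaluation at a point, `T` is a derivation there, and such a derivation is
determined by its values on generating functions. -/
theorem derivation_eq_zero {T : PhaseFun EQ F V →ₗ[ℝ] PhaseFun EQ F V}
    (hT : ∀ f h, T (f * h) = T f * h + f * T h) (hg : ∀ ξ, T (gen ξ) = 0) (f : PhaseFun EQ F V) :
    T f = 0 := by
  ext z
  let e : PhaseFun EQ F V →ₗ[ℝ] ℝ :=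
    { toFun := fun f => f z
      map_add' := fun _ _ => rfl
      map_smul' := fun _ _ => rfl }
  refine IsDerivationAt.eq_zero (z := z) (D := e ∘ₗ T) (fun f h => ?_) (fun ξ => ?_) f
  · rw [LinearMap.comp_apply, hT]
    rfl
  · rw [LinearMap.comp_apply, hg, map_zero]

/-- The Jacobi sum is a derivation in its first argument and cyclically symmetric, so its three
arguments are reduced to generating functions one after another. -/
theorem jacobi_of_gen {br : PhaseFun EQ F V →ₗ[ℝ] PhaseFun EQ F V →ₗ[ℝ] PhaseFun EQ F V}
    (hs : ∀ f, br f f = 0) (hl : ∀ f h k, br f (h * k) = br f h * k + h * br f k)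
    (hj : ∀ ξ ξ' ξ'' : Gen EQ Q F V, br (gen ξ) (br (gen ξ') (gen ξ''))
      + br (gen ξ') (br (gen ξ'') (gen ξ)) + br (gen ξ'') (br (gen ξ) (gen ξ')) = 0)
    (f h k : PhaseFun EQ F V) : br f (br h k) + br h (br k f) + br k (br f h) = 0 := by
  have key : ∀ h k : PhaseFun EQ F V,
      (∀ ξ, br (gen ξ) (br h k) + br h (br k (gen ξ)) + br k (br (gen ξ) h) = 0) →
      ∀ f, br f (br h k) + br h (br k f) + br k (br f h) = 0 := fun h k hg f =>
    derivation_eq_zero (T := jacobiSum br h k) (fun f f' => jacobiSum_mul hs hl f f' h k) hg f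
  refine key h k (fun ξ => ?_) f
  rw [← key k (gen ξ) (fun ξ' => ?_) h]
  · abel
  · rw [← key (gen ξ) (gen ξ') (fun ξ'' => hj ξ'' ξ ξ') k]
    abel

/-- The gauge Poisson structure of a compatible pair. -/
def gaugePoisson (h : IsCompatiblePair Ψ nabla B) :
    PoissonStructure (phaseModel EQ F) (PhaseSpace EQ F V) where
  br := bracketLin h
  skew := bracketLin_self h
  leibniz := bracketLin_mul h
  jacobi := jacobi_of_gen (bracketLin_self h) (bracketLin_mul h) fun ξ ξ' ξ'' => by
    change bracketFun h _ (bracketFun h _ _) + bracketFun h _ (bracketFun h _ _)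
      + bracketFun h _ (bracketFun h _ _) = 0
    simp only [bracketFun_gen]
    rw [← map_add, ← map_add, genBracket_jacobi, map_zero]

theorem gaugePoisson_gen (h : IsCompatiblePair Ψ nabla B) (ξ ζ : Gen EQ Q F V) :
    (gaugePoisson h).br (gen ξ) (gen ζ) = gen (genBracket h ξ ζ) := bracketFun_gen h ξ ζ

theorem gen_fst (f : C^∞⟮𝓘(ℝ, EQ), Q; 𝓘(ℝ, ℝ), ℝ⟯) :
    gen ((f, 0, 0) : Gen EQ Q F V) = baseFun f := by
  ext z
  change f z.1.1 + z.1.2 0 + 0 = f z.1.1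
  rw [map_zero, add_zero, add_zero]

theorem gen_mom (v : VectorFields EQ Q) : gen ((0, v, 0) : Gen EQ Q F V) = momFun v := by
  ext z
  change 0 + z.1.2 (v z.1.1) + 0 = z.1.2 (v z.1.1)
  rw [add_zero, zero_add]

theorem gen_lin (η : DualSections EQ F V) : gen ((0, 0, η) : Gen EQ Q F V) = linFun η := by
  ext z
  change 0 + z.1.2 0 + η z.1.1 z.2 = η z.1.1 z.2
  rw [map_zero, add_zero, zero_add]

theorem gaugePoisson_eq (h : IsCompatiblePair Ψ nabla B) {ξ ζ ϑ : Gen EQ Q F V}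
    {f k g : PhaseFun EQ F V} (hf : gen ξ = f) (hk : gen ζ = k) (hb : genBracket h ξ ζ = ϑ)
    (hg : gen ϑ = g) : (gaugePoisson h).br f k = g := by
  rw [← hf, ← hk, ← hg, ← hb]
  exact gaugePoisson_gen h ξ ζ

theorem isGaugePoisson_gaugePoisson (h : IsCompatiblePair Ψ nabla B) :
    IsGaugePoisson Ψ nabla B (gaugePoisson h) where
  base_base f k :=
    gaugePoisson_eq h (gen_fst f) (gen_fst k) (tripleBracket_fst_fst _ _ _ _ _ f k) (map_zero gen)
  mom_base v f q p y :=
    congrArg (fun f : PhaseFun EQ F V => f (phasePt q p y)) (gaugePoisson_eq h (gen_mom v)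
      (gen_fst f) (tripleBracket_mid_fst _ _ _ _ _ v f) (gen_fst _))
  base_lin f η :=
    gaugePoisson_eq h (gen_fst f) (gen_lin η) (tripleBracket_fst_last _ _ _ _ _ f η) (map_zero gen)
  mom_lin v η q p y :=
    congrArg (fun f : PhaseFun EQ F V => f (phasePt q p y)) (gaugePoisson_eq h (gen_mom v)
      (gen_lin η) (tripleBracket_mid_last _ _ _ _ _ v η) (gen_lin _))
  mom_mom v w q p y := by
    refine (congrArg (fun f : PhaseFun EQ F V => f (phasePt q p y)) (gaugePoisson_eq h (gen_mom v)
      (gen_mom w) (tripleBracket_mid_mid _ _ _ _ _ v w) rfl)).trans ?_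
    change 0 + p (mlieBracket 𝓘(ℝ, EQ) v w q) + B q (v q) (w q) y = _
    rw [zero_add]
  lin_lin η θ q p y :=
    congrArg (fun f : PhaseFun EQ F V => f (phasePt q p y)) (gaugePoisson_eq h (gen_lin η)
      (gen_lin θ) (tripleBracket_last_last _ _ _ _ _ η θ) (gen_lin _))

theorem PoissonStructure.ext_of_gen {Pi Pi' : PoissonStructure (phaseModel EQ F) (PhaseSpace EQ F V)}
    (hg : ∀ ξ ξ' : Gen EQ Q F V, Pi.br (gen ξ) (gen ξ') = Pi'.br (gen ξ) (gen ξ')) : Pi = Pi' := by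
  have hbr : Pi.br = Pi'.br := ext_biderivation (g := gen)
    (fun T hT hT0 => LinearMap.ext (derivation_eq_zero hT hT0)) Pi.skew Pi'.skew Pi.leibniz
    Pi'.leibniz hg
  cases Pi
  cases Pi'
  congr

/-- Six of the nine types of brackets are prescribed; the other three follow by skewness. -/
theorem IsGaugePoisson.br_gen {Pi Pi' : PoissonStructure (phaseModel EQ F) (PhaseSpace EQ F V)}
    (h : IsGaugePoisson Ψ nabla B Pi) (h' : IsGaugePoisson Ψ nabla B Pi') (ξ ξ' : Gen EQ Q F V) :
    Pi.br (gen ξ) (gen ξ') = Pi'.br (gen ξ) (gen ξ') := by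
  have mb : ∀ (v : VectorFields EQ Q) f,
      Pi.br (momFun v) (baseFun f) = Pi'.br (momFun v) (baseFun f) := fun v f => by
    ext z
    exact (h.mom_base v f z.1.1 z.1.2 z.2).trans (h'.mom_base v f z.1.1 z.1.2 z.2).symm
  have ml : ∀ (v : VectorFields EQ Q) η,
      Pi.br (momFun v) (linFun η) = Pi'.br (momFun v) (linFun η) := fun v η => by
    ext z
    exact (h.mom_lin v η z.1.1 z.1.2 z.2).trans (h'.mom_lin v η z.1.1 z.1.2 z.2).symm
  have mm : ∀ v w : VectorFields EQ Q,
      Pi.br (momFun v) (momFun w) = Pi'.br (momFun v) (momFun w) := fun v w => by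
    ext z
    exact (h.mom_mom v w z.1.1 z.1.2 z.2).trans (h'.mom_mom v w z.1.1 z.1.2 z.2).symm
  have ll : ∀ η θ : DualSections EQ F V,
      Pi.br (linFun η) (linFun θ) = Pi'.br (linFun η) (linFun θ) := fun η θ => by
    ext z
    exact (h.lin_lin η θ z.1.1 z.1.2 z.2).trans (h'.lin_lin η θ z.1.1 z.1.2 z.2).symm
  simp only [gen_eq, map_add, LinearMap.add_apply, h.base_base, h'.base_base, h.base_lin,
    h'.base_lin, mb, ml, mm, ll, skew_of_self Pi.skew (baseFun _) (momFun _),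
    skew_of_self Pi'.skew (baseFun _) (momFun _), skew_of_self Pi.skew (linFun _) (momFun _),
    skew_of_self Pi'.skew (linFun _) (momFun _), skew_of_self Pi.skew (linFun _) (baseFun _),
    skew_of_self Pi'.skew (linFun _) (baseFun _)]

theorem IsGaugePoisson.unique {Pi Pi' : PoissonStructure (phaseModel EQ F) (PhaseSpace EQ F V)}
    (h : IsGaugePoisson Ψ nabla B Pi) (h' : IsGaugePoisson Ψ nabla B Pi') : Pi = Pi' :=
  PoissonStructure.ext_of_gen (h.br_gen h')

end PoissonConstruction

end Wong

namespace Wong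

/-! ### Transport of Poisson structures by diffeomorphisms. -/

section Transport

variable {E H : Type*} [NormedAddCommGroup E] [NormedSpace ℝ E] [TopologicalSpace H]
  {I : ModelWithCorners ℝ E H} {M : Type*} [TopologicalSpace M] [ChartedSpace H M]

/-- Composition with a smooth map, as a linear map of functions. -/
def compLin (φ : C^∞⟮I, M; I, M⟯) : C^∞⟮I, M; 𝓘(ℝ, ℝ), ℝ⟯ →ₗ[ℝ] C^∞⟮I, M; 𝓘(ℝ, ℝ), ℝ⟯ where
  toFun f := f.comp φ
  map_add' _ _ := rfl
  map_smul' _ _ := rfl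

theorem compLin_mul (φ : C^∞⟮I, M; I, M⟯) (f h : C^∞⟮I, M; 𝓘(ℝ, ℝ), ℝ⟯) :
    compLin φ (f * h) = compLin φ f * compLin φ h := rfl

/-- The Poisson structure transported by a diffeomorphism `φ` with inverse `χ`. -/
def PoissonStructure.transport (Pi : PoissonStructure I M) (φ χ : C^∞⟮I, M; I, M⟯)
    (h : ∀ x, φ (χ x) = x) (h' : ∀ x, χ (φ x) = x) : PoissonStructure I M where
  br := (Pi.br.compl₁₂ (compLin φ) (compLin φ)).compr₂ (compLin χ)
  skew f := by
    rw [LinearMap.compr₂_apply, LinearMap.compl₁₂_apply, Pi.skew, map_zero]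
  leibniz f k l := by
    have e : ∀ f, compLin χ (compLin φ f) = f := fun f => by
      ext x
      exact congrArg f (h x)
    simp only [LinearMap.compr₂_apply, LinearMap.compl₁₂_apply]
    rw [compLin_mul, Pi.leibniz, map_add, compLin_mul, compLin_mul, e, e]
  jacobi f k l := by
    have e : ∀ f, compLin φ (compLin χ f) = f := fun f => by
      ext x
      exact congrArg f (h' x)
    simp only [LinearMap.compr₂_apply, LinearMap.compl₁₂_apply, e]
    rw [← map_add, ← map_add, Pi.jacobi, map_zero]

theorem PoissonStructure.transport_apply (Pi : PoissonStructure I M) (φ χ : C^∞⟮I, M; I, M⟯)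
    (h : ∀ x, φ (χ x) = x) (h' : ∀ x, χ (φ x) = x) (f k : C^∞⟮I, M; 𝓘(ℝ, ℝ), ℝ⟯) (x : M) :
    (Pi.transport φ χ h h').br f k x = Pi.br (f.comp φ) (k.comp φ) (χ x) := rfl

theorem PoissonStructure.transport_eq (Pi : PoissonStructure I M) {φ χ : C^∞⟮I, M; I, M⟯}
    (h : ∀ x, φ (χ x) = x) (h' : ∀ x, χ (φ x) = x) {f k f' k' : C^∞⟮I, M; 𝓘(ℝ, ℝ), ℝ⟯}
    (hf : f.comp φ = f') (hk : k.comp φ = k') {x y : M} (hy : χ x = y) :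
    (Pi.transport φ χ h h').br f k x = Pi.br f' k' y := by
  rw [transport_apply, hf, hk, hy]

end Transport

/-! ### Invariance of the gauge Poisson structure. -/

section Invariance

variable {EQ : Type*} [NormedAddCommGroup EQ] [NormedSpace ℝ EQ] [FiniteDimensional ℝ EQ]
  {Q : Type*} [TopologicalSpace Q] [ChartedSpace EQ Q] [IsManifold 𝓘(ℝ, EQ) ∞ Q] [T2Space Q]
  {F : Type*} [NormedAddCommGroup F] [NormedSpace ℝ F] [FiniteDimensional ℝ F]
  {V : Q → Type*} [TopologicalSpace (TotalSpace F V)]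
  [∀ q, AddCommGroup (V q)] [∀ q, Module ℝ (V q)] [∀ q, TopologicalSpace (V q)]
  [∀ q, IsTopologicalAddGroup (V q)] [∀ q, ContinuousSMul ℝ (V q)]
  [FiberBundle F V] [VectorBundle ℝ F V] [ContMDiffVectorBundle ∞ F V 𝓘(ℝ, EQ)]
  {Ψ : LiePoissonStructure EQ F V} {nabla : CovariantDerivative 𝓘(ℝ, EQ) F V}
  {B : ∀ q : Q, TangentSpace 𝓘(ℝ, EQ) q →L[ℝ] TangentSpace 𝓘(ℝ, EQ) q →L[ℝ] DualFib V q}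
  {G : Type*} [Group G] {Φ : G → ∀ q, V q →L[ℝ] V q}
  {Φbar : G → C^∞⟮phaseModel EQ F, PhaseSpace EQ F V; phaseModel EQ F, PhaseSpace EQ F V⟯}

theorem IsLiftedAction.apply (hbar : IsLiftedAction Φ Φbar) (g : G) (z : PhaseSpace EQ F V) :
    Φbar g z = phasePt z.1.1 z.1.2 (Φ g z.1.1 z.2) := hbar g z.1.1 z.1.2 z.2

/-- The pull-back of a section of the dual bundle by the action. -/
def pullSec (hsm : ∀ g (ζ : Cₛ^∞⟮𝓘(ℝ, EQ); F, V⟯), SmoothSec EQ F fun q => Φ g q (ζ q)) (g : G)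
    (η : DualSections EQ F V) : DualSections EQ F V :=
  ⟨fun q => η q ∘L Φ g q, smoothSec_hom_trivial fun ζ =>
    SmoothSec.pair (σ := fun q => Φ g q (ζ q)) η.contMDiff (hsm g ζ)⟩

/-- The transpose of the invariance of `∇`: the dual connection commutes with pull-back of sections.
-/
theorem IsInvariantPair.dualCov_pullSec (hinv : IsInvariantPair Φ nabla B)
    (hsm : ∀ g (ζ : Cₛ^∞⟮𝓘(ℝ, EQ); F, V⟯), SmoothSec EQ F fun q => Φ g q (ζ q)) (g : G)
    (η : DualSections EQ F V) (q : Q) (v : TangentSpace 𝓘(ℝ, EQ) q) (y : V q) :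
    dualCov nabla (pullSec hsm g η) q v y = dualCov nabla η q v (Φ g q y) := by
  obtain ⟨ζ, rfl⟩ := exists_section_eq EQ F y
  rw [dualCov_section (nabla := nabla) v (pullSec hsm g η).mdifferentiableAt ζ]
  let ζ' : Cₛ^∞⟮𝓘(ℝ, EQ); F, V⟯ := ⟨_, hsm g ζ⟩
  have h := dualCov_section (nabla := nabla) v η.mdifferentiableAt ζ'
  refine Eq.trans ?_ h.symm
  have h1 : nabla ζ' q v = Φ g q (nabla ζ q v) := hinv.connection g ζ q v
  rw [h1]
  rfl

theorem IsLiftedAction.comp_linFun (hbar : IsLiftedAction Φ Φbar)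
    (hsm : ∀ g (ζ : Cₛ^∞⟮𝓘(ℝ, EQ); F, V⟯), SmoothSec EQ F fun q => Φ g q (ζ q)) (g : G)
    (η : DualSections EQ F V) : (linFun η).comp (Φbar g) = linFun (pullSec hsm g η) := by
  ext z
  exact congrArg (linFun η) (hbar.apply g z)

theorem IsLiftedAction.comp_momFun (hbar : IsLiftedAction Φ Φbar) (g : G)
    (v : VectorFields EQ Q) : (momFun v : PhaseFun EQ F V).comp (Φbar g) = momFun v := by
  ext z
  change momFun v (Φbar g z) = _
  rw [hbar.apply]
  rfl

theorem IsLiftedAction.comp_baseFun (hbar : IsLiftedAction Φ Φbar) (g : G)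
    (f : C^∞⟮𝓘(ℝ, EQ), Q; 𝓘(ℝ, ℝ), ℝ⟯) :
    (baseFun f : PhaseFun EQ F V).comp (Φbar g) = baseFun f := by
  ext z
  change baseFun f (Φbar g z) = _
  rw [hbar.apply]
  rfl

/-- The gauge Poisson structure of an invariant pair is invariant. -/
theorem IsGaugePoisson.invariant {Pi : PoissonStructure (phaseModel EQ F) (PhaseSpace EQ F V)}
    (h : IsGaugePoisson Ψ nabla B Pi) (hinv : IsInvariantPair Φ nabla B)
    (hsm : ∀ g (ζ : Cₛ^∞⟮𝓘(ℝ, EQ); F, V⟯), SmoothSec EQ F fun q => Φ g q (ζ q))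
    (hbar : IsLiftedAction Φ Φbar) (hmul : ∀ g q y, Φ g⁻¹ q (Φ g q y) = y)
    (hΨ : ∀ g q η θ, Ψ.Psi q (η ∘L Φ g q) (θ ∘L Φ g q) = Ψ.Psi q η θ ∘L Φ g q) (g : G)
    (f k : PhaseFun EQ F V) :
    Pi.br (f.comp (Φbar g)) (k.comp (Φbar g)) = (Pi.br f k).comp (Φbar g) := by
  have hmul' : ∀ q y, Φ g q (Φ g⁻¹ q y) = y := fun q y => by
    have := hmul g⁻¹ q y
    rwa [inv_inv] at this
  have e1 : ∀ z, Φbar g (Φbar g⁻¹ z) = z := fun z => by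
    rw [hbar.apply g⁻¹, hbar]
    exact congrArg (phasePt z.1.1 z.1.2) (hmul' z.1.1 z.2)
  have e2 : ∀ z, Φbar g⁻¹ (Φbar g z) = z := fun z => by
    rw [hbar.apply g, hbar]
    exact congrArg (phasePt z.1.1 z.1.2) (hmul g z.1.1 z.2)
  -- The transported structure obeys the same defining relations, because the connection, the form
  -- and the fibrewise bracket are invariant; uniqueness then identifies the two.
  have hT : IsGaugePoisson Ψ nabla B (Pi.transport (Φbar g) (Φbar g⁻¹) e1 e2) :=
    { base_base := fun f k => by
        ext z
        refine (Pi.transport_eq e1 e2 (hbar.comp_baseFun g f) (hbar.comp_baseFun g k) rfl).trans ?_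
        rw [h.base_base]
        rfl
      mom_base := fun v f q p y =>
        (Pi.transport_eq e1 e2 (hbar.comp_momFun g v) (hbar.comp_baseFun g f)
          (hbar g⁻¹ q p y)).trans (h.mom_base v f q p _)
      base_lin := fun f η => by
        ext z
        refine (Pi.transport_eq e1 e2 (hbar.comp_baseFun g f) (hbar.comp_linFun hsm g η) rfl).trans ?_
        rw [h.base_lin]
        rfl
      mom_lin := fun v η q p y => by
        refine (Pi.transport_eq e1 e2 (hbar.comp_momFun g v) (hbar.comp_linFun hsm g η)
          (hbar g⁻¹ q p y)).trans ((h.mom_lin v (pullSec hsm g η) q p _).trans ?_)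
        rw [hinv.dualCov_pullSec, hmul']
      mom_mom := fun v w q p y => by
        refine (Pi.transport_eq e1 e2 (hbar.comp_momFun g v) (hbar.comp_momFun g w)
          (hbar g⁻¹ q p y)).trans ((h.mom_mom v w q p _).trans ?_)
        rw [hinv.form]
      lin_lin := fun η θ q p y => by
        refine (Pi.transport_eq e1 e2 (hbar.comp_linFun hsm g η) (hbar.comp_linFun hsm g θ)
          (hbar g⁻¹ q p y)).trans
            ((h.lin_lin (pullSec hsm g η) (pullSec hsm g θ) q p _).trans ?_)
        refine (congrArg (fun L => L (Φ g⁻¹ q y)) (hΨ g q (η q) (θ q))).trans ?_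
        exact congrArg _ (hmul' q y) }
  have e := hT.unique h
  ext z
  have e3 := congrArg (fun P => P.br f k (Φbar g z)) e
  simp only [PoissonStructure.transport_apply, e2] at e3
  exact e3

end Invariance

/-! ### The kinetic Hamiltonian and its flow. -/

section Kinetic

/-- `ContinuousLinearMap.inverse` has default value zero off the equivalences. In finite dimension
nondegeneracy provides an equivalence, so the inverse metric is the true one. -/
theorem exists_equiv_of_nondegenerate {X : Type*} [NormedAddCommGroup X] [NormedSpace ℝ X]
    [FiniteDimensional ℝ X] {A : X →L[ℝ] X →L[ℝ] ℝ} (hA : ∀ v, (∀ w, A v w = 0) → v = 0) :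
    ∃ e : X ≃L[ℝ] (X →L[ℝ] ℝ), (e : X →L[ℝ] X →L[ℝ] ℝ) = A := by
  have hinj : Function.Injective (A : X →ₗ[ℝ] X →L[ℝ] ℝ) :=
    (injective_iff_map_eq_zero _).2 fun v hv => hA v fun w => congrArg (fun L => L w) hv
  have hd : Module.finrank ℝ X = Module.finrank ℝ (X →L[ℝ] ℝ) :=
    (Subspace.dual_finrank_eq (K := ℝ) (V := X)).symm.trans
      (LinearMap.toContinuousLinearMap (𝕜 := ℝ) (E := X) (F' := ℝ)).finrank_eq
  refine ⟨(LinearMap.linearEquivOfInjective _ hinj hd).toContinuousLinearEquiv, ?_⟩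
  ext v w
  rfl

/-- The inverse quadratic form does not depend on the frame, so the Hamiltonian may be computed in a
trivialization fixed near a given point. -/
theorem apply_inverse_eq_of_nondegenerate {X : Type*} [NormedAddCommGroup X] [NormedSpace ℝ X]
    [FiniteDimensional ℝ X] {A A' : X →L[ℝ] X →L[ℝ] ℝ} (hA : ∀ v, (∀ w, A v w = 0) → v = 0)
    (S : X ≃L[ℝ] X) (hA' : ∀ v w, A' v w = A (S v) (S w)) {p p' : X →L[ℝ] ℝ}
    (hp : ∀ v, p' v = p (S v)) : p (A.inverse p) = p' (A'.inverse p') := by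
  have hn : ∀ v, (∀ w, A' v w = 0) → v = 0 := fun v hv => by
    refine S.injective ((hA (S v) fun w => ?_).trans (map_zero S).symm)
    rw [← S.apply_symm_apply w, ← hA', hv]
  obtain ⟨e, rfl⟩ := exists_equiv_of_nondegenerate hA
  obtain ⟨e', rfl⟩ := exists_equiv_of_nondegenerate hn
  rw [ContinuousLinearMap.inverse_equiv, ContinuousLinearMap.inverse_equiv]
  have h : e.symm p = S (e'.symm p') := by
    rw [ContinuousLinearEquiv.symm_apply_eq]
    ext w
    have h1 := hA' (e'.symm p') (S.symm w)
    simp only [ContinuousLinearEquiv.coe_coe, ContinuousLinearEquiv.apply_symm_apply, hp] at h1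
    exact h1
  rw [ContinuousLinearEquiv.coe_coe, ContinuousLinearEquiv.coe_coe, h, hp]

variable {EQ : Type*} [NormedAddCommGroup EQ] [NormedSpace ℝ EQ] [FiniteDimensional ℝ EQ]
  {Q : Type*} [TopologicalSpace Q] [ChartedSpace EQ Q] [IsManifold 𝓘(ℝ, EQ) ∞ Q] [T2Space Q]
  {F : Type*} [NormedAddCommGroup F] [NormedSpace ℝ F] [FiniteDimensional ℝ F]
  {V : Q → Type*} [TopologicalSpace (TotalSpace F V)]
  [∀ q, AddCommGroup (V q)] [∀ q, Module ℝ (V q)] [∀ q, TopologicalSpace (V q)]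
  [∀ q, IsTopologicalAddGroup (V q)] [∀ q, ContinuousSMul ℝ (V q)]
  [FiberBundle F V] [VectorBundle ℝ F V] [ContMDiffVectorBundle ∞ F V 𝓘(ℝ, EQ)]

/-- In the trivialization at `q₀` the metric and the covector become smooth maps to fixed spaces,
and inversion is smooth at an invertible operator. -/
theorem contMDiff_kinetic (met : PseudoMetric EQ Q) :
    ContMDiff (phaseModel EQ F) 𝓘(ℝ, ℝ) ∞ (kinetic met : PhaseSpace EQ F V → ℝ) := by
  intro z₀
  set q₀ := z₀.1.1
  let T := trivializationAt EQ (TangentSpace 𝓘(ℝ, EQ) : Q → Type _) q₀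
  let α : PhaseSpace EQ F V → (EQ →L[ℝ] ℝ) := fun z =>
    (trivializationAt (EQ →L[ℝ] ℝ) (fun q : Q => TangentSpace 𝓘(ℝ, EQ) q →L[ℝ] ℝ) q₀ z.1).2
  let A : Q → (EQ →L[ℝ] EQ →L[ℝ] ℝ) := fun q => (trivializationAt (EQ →L[ℝ] EQ →L[ℝ] ℝ)
    (fun q : Q => TangentSpace 𝓘(ℝ, EQ) q →L[ℝ] TangentSpace 𝓘(ℝ, EQ) q →L[ℝ] ℝ) q₀
    ⟨q, met.inner q⟩).2
  have hproj : ContMDiff (phaseModel EQ F) 𝓘(ℝ, EQ) ∞ fun z : PhaseSpace EQ F V => z.1.1 :=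
    (contMDiff_proj _).comp (contMDiff_proj _)
  have hα : ContMDiffAt (phaseModel EQ F) 𝓘(ℝ, EQ →L[ℝ] ℝ) ∞ α z₀ :=
    (contMDiffAt_totalSpace.1 ((contMDiff_proj (IB := 𝓘(ℝ, EQ).prod 𝓘(ℝ, EQ →L[ℝ] ℝ))
      (F := F) (n := ∞) ((cotProj EQ Q) *ᵖ V)) z₀)).2
  have hA : ContMDiffAt (phaseModel EQ F) 𝓘(ℝ, EQ →L[ℝ] EQ →L[ℝ] ℝ) ∞
      (fun z : PhaseSpace EQ F V => A z.1.1) z₀ :=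
    ContMDiffAt.comp z₀ (g := A) (contMDiffAt_totalSpace.1 (met.contMDiff q₀)).2 (hproj z₀)
  have hα' : ∀ z : PhaseSpace EQ F V, z.1.1 ∈ T.baseSet → ∀ c, α z c = z.1.2 (T.symmL ℝ z.1.1 c) := by
    intro z hz c
    simp only [α]
    rw [hom_trivializationAt_apply]
    simp [ContinuousLinearMap.inCoordinates, T]
  have hA' : ∀ q ∈ T.baseSet, ∀ c d, A q c d = met.inner q (T.symmL ℝ q c) (T.symmL ℝ q d) := by
    intro q hq c d
    simp only [A]
    rw [hom_trivializationAt_apply]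
    simp only [ContinuousLinearMap.inCoordinates, ContinuousLinearMap.coe_comp, Function.comp_apply]
    rw [Trivialization.continuousLinearMapAt_apply, Trivialization.coe_linearMapAt_of_mem _
      (show q ∈ T.baseSet ∩ Set.univ from ⟨hq, Set.mem_univ q⟩)]
    dsimp only
    rw [hom_trivializationAt_apply]
    simp [ContinuousLinearMap.inCoordinates, T]
  have hkin : ∀ z : PhaseSpace EQ F V, z.1.1 ∈ T.baseSet →
      kinetic met z = (1 / 2) * α z ((A z.1.1).inverse (α z)) := by
    intro z hz
    let S : EQ ≃L[ℝ] EQ := (T.continuousLinearEquivAt ℝ z.1.1 hz).symm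
    have hS : ∀ c, S c = T.symmL ℝ z.1.1 c := fun c =>
      congrArg (fun L => L c) (T.symm_continuousLinearEquivAt_eq hz)
    refine congrArg (fun r : ℝ => (1 / 2) * r) ?_
    exact apply_inverse_eq_of_nondegenerate (X := EQ) (A := met.inner z.1.1) (A' := A z.1.1)
      (p := z.1.2) (p' := α z) (met.nondegenerate z.1.1) S
      (fun c d => by rw [hS, hS]; exact hA' _ hz c d) (fun c => by rw [hS]; exact hα' z hz c)
  have hz₀ : q₀ ∈ T.baseSet := FiberBundle.mem_baseSet_trivializationAt EQ _ q₀
  have hnd : ∀ v, (∀ w, A q₀ v w = 0) → v = 0 := by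
    intro v hv
    let S : EQ ≃L[ℝ] EQ := (T.continuousLinearEquivAt ℝ q₀ hz₀).symm
    have hS' : ∀ c, S c = T.symmL ℝ q₀ c := fun c =>
      congrArg (fun L => L c) (T.symm_continuousLinearEquivAt_eq hz₀)
    have hS : S v = 0 := met.nondegenerate q₀ (S v) fun w => by
      have := hA' q₀ hz₀ v (S.symm w)
      rw [hv, ← hS', ← hS'] at this
      refine Eq.trans ?_ this.symm
      exact congrArg (met.inner q₀ (S v)) (S.apply_symm_apply w).symm
    exact S.injective (hS.trans (map_zero S).symm)
  obtain ⟨e, he⟩ := exists_equiv_of_nondegenerate hnd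
  have hinv : ContMDiffAt (phaseModel EQ F) 𝓘(ℝ, (EQ →L[ℝ] ℝ) →L[ℝ] EQ) ∞
      (fun z : PhaseSpace EQ F V => (A z.1.1).inverse) z₀ := by
    have h1 : ContDiffAt ℝ ∞ ContinuousLinearMap.inverse (A z₀.1.1) := by
      have := contDiffAt_map_inverse (𝕜 := ℝ) (n := ∞) e
      rwa [he] at this
    exact h1.contMDiffAt.comp z₀ hA
  refine ContMDiffAt.congr_of_eventuallyEq (f := fun z => (1 / 2) * α z ((A z.1.1).inverse (α z)))
    ?_ ?_
  · exact contMDiffAt_const.mul (hα.clm_apply (hinv.clm_apply hα))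
  · filter_upwards [hproj.continuous.continuousAt.eventually (T.open_baseSet.mem_nhds hz₀)] with z hz
    exact hkin z hz

/-- The kinetic Hamiltonian as a smooth function. -/
def kineticFun (met : PseudoMetric EQ Q) : PhaseFun EQ F V := ⟨kinetic met, contMDiff_kinetic met⟩

variable {G : Type*} [Group G] {Φ : G → ∀ q, V q →L[ℝ] V q}
  {Φbar : G → C^∞⟮phaseModel EQ F, PhaseSpace EQ F V; phaseModel EQ F, PhaseSpace EQ F V⟯}

theorem IsLiftedAction.comp_kineticFun (hbar : IsLiftedAction Φ Φbar) (met : PseudoMetric EQ Q)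
    (g : G) : (kineticFun met : PhaseFun EQ F V).comp (Φbar g) = kineticFun met := by
  ext z
  change kineticFun met (Φbar g z) = _
  rw [hbar.apply]
  rfl

/-- The equation for `φ ∘ c` tested on `f` is the equation for `c` tested on `f ∘ φ`. -/
theorem IsHamiltonianCurve.comp {Pi : PoissonStructure (phaseModel EQ F) (PhaseSpace EQ F V)}
    {φ : C^∞⟮phaseModel EQ F, PhaseSpace EQ F V; phaseModel EQ F, PhaseSpace EQ F V⟯}
    (hφ : ∀ f k : PhaseFun EQ F V, Pi.br (f.comp φ) (k.comp φ) = (Pi.br f k).comp φ)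
    {H : PhaseFun EQ F V} (hH : H.comp φ = H) {J : Set ℝ} {c : ℝ → PhaseSpace EQ F V}
    (hc : IsHamiltonianCurve Pi H J c) : IsHamiltonianCurve Pi H J fun t => φ (c t) := by
  intro t ht f
  have h := hc t ht (f.comp φ)
  have e : Pi.br H (f.comp φ) (c t) = Pi.br H f (φ (c t)) := by
    conv_lhs => rw [← hH, hφ]
    rfl
  rw [← e]
  exact h

end Kinetic

end Wong

namespace Wong

/-! ### Existence of the averaged one-form for the group. -/

section AveragedForm

variable {EQ : Type*} [NormedAddCommGroup EQ] [NormedSpace ℝ EQ] [FiniteDimensional ℝ EQ]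
  {Q : Type*} [TopologicalSpace Q] [ChartedSpace EQ Q] [IsManifold 𝓘(ℝ, EQ) ∞ Q] [T2Space Q]
  {F : Type*} [NormedAddCommGroup F] [NormedSpace ℝ F] [FiniteDimensional ℝ F]
  {V : Q → Type*} [TopologicalSpace (TotalSpace F V)]
  [∀ q, AddCommGroup (V q)] [∀ q, Module ℝ (V q)] [∀ q, TopologicalSpace (V q)]
  [∀ q, IsTopologicalAddGroup (V q)] [∀ q, ContinuousSMul ℝ (V q)]
  [FiberBundle F V] [VectorBundle ℝ F V] [ContMDiffVectorBundle ∞ F V 𝓘(ℝ, EQ)]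
  {EG : Type*} [NormedAddCommGroup EG] [NormedSpace ℝ EG] [FiniteDimensional ℝ EG]
  {G : Type*} [Group G] [TopologicalSpace G] [ChartedSpace EG G] [MeasurableSpace G]
  {μ : Measure G} [IsProbabilityMeasure μ]

theorem exists_isAveragedForm (Ψ : LiePoissonStructure EQ F V)
    {nabla : CovariantDerivative 𝓘(ℝ, EQ) F V} (hn : nabla.ContMDiffCovariantDerivative ∞)
    (s : GroupLieAlgebra 𝓘(ℝ, EG) G →ₗ[ℝ] DualSections EQ F V)
    {log : G → GroupLieAlgebra 𝓘(ℝ, EG) G} (hlog : IsLogChoice μ log) :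
    ∃ A : ∀ q : Q, TangentSpace 𝓘(ℝ, EQ) q →L[ℝ] DualFib V q,
      IsSmoothOneForm F A ∧ IsAveragedForm Ψ nabla s μ log A := by
  let s' : EG →ₗ[ℝ] DualSections EQ F V := s
  obtain ⟨A, hA, hint, hform⟩ := exists_average (W := EG) (μ := μ) Ψ s' hn (l := log)
    hlog.measurable hlog.bounded
  have e : ∀ (a : GroupLieAlgebra 𝓘(ℝ, EG) G) q v (y : V q) (t : ℝ),
      adExp Ψ q t (s a q) (dualCov nabla (s a) q v) y = avgKernel Ψ nabla s' q v y ((a : EG), t) :=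
    fun a q v y t => avgKernel_eq Ψ nabla s' q v y a t
  refine ⟨A, hA, fun a q v t => (hasSum_adExp Ψ q _ _ t).summable, fun a q v y => ?_,
    fun q v y => ?_, fun q v y => ?_⟩
  · simp only [e]
    exact ((continuous_avgKernel Ψ s' hn q v y).comp (Continuous.prodMk_right (a : EG)))
      |>.intervalIntegrable 0 1
  · simp only [e]
    exact hint q v y
  · simp only [e]
    exact hform q v y

end AveragedForm

end Wong

end

theorem mainTheorem5
    -- the base manifold `Q`
    {EQ : Type*} [NormedAddCommGroup EQ] [NormedSpace ℝ EQ] [FiniteDimensional ℝ EQ]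
    {Q : Type*} [TopologicalSpace Q] [T2Space Q] [SecondCountableTopology Q]
    [ChartedSpace EQ Q] [IsManifold 𝓘(ℝ, EQ) ∞ Q]
    -- the Lie-Poisson bundle `V → Q`
    {F : Type*} [NormedAddCommGroup F] [NormedSpace ℝ F] [FiniteDimensional ℝ F]
    {V : Q → Type*} [TopologicalSpace (TotalSpace F V)]
    [∀ q, AddCommGroup (V q)] [∀ q, Module ℝ (V q)] [∀ q, TopologicalSpace (V q)]
    [∀ q, IsTopologicalAddGroup (V q)] [∀ q, ContinuousSMul ℝ (V q)]
    [FiberBundle F V] [VectorBundle ℝ F V] [ContMDiffVectorBundle ∞ F V 𝓘(ℝ, EQ)]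
    (Ψ : Wong.LiePoissonStructure EQ F V)
    -- the compact connected Lie group `G` with its normalized Haar measure
    {EG : Type*} [NormedAddCommGroup EG] [NormedSpace ℝ EG] [FiniteDimensional ℝ EG]
    {G : Type*} [Group G] [TopologicalSpace G] [ChartedSpace EG G] [LieGroup 𝓘(ℝ, EG) ∞ G]
    [CompactSpace G] [ConnectedSpace G] [T2Space G]
    [MeasurableSpace G] [BorelSpace G]
    (μ : Measure G) [μ.IsHaarMeasure] [IsProbabilityMeasure μ]
    -- the action of `G` on the total space of `V`
    [MulAction G (TotalSpace F V)]
    [ContMDiffSMul 𝓘(ℝ, EG) (𝓘(ℝ, EQ).prod 𝓘(ℝ, F)) ∞ G (TotalSpace F V)]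
    (s : GroupLieAlgebra 𝓘(ℝ, EG) G →ₗ[ℝ] Cₛ^∞⟮𝓘(ℝ, EQ); F →L[ℝ] ℝ, Wong.DualFib V⟯)
    (hs : Wong.HasCoadGenerators Ψ s)
    -- the given pair `(∇₀, F₀)`
    (nabla₀ : CovariantDerivative 𝓘(ℝ, EQ) F V)
    (B₀ : ∀ q : Q, TangentSpace 𝓘(ℝ, EQ) q →L[ℝ] TangentSpace 𝓘(ℝ, EQ) q →L[ℝ] Wong.DualFib V q)
    (h₀ : Wong.IsCompatiblePair Ψ nabla₀ B₀)
    -- the choice of `a` with `g = exp a` in the averaging formula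
    (log : G → GroupLieAlgebra 𝓘(ℝ, EG) G) (hlog : Wong.IsLogChoice μ log) :
    -- the action is fibrewise linear and lifts to the phase space
    ∃ (Φ : G → ∀ q, V q →L[ℝ] V q)
      (Φbar : G → C^∞⟮Wong.phaseModel EQ F, Wong.PhaseSpace EQ F V;
        Wong.phaseModel EQ F, Wong.PhaseSpace EQ F V⟯),
      Wong.ActsBy (F := F) Φ ∧ Wong.IsLiftedAction Φ Φbar ∧
    -- the formulas define a one-form and a two-form
    ∃ (A : ∀ q : Q, TangentSpace 𝓘(ℝ, EQ) q →L[ℝ] Wong.DualFib V q)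
      (B : ∀ q : Q, TangentSpace 𝓘(ℝ, EQ) q →L[ℝ] TangentSpace 𝓘(ℝ, EQ) q →L[ℝ] Wong.DualFib V q),
      Wong.IsSmoothOneForm F A ∧ Wong.IsAveragedForm Ψ nabla₀ s μ log A ∧
      Wong.IsGaugedForm Ψ nabla₀ B₀ A B ∧
    -- the pair `(∇₀ - ad_A^*, B)` is compatible and invariant
      Wong.IsCompatiblePair Ψ (nabla₀.addOneForm (Wong.negCoadForm Ψ A)) B ∧
      Wong.IsInvariantPair Φ (nabla₀.addOneForm (Wong.negCoadForm Ψ A)) B ∧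
    -- it induces a Poisson structure on the phase space, which is invariant
      ∃ Pi : Wong.PoissonStructure (Wong.phaseModel EQ F) (Wong.PhaseSpace EQ F V),
        Wong.IsGaugePoisson Ψ (nabla₀.addOneForm (Wong.negCoadForm Ψ A)) B Pi ∧
        (∀ Pi', Wong.IsGaugePoisson Ψ (nabla₀.addOneForm (Wong.negCoadForm Ψ A)) B Pi' →
          Pi' = Pi) ∧
        (∀ (g : G) (f h : Wong.PhaseFun EQ F V),
          Pi.br (f.comp (Φbar g)) (h.comp (Φbar g)) = (Pi.br f h).comp (Φbar g)) ∧
    -- and, for every pseudo-Riemannian metric on `Q`, a Wong system, which is invariant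
        ∀ met : Wong.PseudoMetric EQ Q, ∃ H : Wong.PhaseFun EQ F V,
          (∀ z, H z = Wong.kinetic met z) ∧
          (∀ g : G, H.comp (Φbar g) = H) ∧
          (∀ (g : G) (J : Set ℝ) (c : ℝ → Wong.PhaseSpace EQ F V), IsOpen J →
            Wong.IsHamiltonianCurve Pi H J c →
            Wong.IsHamiltonianCurve Pi H J (fun t => Φbar g (c t))) := by
  obtain ⟨Φ, hΦ, hΨ⟩ := hs.exists_actsBy μ hlog
  obtain ⟨Φbar, hbar⟩ := hΦ.exists_lift (EG := EG) (EQ := EQ) inferInstance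
  obtain ⟨A, hA, hAv⟩ := Wong.exists_isAveragedForm Ψ h₀.smooth_connection s hlog
  obtain ⟨B, hB⟩ := Wong.exists_gauged_twoForm Ψ nabla₀ hA B₀
  have hc := h₀.gauge hA hB
  have hinv := hAv.isInvariantPair h₀ hs hΦ hlog hc
  have hP := Wong.isGaugePoisson_gaugePoisson hc
  have hPinv := hP.invariant hinv (fun g ζ => hΦ.smoothSec (EG := EG) inferInstance g ζ.contMDiff)
    hbar hΦ.inv_apply hΨ
  refine ⟨Φ, Φbar, hΦ, hbar, A, B, hA, hAv, hB, hc, hinv, Wong.gaugePoisson hc, hP,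
    fun Pi' h' => h'.unique hP, hPinv, fun met => ⟨Wong.kineticFun met, fun z => rfl,
    hbar.comp_kineticFun met, fun g J c _ h => h.comp (hPinv g) (hbar.comp_kineticFun met g)⟩⟩
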